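/- **Notation.** Let $\mathcal A=\{x+\sigma y:\ x,y\in\mathbb R\}$, $\sigma^2=1$, be the algebra of Lorentz numbers, with conjugation $\overline{x+\sigma y}=x-\sigma y$, and let $\mathbb H^{\mathcal A}=\{a_0 1+a_1I+a_2J+a_3K:\ a_i\in\mathcal A\}$ be the quaternions with coefficients in $\mathcal A$. For $q=a_01+a_1I+a_2J+a_3K$ put $\bar q=a_01-a_1I-a_2J-a_3K$ and $\hat q=\overline{a_0}1+\overline{a_1}I+\overline{a_2}J+\overline{a_3}K$. Let $Spin(4)=\{q\in\mathbb H^{\mathcal A}:\ a_0^2+a_1^2+a_2^2+a_3^2=1\}$ (so $q^{-1}=\bar q$ on $Spin(4)$), and identify $\mathbb R^4$ with $\{\sigma x_01+x_1I+x_2J+x_3K:\ x_i\in\mathbb R\}\subset\mathbb H^{\mathcal A}$. The functions $\cos,\sin$ on $\mathcal A$ are defined by their power series. A map $f$ from an open set $\mathcal U\subset\mathcal A$ to $\mathcal A$ or $\mathbb H^{\mathcal A}$ is *conformal* if it is smooth and $df_a(\sigma h)=\sigma\,df_a(h)$ for all $a\in\mathcal U$, $h\in\mathcal A$; then $df=f'\,da$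 with $f'=\partial_xf$. For an immersed surface in $\mathbb R^4$, $K$ is the Gauss curvature of the induced metric and $K_N$ the curvature of the normal connection; the Gauss map $G=u_1\wedge u_2\in\Lambda^2\mathbb R^4$ ($(u_1,u_2)$ a positive orthonormal basis of the tangent plane, for a local orientation) is *regular* if $dG$ is injective at every point. **Representation data.** Let $\mathcal U\subset\mathcal A$ be open. Let $\psi=\theta_1+\sigma\theta_2:\mathcal U\to\mathcal A$ be conformal ($\theta_1,\theta_2$ real valued), let $\lambda,\mu:\mathcal U\to\mathbb R$ be smooth with $\lambda\mu>0$ and $$\partial_x\mu=\lambda\,\partial_x\theta_2,\qquad \partial_y\lambda=-\mu\,\partial_y\theta_2,$$ and let $g:\mathcal U\to Spin(4)$ be conformal with $g'g^{-1}=\cos\psi\,J+\sin\psi\,K$. Let $\omega_2,\omega_3$ be the real one-forms on $\mathcal U$ dual to the vector fields $$\underline{e_2}=\tfrac1\lambda\sin\theta_1+\sigma\,\tfrac1\mu\cos\theta_1,\qquad \underline{e_3}=-\tfrac1\lambda\cos\theta_1+\sigma\,\tfrac1\mu\sin\theta_1,$$ and set $\xi=g^{-1}(\omega_2J+\omega_3K)\hat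 g$. **Theorem.** (1) For such data, if $\mathcal U$ is simply connected then there is $F=\int\xi$, i.e. $F:\mathcal U\to\mathbb R^4\subset\mathbb H^{\mathcal A}$ with $dF=\xi$; and (for every open $\mathcal U$) every $F:\mathcal U\to\mathbb R^4$ with $dF=\xi$ is a smooth immersion with $K=K_N=0$. (2) Conversely, let $M$ be a smooth surface and $F:M\to\mathbb R^4$ a smooth immersion with $K=K_N=0$ and regular Gauss map. Then every point of $M$ lies in the domain of a smooth chart of $M$ onto an open set $\mathcal U\subset\mathcal A$ in which $F$ satisfies $dF=\xi$ for some data $(\psi,\lambda,\mu,g)$ on $\mathcal U$ as above. -/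

import Mathlib

open scoped ContDiff Manifold

noncomputable section

/-! ### Lorentz numbers -/

/-- The algebra `𝒜 = {x + σ y : x, y ∈ ℝ}` of Lorentz numbers, with `σ² = 1`
(`re` is `x` and `im` is `y`). -/
abbrev LorentzNumber : Type := QuadraticAlgebra ℝ 1 0

namespace LorentzNumber

/-- The element `σ`. -/
def sigma : LorentzNumber := ⟨0, 1⟩

theorem sigma_mul_sigma : sigma * sigma = 1 := by
  ext <;> simp [sigma, QuadraticAlgebra.re_one, QuadraticAlgebra.im_one]

/-- The identification of `𝒜` with `ℝ²` as a real vector space. -/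
def toProd : LorentzNumber →ₗ[ℝ] ℝ × ℝ where
  toFun a := (a.re, a.im)
  map_add' _ _ := rfl
  map_smul' _ _ := rfl

theorem toProd_injective : Function.Injective toProd := fun a b h => by
  have h' : (a.re, a.im) = (b.re, b.im) := h
  exact QuadraticAlgebra.ext (congrArg Prod.fst h') (congrArg Prod.snd h')

/-- A norm defining the usual topology of the finite dimensional real vector space `𝒜 ≃ ℝ²`. -/
instance instNormedAddCommGroup : NormedAddCommGroup LorentzNumber :=
  NormedAddCommGroup.induced LorentzNumber (ℝ × ℝ) toProd toProd_injective

instance instNormedSpace : NormedSpace ℝ LorentzNumber :=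
  NormedSpace.induced ℝ LorentzNumber (ℝ × ℝ) toProd

/-- The idempotent `(1 + σ) / 2`. -/
def ePlus : LorentzNumber := ⟨1 / 2, 1 / 2⟩

/-- The idempotent `(1 - σ) / 2`. -/
def eMinus : LorentzNumber := ⟨1 / 2, -(1 / 2)⟩

/-- Cosine on the Lorentz numbers: `cos θ = (1+σ)/2 cos s + (1-σ)/2 cos t` for
`θ = (1+σ)/2 s + (1-σ)/2 t`, that is, for `θ = x + σ y`, `s = x + y` and `t = x - y`.
It is the sum of the cosine series, see `hasSum_cos`. -/
def cos (θ : LorentzNumber) : LorentzNumber :=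
  Real.cos (θ.re + θ.im) • ePlus + Real.cos (θ.re - θ.im) • eMinus

/-- Sine on the Lorentz numbers; it is the sum of the sine series, see `hasSum_sin`. -/
def sin (θ : LorentzNumber) : LorentzNumber :=
  Real.sin (θ.re + θ.im) • ePlus + Real.sin (θ.re - θ.im) • eMinus

theorem pow_eq (θ : LorentzNumber) (n : ℕ) :
    θ ^ n = (θ.re + θ.im) ^ n • ePlus + (θ.re - θ.im) ^ n • eMinus := by
  induction n with
  | zero => ext <;> simp [ePlus, eMinus, QuadraticAlgebra.re_one, QuadraticAlgebra.im_one]; ring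
  | succ k ih =>
    rw [pow_succ, ih]
    ext <;> simp [ePlus, eMinus] <;> ring

theorem hasSum_cos (θ : LorentzNumber) :
    HasSum (fun n : ℕ => ((-1 : ℝ) ^ n / ((2 * n).factorial : ℝ)) • θ ^ (2 * n)) (cos θ) := by
  refine (((Real.hasSum_cos (θ.re + θ.im)).smul_const ePlus).add
    ((Real.hasSum_cos (θ.re - θ.im)).smul_const eMinus)).congr_fun ?_
  intro n
  rw [pow_eq, smul_add, smul_smul, smul_smul]
  congr 2 <;> ring

theorem hasSum_sin (θ : LorentzNumber) :
    HasSum (fun n : ℕ => ((-1 : ℝ) ^ n / ((2 * n + 1).factorial : ℝ)) • θ ^ (2 * n + 1))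
      (sin θ) := by
  refine (((Real.hasSum_sin (θ.re + θ.im)).smul_const ePlus).add
    ((Real.hasSum_sin (θ.re - θ.im)).smul_const eMinus)).congr_fun ?_
  intro n
  rw [pow_eq, smul_add, smul_smul, smul_smul]
  congr 2 <;> ring

end LorentzNumber

/-! ### Quaternions with coefficients in the Lorentz numbers -/

/-- `ℍ^𝒜 = {a₀ 1 + a₁ I + a₂ J + a₃ K : aᵢ ∈ 𝒜}`. Its quaternionic conjugation
`a₀ 1 - a₁ I - a₂ J - a₃ K` is `star`. -/
abbrev LorentzQuaternion : Type := Quaternion LorentzNumber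

/-- Euclidean four-space. -/
abbrev R4 : Type := EuclideanSpace ℝ (Fin 4)

namespace LorentzQuaternion

/-- The identification of `ℍ^𝒜` with `𝒜⁴` as a real vector space. -/
def toProd : LorentzQuaternion →ₗ[ℝ]
    LorentzNumber × LorentzNumber × LorentzNumber × LorentzNumber where
  toFun q := (q.re, q.imI, q.imJ, q.imK)
  map_add' _ _ := rfl
  map_smul' _ _ := rfl

theorem toProd_injective : Function.Injective toProd := fun p q h => by
  have h' : (p.re, p.imI, p.imJ, p.imK) = (q.re, q.imI, q.imJ, q.imK) := h
  simp only [Prod.mk.injEq] at h'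
  obtain ⟨h0, h1, h2, h3⟩ := h'
  apply Quaternion.ext
  exacts [h0, h1, h2, h3]

/-- A norm defining the usual topology of the finite dimensional real vector space `ℍ^𝒜 ≃ ℝ⁸`. -/
instance instNormedAddCommGroup : NormedAddCommGroup LorentzQuaternion :=
  NormedAddCommGroup.induced LorentzQuaternion
    (LorentzNumber × LorentzNumber × LorentzNumber × LorentzNumber) toProd toProd_injective

instance instNormedSpace : NormedSpace ℝ LorentzQuaternion :=
  NormedSpace.induced ℝ LorentzQuaternion
    (LorentzNumber × LorentzNumber × LorentzNumber × LorentzNumber) toProd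

/-- The quaternion `J`. -/
def J : LorentzQuaternion := ⟨0, 0, 1, 0⟩

/-- The quaternion `K`. -/
def K : LorentzQuaternion := ⟨0, 0, 0, 1⟩

/-- `ξ ↦ ξ̂`: conjugation `x + σ y ↦ x - σ y` of each of the four coefficients. -/
def hat (q : LorentzQuaternion) : LorentzQuaternion :=
  ⟨star q.re, star q.imI, star q.imJ, star q.imK⟩

/-- `Spin(4) = {a ∈ ℍ^𝒜 : H(a, a) = 1}` with `H(a, a) = a₀² + a₁² + a₂² + a₃² ∈ 𝒜`.
For such `a` one has `star a * a = a * star a = 1`, that is, `a⁻¹ = star a`. -/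
def spin4 : Set LorentzQuaternion :=
  {a | a.re ^ 2 + a.imI ^ 2 + a.imJ ^ 2 + a.imK ^ 2 = 1}

/-- The inclusion `ℝ⁴ ⊂ ℍ^𝒜`, `(x₀, x₁, x₂, x₃) ↦ σ x₀ 1 + x₁ I + x₂ J + x₃ K`. -/
def ofR4 (x : R4) : LorentzQuaternion := ⟨⟨0, x 0⟩, ⟨x 1, 0⟩, ⟨x 2, 0⟩, ⟨x 3, 0⟩⟩

end LorentzQuaternion

/-! ### Conformal maps -/

/-- Conformal maps on an open subset `U` of `𝒜` with values in an `𝒜`-module: smooth maps whose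
differential commutes with `σ`. -/
def IsLorentzConformalOn {V : Type*} [NormedAddCommGroup V] [NormedSpace ℝ V]
    [Module LorentzNumber V] (f : LorentzNumber → V) (U : Set LorentzNumber) : Prop :=
  ContDiffOn ℝ ∞ f U ∧
    ∀ a ∈ U, ∀ h : LorentzNumber,
      fderiv ℝ f a (LorentzNumber.sigma * h) = LorentzNumber.sigma • fderiv ℝ f a h

/-- The derivative `f'` of a conformal map, characterized by `df = f' da`; it is the partial
derivative in the direction `1`. -/
def lorentzDeriv {V : Type*} [NormedAddCommGroup V] [NormedSpace ℝ V]
    (f : LorentzNumber → V) (a : LorentzNumber) : V := fderiv ℝ f a 1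

/-! ### Geometry of immersed surfaces of `ℝ⁴`

A parametrized surface is a map `f : E → ℝ⁴`, considered on an open subset of a two-dimensional
real vector space `E`. -/

section Surfaces

variable {E : Type*} [NormedAddCommGroup E] [NormedSpace ℝ E]

/-- Smooth immersions on the open set `U`. -/
def IsImmersedOn (f : E → R4) (U : Set E) : Prop :=
  ContDiffOn ℝ ∞ f U ∧ ∀ p ∈ U, Function.Injective (fderiv ℝ f p)

/-- The tangent plane of `f` at `p`. -/
def tangentPlane (f : E → R4) (p : E) : Submodule ℝ R4 :=
  LinearMap.range (fderiv ℝ f p : E →ₗ[ℝ] R4)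

/-- Covariant derivative of a vector field `Y` along `f` in the direction `u` for the
Levi-Civita connection of the induced metric: the tangential part of the derivative. -/
def tangentCov (f : E → R4) (u : E) (Y : E → R4) : E → R4 :=
  fun p => (tangentPlane f p).starProjection (fderiv ℝ Y p u)

/-- Covariant derivative for the connection of the normal bundle: the normal part of the
derivative. -/
def normalCov (f : E → R4) (u : E) (N : E → R4) : E → R4 :=
  fun p => (tangentPlane f p)ᗮ.starProjection (fderiv ℝ N p u)

/-- Squared area of the parallelogram spanned by `df(u)` and `df(v)`, i.e. `EG - F²`. -/
def areaSq (f : E → R4) (u v : E) (p : E) : ℝ :=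
  ‖fderiv ℝ f p u‖ ^ 2 * ‖fderiv ℝ f p v‖ ^ 2 - inner ℝ (fderiv ℝ f p u) (fderiv ℝ f p v) ^ 2

/-- The Gauss curvature `⟨R(u, v) v, u⟩ / (|u|²|v|² - ⟨u, v⟩²)` of the induced metric, where
`R(u, v) = ∇_u ∇_v - ∇_v ∇_u` for the (commuting) constant vector fields `u`, `v` on `E`.
It does not depend on the basis `(u, v)` of `E`. -/
def gaussCurvature (f : E → R4) (u v : E) (p : E) : ℝ :=
  inner ℝ
    (tangentCov f u (tangentCov f v fun q => fderiv ℝ f q v) p -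
      tangentCov f v (tangentCov f u fun q => fderiv ℝ f q v) p)
    (fderiv ℝ f p u) / areaSq f u v p

/-- The normal curvature `⟨R^⊥(e₂, e₃) n₁, n₀⟩`, for an orthonormal basis `(n₀, n₁)` of the normal
plane at `p` and the orthonormal basis `(e₂, e₃)` of the tangent plane with the orientation of
`(u, v)`. The vector `n₁` is extended to the normal field `q ↦ (normal part of n₁ at q)`. A change
of orientation of one of the two bases changes the sign; otherwise the value does not depend on
the choices. -/
def normalCurvature (f : E → R4) (u v : E) (n₀ n₁ : R4) (p : E) : ℝ :=
  inner ℝ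
    (normalCov f u (normalCov f v fun q => (tangentPlane f q)ᗮ.starProjection n₁) p -
      normalCov f v (normalCov f u fun q => (tangentPlane f q)ᗮ.starProjection n₁) p)
    n₀ / Real.sqrt (areaSq f u v p)

/-- `K = K_N = 0` on `U`. -/
def HasZeroCurvaturesOn (f : E → R4) (U : Set E) : Prop :=
  ∀ p ∈ U, ∀ u v : E, LinearIndependent ℝ ![u, v] →
    gaussCurvature f u v p = 0 ∧
      ∀ n₀ ∈ (tangentPlane f p)ᗮ, ∀ n₁ ∈ (tangentPlane f p)ᗮ, Orthonormal ℝ ![n₀, n₁] →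
        normalCurvature f u v n₀ n₁ p = 0

/-- The bivector `u ∧ v` of `ℝ⁴`, given by its Plücker coordinates. -/
def wedge (u v : R4) : Fin 4 → Fin 4 → ℝ := fun i j => u i * v j - u j * v i

/-- The Gauss map `p ↦ e₂ ∧ e₃` into the unit simple bivectors, `(e₂, e₃)` being an orthonormal
basis of the tangent plane with the orientation of `(u, v)`. -/
def gaussMap (f : E → R4) (u v : E) (p : E) : Fin 4 → Fin 4 → ℝ :=
  (Real.sqrt (areaSq f u v p))⁻¹ • wedge (fderiv ℝ f p u) (fderiv ℝ f p v)

/-- The Gauss map is regular: its differential is injective at every point of `U`. -/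
def HasRegularGaussMapOn (f : E → R4) (U : Set E) : Prop :=
  ∀ p ∈ U, ∀ u v : E, LinearIndependent ℝ ![u, v] →
    Function.Injective (fderiv ℝ (gaussMap f u v) p)

end Surfaces

/-! ### The local representation -/

/-- The vector `e₂ = sin θ₁ / l + σ cos θ₁ / m`, with `ψ = θ₁ + σ θ₂`. -/
def frameTwo (ψ : LorentzNumber → LorentzNumber) (l m : LorentzNumber → ℝ)
    (a : LorentzNumber) : LorentzNumber :=
  ⟨Real.sin (ψ a).re * (1 / l a), Real.cos (ψ a).re * (1 / m a)⟩

/-- The vector `e₃ = - cos θ₁ / l + σ sin θ₁ / m`, with `ψ = θ₁ + σ θ₂`. -/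
def frameThree (ψ : LorentzNumber → LorentzNumber) (l m : LorentzNumber → ℝ)
    (a : LorentzNumber) : LorentzNumber :=
  ⟨-Real.cos (ψ a).re * (1 / l a), Real.sin (ψ a).re * (1 / m a)⟩

/-- The data of the representation on an open set `U ⊂ 𝒜`. -/
structure IsRepresentationData (U : Set LorentzNumber) (ψ : LorentzNumber → LorentzNumber)
    (l m : LorentzNumber → ℝ) (g : LorentzNumber → LorentzQuaternion)
    (ω₂ ω₃ : LorentzNumber → (LorentzNumber →L[ℝ] ℝ)) : Prop where
  psi_conformal : IsLorentzConformalOn ψ U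
  l_smooth : ContDiffOn ℝ ∞ l U
  m_smooth : ContDiffOn ℝ ∞ m U
  mul_pos : ∀ a ∈ U, 0 < l a * m a
  /-- `∂ₓ m = l ∂ₓ θ₂`. -/
  system_x : ∀ a ∈ U, fderiv ℝ m a 1 = l a * fderiv ℝ (fun b => (ψ b).im) a 1
  /-- `∂_y l = - m ∂_y θ₂`. -/
  system_y : ∀ a ∈ U, fderiv ℝ l a LorentzNumber.sigma =
    -(m a) * fderiv ℝ (fun b => (ψ b).im) a LorentzNumber.sigma
  g_mem : ∀ a ∈ U, g a ∈ LorentzQuaternion.spin4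
  g_conformal : IsLorentzConformalOn g U
  /-- `g' g⁻¹ = cos ψ J + sin ψ K`. -/
  g_deriv : ∀ a ∈ U, lorentzDeriv g a * star (g a) =
    LorentzNumber.cos (ψ a) • LorentzQuaternion.J + LorentzNumber.sin (ψ a) • LorentzQuaternion.K
  /-- `(ω₂, ω₃)` is the dual coframe of `(e₂, e₃)`. -/
  dual : ∀ a ∈ U, ω₂ a (frameTwo ψ l m a) = 1 ∧ ω₂ a (frameThree ψ l m a) = 0 ∧
    ω₃ a (frameTwo ψ l m a) = 0 ∧ ω₃ a (frameThree ψ l m a) = 1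

/-- The one-form `ξ = g⁻¹ (ω₂ J + ω₃ K) ĝ` with values in `ℍ^𝒜`. -/
def representationForm (g : LorentzNumber → LorentzQuaternion)
    (ω₂ ω₃ : LorentzNumber → (LorentzNumber →L[ℝ] ℝ)) (a h : LorentzNumber) : LorentzQuaternion :=
  star (g a) * ((ω₂ a h) • LorentzQuaternion.J + (ω₃ a h) • LorentzQuaternion.K) *
    LorentzQuaternion.hat (g a)

/-- `F = ∫ ξ` on `U`: the `ℝ⁴`-valued function `F` satisfies `dF = ξ` in `ℝ⁴ ⊂ ℍ^𝒜`. -/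
def IsPrimitiveOn (F : LorentzNumber → R4) (ξ : LorentzNumber → LorentzNumber → LorentzQuaternion)
    (U : Set LorentzNumber) : Prop :=
  ∀ a ∈ U, DifferentiableAt ℝ F a ∧ ∀ h : LorentzNumber,
    LorentzQuaternion.ofR4 (fderiv ℝ F a h) = ξ a h

/-! ### Immersions of abstract surfaces -/

/-- The model space of smooth surfaces. -/
abbrev R2 : Type := EuclideanSpace ℝ (Fin 2)

section Manifold

variable {M : Type*} [TopologicalSpace M] [ChartedSpace R2 M]

/-- Smooth immersions of a smooth surface into `ℝ⁴`. -/
def IsSurfaceImmersion (F : M → R4) : Prop :=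
  ContMDiff 𝓘(ℝ, R2) 𝓘(ℝ, R4) ∞ F ∧
    ∀ p : M, Function.Injective (mfderiv 𝓘(ℝ, R2) 𝓘(ℝ, R4) F p)

/-- `K = K_N = 0` on the surface (both conditions are independent of the charts). -/
def SurfaceHasZeroCurvatures (F : M → R4) : Prop :=
  ∀ c ∈ atlas R2 M, HasZeroCurvaturesOn (F ∘ c.symm) c.target

/-- The Gauss map of the surface is regular (this is independent of the charts). -/
def SurfaceHasRegularGaussMap (F : M → R4) : Prop :=
  ∀ c ∈ atlas R2 M, HasRegularGaussMapOn (F ∘ c.symm) c.target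

end Manifold

end

/-! Everything splits along the idempotents `ePlus` and `eMinus`. A Lorentz quaternion becomes a
pair of real quaternions, `spin4` becomes S³ × S³ (`mem_spin4_iff`), and ℝ⁴ becomes the set of pairs
(X, -X̄), so a vector is recovered from the single quaternion X. For g = (g₊, g₋) the form ξ reads
g₊⁻¹(ω₂J + ω₃K)g₋ (`ofR4_eq_sandwich_iff`). Thus X ↦ g₊⁻¹Xg₋ is a moving orthonormal frame with J, K
tangent and 1, I normal (`IsFramedBy`). Put η± = dg± g±⁻¹. The connection form of the tangent bundle
is minus the sum of the I-parts of η₊ and η₋, that of the normal bundle is their difference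
(`connectionForm_tangent`, `connectionForm_normal`). Since a connection on a plane bundle has
curvature d(connection form) (`planeCov_commutator`), K = K_N = 0 says that both I-parts are closed.

Direct statement. Conformality and the equation for g'g⁻¹ say η± = d(x ± y)(cos(θ₁ ± θ₂)J + sin(θ₁ ±
θ₂)K). There is no I-part, so both bundles are flat. In the tangent frame rotated by θ₁ the normal
part of dξ vanishes identically, and the vanishing of its tangent part is the system for λ, μ,
modulo Cauchy–Riemann (`form_closed`). Local primitives are glued on a simply connected set by
lifting its identity map through a covering (`exists_primitive_of_simplyConnected`).

Converse. Left and right unit imaginary quaternions attached to the tangent planes give a local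
frame (g₊, g₋) (`exists_isFramedBy`). The closed I-parts are locally exact, and multiplying g± on
the left by cos φ + sin φ I removes them (`exists_parallel_frame`). The Maurer–Cartan equation then
makes the J- and K-parts closed and proportional (`structure_equations`), so η± = ds±(cos ψ± J + sin
ψ± K) with dψ± ∧ ds± = 0 (`exists_isPolarOn`). Regularity of the Gauss map forbids a common kernel
of η₊ and η₋, hence (s₊, s₋) are the idempotent coefficients of a chart with values in 𝒜. There dψ±
is a multiple of ds±, which is conformality of ψ. Finally the second derivatives of F are symmetric:
the normal components make the rotated coframe diagonal in dx, dy, which defines λ and μ, and the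
tangent components are the required system (`exists_isRepresentationData_of_adapted`). The sign of
λμ is an orientation, corrected by reversing s₊ (`IsPolarOn.flip`). -/

noncomputable section

open scoped Quaternion

open Quaternion

/-! ### Splitting along the idempotents -/

namespace LorentzNumber

/-- The coefficient of `ePlus`. -/
def plus : LorentzNumber →L[ℝ] ℝ :=
  LinearMap.toContinuousLinearMap
    { toFun := fun a => a.re + a.im
      map_add' := fun a b => by simp; ring
      map_smul' := fun c a => by simp; ring }

/-- The coefficient of `eMinus`. -/
def minus : LorentzNumber →L[ℝ] ℝ :=
  LinearMap.toContinuousLinearMap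
    { toFun := fun a => a.re - a.im
      map_add' := fun a b => by simp; ring
      map_smul' := fun c a => by simp; ring }

theorem plus_apply (a : LorentzNumber) : plus a = a.re + a.im := rfl
theorem minus_apply (a : LorentzNumber) : minus a = a.re - a.im := rfl

@[simp] theorem plus_star (a : LorentzNumber) : plus (star a) = minus a := by
  simp [plus_apply, minus_apply, sub_eq_add_neg]
@[simp] theorem minus_star (a : LorentzNumber) : minus (star a) = plus a := by
  simp [plus_apply, minus_apply]

theorem ext_plus_minus {a b : LorentzNumber} (h₁ : plus a = plus b) (h₂ : minus a = minus b) :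
    a = b := by
  simp only [plus_apply, minus_apply] at h₁ h₂
  ext <;> linarith

/-- The Lorentz number with given idempotent coefficients. -/
def ofPlusMinus (s t : ℝ) : LorentzNumber := s • ePlus + t • eMinus

@[simp] theorem plus_ofPlusMinus (s t : ℝ) : plus (ofPlusMinus s t) = s := by
  simp [plus_apply, ofPlusMinus, ePlus, eMinus]; ring
@[simp] theorem minus_ofPlusMinus (s t : ℝ) : minus (ofPlusMinus s t) = t := by
  simp [minus_apply, ofPlusMinus, ePlus, eMinus]; ring
@[simp] theorem plus_mul (a b : LorentzNumber) : plus (a * b) = plus a * plus b := by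
  simp [plus_apply]; ring
@[simp] theorem minus_mul (a b : LorentzNumber) : minus (a * b) = minus a * minus b := by
  simp [minus_apply]; ring
@[simp] theorem plus_one : plus 1 = 1 := by simp [plus_apply, QuadraticAlgebra.re_one,
  QuadraticAlgebra.im_one]
@[simp] theorem minus_one : minus 1 = 1 := by simp [minus_apply, QuadraticAlgebra.re_one,
  QuadraticAlgebra.im_one]
@[simp] theorem plus_sigma : plus sigma = 1 := by simp [plus_apply, sigma]
@[simp] theorem minus_sigma : minus sigma = -1 := by simp [minus_apply, sigma]
@[simp] theorem plus_cos (a : LorentzNumber) : plus (cos a) = Real.cos (plus a) := by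
  simp [plus_apply, cos, ePlus, eMinus]; ring
@[simp] theorem minus_cos (a : LorentzNumber) : minus (cos a) = Real.cos (minus a) := by
  simp [minus_apply, cos, ePlus, eMinus]; ring
@[simp] theorem plus_sin (a : LorentzNumber) : plus (sin a) = Real.sin (plus a) := by
  simp [plus_apply, sin, ePlus, eMinus]; ring
@[simp] theorem minus_sin (a : LorentzNumber) : minus (sin a) = Real.sin (minus a) := by
  simp [minus_apply, sin, ePlus, eMinus]; ring

/-- The real part as a continuous linear map. -/
def reCLM : LorentzNumber →L[ℝ] ℝ := (1 / 2 : ℝ) • (plus + minus)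
/-- The coefficient of `σ` as a continuous linear map. -/
def imCLM : LorentzNumber →L[ℝ] ℝ := (1 / 2 : ℝ) • (plus - minus)

theorem reCLM_apply (a : LorentzNumber) : reCLM a = a.re := by
  simp [reCLM, plus_apply, minus_apply]; ring
theorem imCLM_apply (a : LorentzNumber) : imCLM a = a.im := by
  simp [imCLM, plus_apply, minus_apply]; ring

theorem eq_smul_add_smul (h : LorentzNumber) : h = h.re • (1 : LorentzNumber) + h.im • sigma := by
  ext <;> simp [sigma, QuadraticAlgebra.re_one, QuadraticAlgebra.im_one]

end LorentzNumber

/-! ### Lorentz quaternions as pairs of real quaternions. -/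

namespace LorentzQuaternion

instance : FiniteDimensional ℝ LorentzQuaternion :=
  FiniteDimensional.of_injective toProd toProd_injective

/-- The `ePlus` component, as a function. -/
def plusFun (q : LorentzQuaternion) : ℍ[ℝ] :=
  ⟨LorentzNumber.plus q.re, LorentzNumber.plus q.imI, LorentzNumber.plus q.imJ,
    LorentzNumber.plus q.imK⟩

/-- The `eMinus` component, as a function. -/
def minusFun (q : LorentzQuaternion) : ℍ[ℝ] :=
  ⟨LorentzNumber.minus q.re, LorentzNumber.minus q.imI, LorentzNumber.minus q.imJ,
    LorentzNumber.minus q.imK⟩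

/-- The quaternion with given idempotent components, as a function. -/
def ofPlusMinusFun (x : ℍ[ℝ] × ℍ[ℝ]) : LorentzQuaternion :=
  ⟨LorentzNumber.ofPlusMinus x.1.re x.2.re, LorentzNumber.ofPlusMinus x.1.imI x.2.imI,
    LorentzNumber.ofPlusMinus x.1.imJ x.2.imJ, LorentzNumber.ofPlusMinus x.1.imK x.2.imK⟩

section Components

variable (q : LorentzQuaternion) (x : ℍ[ℝ] × ℍ[ℝ])

@[simp] theorem re_plusFun : (plusFun q).re = LorentzNumber.plus q.re := rfl
@[simp] theorem imI_plusFun : (plusFun q).imI = LorentzNumber.plus q.imI := rfl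
@[simp] theorem imJ_plusFun : (plusFun q).imJ = LorentzNumber.plus q.imJ := rfl
@[simp] theorem imK_plusFun : (plusFun q).imK = LorentzNumber.plus q.imK := rfl
@[simp] theorem re_minusFun : (minusFun q).re = LorentzNumber.minus q.re := rfl
@[simp] theorem imI_minusFun : (minusFun q).imI = LorentzNumber.minus q.imI := rfl
@[simp] theorem imJ_minusFun : (minusFun q).imJ = LorentzNumber.minus q.imJ := rfl
@[simp] theorem imK_minusFun : (minusFun q).imK = LorentzNumber.minus q.imK := rfl
@[simp] theorem re_ofPlusMinusFun :
    (ofPlusMinusFun x).re = LorentzNumber.ofPlusMinus x.1.re x.2.re := rfl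
@[simp] theorem imI_ofPlusMinusFun :
    (ofPlusMinusFun x).imI = LorentzNumber.ofPlusMinus x.1.imI x.2.imI := rfl
@[simp] theorem imJ_ofPlusMinusFun :
    (ofPlusMinusFun x).imJ = LorentzNumber.ofPlusMinus x.1.imJ x.2.imJ := rfl
@[simp] theorem imK_ofPlusMinusFun :
    (ofPlusMinusFun x).imK = LorentzNumber.ofPlusMinus x.1.imK x.2.imK := rfl
@[simp] theorem re_hat : (hat q).re = star q.re := rfl
@[simp] theorem imI_hat : (hat q).imI = star q.imI := rfl
@[simp] theorem imJ_hat : (hat q).imJ = star q.imJ := rfl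
@[simp] theorem imK_hat : (hat q).imK = star q.imK := rfl
@[simp] theorem re_J : J.re = 0 := rfl
@[simp] theorem imI_J : J.imI = 0 := rfl
@[simp] theorem imJ_J : J.imJ = 1 := rfl
@[simp] theorem imK_J : J.imK = 0 := rfl
@[simp] theorem re_K : K.re = 0 := rfl
@[simp] theorem imI_K : K.imI = 0 := rfl
@[simp] theorem imJ_K : K.imJ = 0 := rfl
@[simp] theorem imK_K : K.imK = 1 := rfl

end Components

theorem ext_plusFun_minusFun {p q : LorentzQuaternion} (h₁ : plusFun p = plusFun q)
    (h₂ : minusFun p = minusFun q) : p = q := by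
  rw [Quaternion.ext_iff] at h₁ h₂
  obtain ⟨a1, a2, a3, a4⟩ := h₁
  obtain ⟨b1, b2, b3, b4⟩ := h₂
  apply Quaternion.ext <;> apply LorentzNumber.ext_plus_minus <;> assumption

/-- The `ePlus` component. -/
def plus : LorentzQuaternion →L[ℝ] ℍ[ℝ] :=
  LinearMap.toContinuousLinearMap
    { toFun := plusFun
      map_add' := fun a b => by apply Quaternion.ext <;> simp
      map_smul' := fun c a => by apply Quaternion.ext <;> simp }

/-- The `eMinus` component. -/
def minus : LorentzQuaternion →L[ℝ] ℍ[ℝ] :=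
  LinearMap.toContinuousLinearMap
    { toFun := minusFun
      map_add' := fun a b => by apply Quaternion.ext <;> simp
      map_smul' := fun c a => by apply Quaternion.ext <;> simp }

theorem plus_apply (q : LorentzQuaternion) : plus q = plusFun q := rfl
theorem minus_apply (q : LorentzQuaternion) : minus q = minusFun q := rfl

theorem ext_plus_minus {p q : LorentzQuaternion} (h₁ : plus p = plus q) (h₂ : minus p = minus q) :
    p = q := ext_plusFun_minusFun h₁ h₂

/-- The quaternion with given idempotent components. -/
def ofPlusMinus : ℍ[ℝ] × ℍ[ℝ] →L[ℝ] LorentzQuaternion :=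
  LinearMap.toContinuousLinearMap
    { toFun := ofPlusMinusFun
      map_add' := fun a b => by
        apply Quaternion.ext <;> apply LorentzNumber.ext_plus_minus <;> simp
      map_smul' := fun c a => by
        apply Quaternion.ext <;> apply LorentzNumber.ext_plus_minus <;> simp }

theorem ofPlusMinus_apply (x : ℍ[ℝ] × ℍ[ℝ]) : ofPlusMinus x = ofPlusMinusFun x := rfl

@[simp] theorem plus_ofPlusMinus (x : ℍ[ℝ] × ℍ[ℝ]) : plus (ofPlusMinus x) = x.1 := by
  apply Quaternion.ext <;> simp [plus_apply, ofPlusMinus_apply]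
@[simp] theorem minus_ofPlusMinus (x : ℍ[ℝ] × ℍ[ℝ]) : minus (ofPlusMinus x) = x.2 := by
  apply Quaternion.ext <;> simp [minus_apply, ofPlusMinus_apply]
@[simp] theorem plus_mul (p q : LorentzQuaternion) : plus (p * q) = plus p * plus q := by
  apply Quaternion.ext <;> simp [plus_apply]
@[simp] theorem minus_mul (p q : LorentzQuaternion) : minus (p * q) = minus p * minus q := by
  apply Quaternion.ext <;> simp [minus_apply]
@[simp] theorem plus_star (q : LorentzQuaternion) : plus (star q) = star (plus q) := by
  apply Quaternion.ext <;> simp [plus_apply]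
@[simp] theorem minus_star (q : LorentzQuaternion) : minus (star q) = star (minus q) := by
  apply Quaternion.ext <;> simp [minus_apply]
@[simp] theorem plus_hat (q : LorentzQuaternion) : plus (hat q) = minus q := by
  apply Quaternion.ext <;> simp [plus_apply, minus_apply]
@[simp] theorem minus_hat (q : LorentzQuaternion) : minus (hat q) = plus q := by
  apply Quaternion.ext <;> simp [plus_apply, minus_apply]
@[simp] theorem plus_smul (c : LorentzNumber) (q : LorentzQuaternion) :
    plus (c • q) = LorentzNumber.plus c • plus q := by
  apply Quaternion.ext <;> simp [plus_apply]
@[simp] theorem minus_smul (c : LorentzNumber) (q : LorentzQuaternion) :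
    minus (c • q) = LorentzNumber.minus c • minus q := by
  apply Quaternion.ext <;> simp [minus_apply]

end LorentzQuaternion

/-! ### Real quaternions -/

namespace Quaternion

/-- The quaternion `I`. -/
def unitI : ℍ[ℝ] := ⟨0, 1, 0, 0⟩
/-- The quaternion `J`. -/
def unitJ : ℍ[ℝ] := ⟨0, 0, 1, 0⟩
/-- The quaternion `K`. -/
def unitK : ℍ[ℝ] := ⟨0, 0, 0, 1⟩

@[simp] theorem re_unitI : unitI.re = 0 := rfl
@[simp] theorem imI_unitI : unitI.imI = 1 := rfl
@[simp] theorem imJ_unitI : unitI.imJ = 0 := rfl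
@[simp] theorem imK_unitI : unitI.imK = 0 := rfl
@[simp] theorem re_unitJ : unitJ.re = 0 := rfl
@[simp] theorem imI_unitJ : unitJ.imI = 0 := rfl
@[simp] theorem imJ_unitJ : unitJ.imJ = 1 := rfl
@[simp] theorem imK_unitJ : unitJ.imK = 0 := rfl
@[simp] theorem re_unitK : unitK.re = 0 := rfl
@[simp] theorem imI_unitK : unitK.imI = 0 := rfl
@[simp] theorem imJ_unitK : unitK.imJ = 0 := rfl
@[simp] theorem imK_unitK : unitK.imK = 1 := rfl

/-- The unit quaternion `cos t J + sin t K`. -/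
def circleJK (t : ℝ) : ℍ[ℝ] := Real.cos t • unitJ + Real.sin t • unitK

/-- The coordinate `re` as a continuous linear map. -/
def reCLM : ℍ[ℝ] →L[ℝ] ℝ := LinearMap.toContinuousLinearMap
  { toFun := fun q => q.re, map_add' := fun _ _ => rfl, map_smul' := fun _ _ => rfl }
/-- The coordinate `imI` as a continuous linear map. -/
def imICLM : ℍ[ℝ] →L[ℝ] ℝ := LinearMap.toContinuousLinearMap
  { toFun := fun q => q.imI, map_add' := fun _ _ => rfl, map_smul' := fun _ _ => rfl }
/-- The coordinate `imJ` as a continuous linear map. -/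
def imJCLM : ℍ[ℝ] →L[ℝ] ℝ := LinearMap.toContinuousLinearMap
  { toFun := fun q => q.imJ, map_add' := fun _ _ => rfl, map_smul' := fun _ _ => rfl }
/-- The coordinate `imK` as a continuous linear map. -/
def imKCLM : ℍ[ℝ] →L[ℝ] ℝ := LinearMap.toContinuousLinearMap
  { toFun := fun q => q.imK, map_add' := fun _ _ => rfl, map_smul' := fun _ _ => rfl }

/-- The isometry `x₀ + x₁ I + x₂ J + x₃ K ↦ (x₀, x₁, x₂, x₃)`. -/
def toR4 : ℍ[ℝ] ≃ₗᵢ[ℝ] R4 := linearIsometryEquivTuple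

@[simp] theorem reCLM_apply (q : ℍ[ℝ]) : reCLM q = q.re := rfl
@[simp] theorem imICLM_apply (q : ℍ[ℝ]) : imICLM q = q.imI := rfl
@[simp] theorem imJCLM_apply (q : ℍ[ℝ]) : imJCLM q = q.imJ := rfl
@[simp] theorem imKCLM_apply (q : ℍ[ℝ]) : imKCLM q = q.imK := rfl

theorem star_mul_self_of_norm {g : ℍ[ℝ]} (h : ‖g‖ = 1) : star g * g = 1 := by
  rw [Quaternion.star_mul_self, Quaternion.normSq_eq_norm_mul_self, h]; simp
theorem self_mul_star_of_norm {g : ℍ[ℝ]} (h : ‖g‖ = 1) : g * star g = 1 := by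
  rw [Quaternion.self_mul_star, Quaternion.normSq_eq_norm_mul_self, h]; simp

end Quaternion

/-! ### Spin(4) as S³ × S³ and the position of ℝ⁴ in ℍ × ℍ. -/

namespace LorentzQuaternion

@[simp] theorem plus_J : plus J = unitJ := by
  apply Quaternion.ext <;> simp [plus_apply]
@[simp] theorem minus_J : minus J = unitJ := by
  apply Quaternion.ext <;> simp [minus_apply]
@[simp] theorem plus_K : plus K = unitK := by
  apply Quaternion.ext <;> simp [plus_apply]
@[simp] theorem minus_K : minus K = unitK := by
  apply Quaternion.ext <;> simp [minus_apply]

/-- Both coefficient maps are ring homomorphisms on 𝒜 and together they separate points, so one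
equation in 𝒜 is the same as two real sphere equations. -/
theorem mem_spin4_iff {q : LorentzQuaternion} : q ∈ spin4 ↔ ‖plus q‖ = 1 ∧ ‖minus q‖ = 1 := by
  have hn : ∀ x : ℍ[ℝ], ‖x‖ = 1 ↔ x.re ^ 2 + x.imI ^ 2 + x.imJ ^ 2 + x.imK ^ 2 = 1 := by
    intro x
    rw [← Quaternion.normSq_def', Quaternion.normSq_eq_norm_mul_self]
    constructor
    · intro h; rw [h]; norm_num
    · intro h; nlinarith [norm_nonneg x]
  rw [hn, hn]
  simp only [plus_apply, minus_apply, re_plusFun, imI_plusFun, imJ_plusFun, imK_plusFun,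
    re_minusFun, imI_minusFun, imJ_minusFun, imK_minusFun]
  constructor
  · intro h
    have h1 := congrArg LorentzNumber.plus h
    have h2 := congrArg LorentzNumber.minus h
    simp only [pow_two, map_add, LorentzNumber.plus_mul, LorentzNumber.minus_mul,
      LorentzNumber.plus_one, LorentzNumber.minus_one] at h1 h2 ⊢
    exact ⟨h1, h2⟩
  · rintro ⟨h1, h2⟩
    simp only [pow_two] at h1 h2
    apply LorentzNumber.ext_plus_minus <;>
    simp only [pow_two, map_add, LorentzNumber.plus_mul, LorentzNumber.minus_mul,
      LorentzNumber.plus_one, LorentzNumber.minus_one] <;> assumption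

@[simp] theorem re_ofR4 (x : R4) : (ofR4 x).re = ⟨0, x 0⟩ := rfl
@[simp] theorem imI_ofR4 (x : R4) : (ofR4 x).imI = ⟨x 1, 0⟩ := rfl
@[simp] theorem imJ_ofR4 (x : R4) : (ofR4 x).imJ = ⟨x 2, 0⟩ := rfl
@[simp] theorem imK_ofR4 (x : R4) : (ofR4 x).imK = ⟨x 3, 0⟩ := rfl
@[simp] theorem _root_.Quaternion.re_toR4_symm (x : R4) :
    (toR4.symm x).re = x 0 := rfl
@[simp] theorem _root_.Quaternion.imI_toR4_symm (x : R4) :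
    (toR4.symm x).imI = x 1 := rfl
@[simp] theorem _root_.Quaternion.imJ_toR4_symm (x : R4) :
    (toR4.symm x).imJ = x 2 := rfl
@[simp] theorem _root_.Quaternion.imK_toR4_symm (x : R4) :
    (toR4.symm x).imK = x 3 := rfl

theorem plus_ofR4 (x : R4) : plus (ofR4 x) = toR4.symm x := by
  apply Quaternion.ext <;> simp [plus_apply, LorentzNumber.plus_apply]
-- The coefficient σ sits on the real part only, so passing to the other idempotent flips exactly
-- that sign. ℝ⁴ is therefore the graph of X ↦ -X̄ in ℍ × ℍ.
theorem minus_ofR4 (x : R4) : minus (ofR4 x) = -star (toR4.symm x) := by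
  apply Quaternion.ext <;> simp [minus_apply, LorentzNumber.minus_apply]

/-- The `ePlus` component of `ofR4` determines the vector. -/
theorem ofR4_eq_sandwich_iff (x : R4) (g y : LorentzQuaternion) (hy : plus y = minus y)
    (hs : star (plus y) = -plus y) :
    ofR4 x = star g * y * hat g ↔
      x = toR4 (star (plus g) * plus y * minus g) := by
  constructor
  · intro h
    have h1 := congrArg plus h
    rw [plus_ofR4, plus_mul, plus_mul, plus_star, plus_hat] at h1
    rw [← h1, LinearIsometryEquiv.apply_symm_apply]
  · rintro rfl
    apply ext_plus_minus
    · rw [plus_ofR4, LinearIsometryEquiv.symm_apply_apply, plus_mul, plus_mul, plus_star, plus_hat]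
    -- The second component carries no new information: hat swaps the two components of g, and the
    -- conjugate of g₊⁻¹Yg₋ is -g₋⁻¹Yg₊ for imaginary Y.
    · rw [minus_ofR4, LinearIsometryEquiv.symm_apply_apply, minus_mul, minus_mul, minus_star,
        minus_hat, ← hy, star_mul, star_mul, star_star, hs, mul_assoc]
      simp only [neg_mul, mul_neg, neg_neg]

end LorentzQuaternion

/-! ### Conformal maps -/

section Conformal

variable {V : Type*} [NormedAddCommGroup V] [NormedSpace ℝ V] [Module LorentzNumber V]
  {f : LorentzNumber → V} {U : Set LorentzNumber}

theorem isLorentzConformalOn_of_fderiv (hf : ContDiffOn ℝ ∞ f U) (w : LorentzNumber → V)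
    (h : ∀ a ∈ U, ∀ h, fderiv ℝ f a h = h • w a) : IsLorentzConformalOn f U :=
  ⟨hf, fun a ha k => by rw [h a ha, h a ha, smul_smul]⟩

/-- A real-linear map commuting with σ is 𝒜-linear, hence determined by its value at 1. -/
theorem IsLorentzConformalOn.fderiv_eq [IsScalarTower ℝ LorentzNumber V]
    (hf : IsLorentzConformalOn f U) {a : LorentzNumber} (ha : a ∈ U) (h : LorentzNumber) :
    fderiv ℝ f a h = h • lorentzDeriv f a := by
  have h1 := hf.2 a ha 1
  rw [mul_one] at h1
  conv_lhs => rw [LorentzNumber.eq_smul_add_smul h]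
  rw [map_add, map_smul, map_smul, h1]
  conv_rhs => rw [LorentzNumber.eq_smul_add_smul h]
  rw [add_smul, smul_assoc, smul_assoc, one_smul]
  rfl

end Conformal

/-! ### Primitives of closed one-forms -/

section Primitive

variable {E F : Type*} [NormedAddCommGroup E] [NormedSpace ℝ E] [NormedAddCommGroup F]
  [NormedSpace ℝ F]

theorem fderiv_clm_apply_const {η : E → E →L[ℝ] F} {p : E} (h : DifferentiableAt ℝ η p) (u v : E) :
    fderiv ℝ η p u v = fderiv ℝ (fun q => η q v) p u := by
  rw [fderiv_clm_apply h (differentiableAt_const v)]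
  simp

/-- Closed smooth one-forms on a ball have smooth primitives. -/
theorem exists_primitive_ball [CompleteSpace F] {η : E → E →L[ℝ] F} {p : E} {r : ℝ}
    (hη : ContDiffOn ℝ ∞ η (Metric.ball p r))
    (hc : ∀ q ∈ Metric.ball p r, ∀ u v,
      fderiv ℝ (fun x => η x v) q u = fderiv ℝ (fun x => η x u) q v) :
    ∃ φ : E → F, ContDiffOn ℝ ∞ φ (Metric.ball p r) ∧
      ∀ q ∈ Metric.ball p r, HasFDerivAt φ (η q) q := by
  have hd : DifferentiableOn ℝ η (Metric.ball p r) := hη.differentiableOn (by simp)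
  obtain ⟨φ, hφ⟩ := (convex_ball p r).exists_forall_hasFDerivAt_of_fderiv_symmetric
    Metric.isOpen_ball hd (fun a ha x y => by
      have := hd.differentiableAt (Metric.isOpen_ball.mem_nhds ha)
      rw [fderiv_clm_apply_const this, fderiv_clm_apply_const this, hc a ha])
  refine ⟨φ, ?_, hφ⟩
  -- Smoothness comes for free, because the derivative of the primitive is the smooth form itself.
  rw [contDiffOn_infty_iff_fderiv_of_isOpen Metric.isOpen_ball]
  exact ⟨fun q hq => (hφ q hq).differentiableAt.differentiableWithinAt,
    hη.congr fun q hq => (hφ q hq).fderiv⟩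

/-- A type synonym carrying the discrete topology. -/
def DiscreteCopy (F : Type*) : Type _ := F

instance (F : Type*) : TopologicalSpace (DiscreteCopy F) := ⊥
instance (F : Type*) : DiscreteTopology (DiscreteCopy F) := ⟨rfl⟩

/-- The bundle of germs of primitives of a one-form, given local primitives `f i` on
neighbourhoods `s i`. -/
def primitiveBundle {U : Set E} (f : U → E → F) (s : U → Set U) (hs : ∀ i, IsOpen (s i))
    (hmem : ∀ i, i ∈ s i)
    (hconst : ∀ i j : U, ∀ x ∈ s i ∩ s j,
      ∀ᶠ y : U in nhds x, f i y - f j y = f i x - f j x) :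
    FiberBundleCore U U (DiscreteCopy F) where
  baseSet := s
  isOpen_baseSet := hs
  indexAt := id
  mem_baseSet_at := hmem
  -- The fibre coordinate v in the trivialization `i` encodes the germ of the primitive `f i` plus a
  -- constant, with value v + `f i x` at x. Keeping that value fixed while changing to `f j` gives
  -- this formula.
  coordChange i j x v := (show F from v) + (f i x - f j x)
  coordChange_self i x _ v := by
    show (show F from v) + (f i x - f i x) = v
    rw [sub_self, add_zero]
  continuousOn_coordChange i j := by
    rintro ⟨x, v⟩ ⟨hx, -⟩
    -- In a discrete fibre continuity means local constancy, which is the local constancy of the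
    -- difference of two primitives.
    apply ContinuousAt.continuousWithinAt
    refine (continuousAt_const (y := (show DiscreteCopy F from
      (show F from v) + (f i x - f j x)))).congr ?_
    have h2 : ∀ᶠ w : DiscreteCopy F in nhds v, w = v := by
      rw [nhds_discrete]; rfl
    have h1 := hconst i j x hx
    rw [nhds_prod_eq]
    filter_upwards [h1.prod_mk h2] with p hp
    show (show F from v) + (f i x - f j x) = (show F from p.2) + (f i p.1 - f j p.1)
    rw [hp.1, hp.2]
  coordChange_comp i j k x _ v := by
    show ((show F from v) + (f i x - f j x)) + (f j x - f k x) = (show F from v) + (f i x - f k x)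
    abel

/-- A locally exact one-form on a simply connected open set is exact. -/
theorem exists_primitive_of_simplyConnected {U : Set E} (hU : IsOpen U)
    [SimplyConnectedSpace U] {η : E → E →L[ℝ] F}
    (hloc : ∀ p ∈ U, ∃ f : E → F, ∀ᶠ q in nhds p, HasFDerivAt f (η q) q) :
    ∃ f : E → F, ∀ p ∈ U, HasFDerivAt f (η p) p := by
  classical
  choose! f₀ hf₀ using hloc
  have hf₁ : ∀ i : U, ∃ r > 0, ∀ q ∈ Metric.ball (i : E) r, q ∈ U ∧
      HasFDerivAt (f₀ i) (η q) q := fun i => by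
    have := (hf₀ i i.2).and (hU.mem_nhds i.2)
    obtain ⟨r, hr, h⟩ := Metric.eventually_nhds_iff_ball.mp this
    exact ⟨r, hr, fun q hq => ⟨(h q hq).2, (h q hq).1⟩⟩
  choose r hr hball using hf₁
  let f : U → E → F := fun i => f₀ i
  let s : U → Set U := fun i => Subtype.val ⁻¹' Metric.ball (i : E) (r i)
  have hs : ∀ i, IsOpen (s i) := fun i => Metric.isOpen_ball.preimage continuous_subtype_val
  have hmem : ∀ i, i ∈ s i := fun i => Metric.mem_ball_self (hr i)
  have hconst : ∀ i j : U, ∀ x ∈ s i ∩ s j,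
      ∀ᶠ y : U in nhds x, f i y - f j y = f i x - f j x := by
    rintro i j x ⟨hi, hj⟩
    have ho : IsOpen (Metric.ball (i : E) (r i) ∩ Metric.ball (j : E) (r j)) :=
      Metric.isOpen_ball.inter Metric.isOpen_ball
    -- Balls are used as neighbourhoods so that overlaps are convex; there two primitives differ by
    -- a constant.
    have hcv : Convex ℝ (Metric.ball (i : E) (r i) ∩ Metric.ball (j : E) (r j)) :=
      (convex_ball _ _).inter (convex_ball _ _)
    have hxm : (x : E) ∈ Metric.ball (i : E) (r i) ∩ Metric.ball (j : E) (r j) := ⟨hi, hj⟩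
    have hder : ∀ y ∈ Metric.ball (i : E) (r i) ∩ Metric.ball (j : E) (r j),
        HasFDerivAt (fun y => f i y - f j y) (0 : E →L[ℝ] F) y := fun y hy => by
      have := ((hball i y hy.1).2).sub ((hball j y hy.2).2)
      rwa [sub_self] at this
    have hev : ∀ᶠ y : E in nhds (x : E), f i y - f j y = f i x - f j x := by
      filter_upwards [ho.mem_nhds hxm] with y hy
      refine hcv.is_const_of_fderivWithin_eq_zero (𝕜 := ℝ) (f := fun y => f i y - f j y)
        (fun z hz => (hder z hz).differentiableAt.differentiableWithinAt) (fun z hz => ?_) hy hxm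
      rw [fderivWithin_of_isOpen ho hz, (hder z hz).fderiv]
    exact continuous_subtype_val.continuousAt.eventually hev
  let Z := primitiveBundle f s hs hmem hconst
  have hcov : IsCoveringMap (Z.proj) := by
    refine IsCoveringMap.mk _ (fun _ => DiscreteCopy F) (fun i => Z.localTriv i) (fun i => hmem i)
  have : LocallyPathConnectedSpace U := hU.locallyPathConnectedSpace
  obtain ⟨a₀⟩ : Nonempty U := inferInstance
  -- Simple connectedness enters only here: the identity of U lifts to a global section of the
  -- covering of germs. Evaluating the germs along this section gives the primitive `P`.
  obtain ⟨G, ⟨-, hG⟩, -⟩ := hcov.existsUnique_continuousMap_lifts (ContinuousMap.id U) a₀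
    (⟨a₀, (show F from 0)⟩ : Z.TotalSpace) rfl
  have hG' : ∀ x, (G x).1 = x := fun x => congrFun hG x
  let P : E → F := fun x => if hx : x ∈ U then (show F from (G ⟨x, hx⟩).2) + f ⟨x, hx⟩ x else 0
  refine ⟨P, fun p hp => ?_⟩
  -- in the trivialization at `p`, the section `G` is locally constant
  let i : U := ⟨p, hp⟩
  have hval : ∀ x : U, x ∈ s i → (show F from ((Z.localTriv i) (G x)).2) + f i x = P x := by
    intro x hx
    have h1 : ((Z.localTriv i) (G x)).2 =
        (show F from (G x).2) + (f (G x).1 (G x).1 - f i (G x).1) := rfl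
    have h2 : P x = (show F from (G x).2) + f x x := by
      show dite _ _ _ = _
      rw [dif_pos x.2]
    rw [h1, h2, hG' x]
    show ((show F from (G x).2) + (f x x - f i x)) + f i x = _
    abel
  have hcont : ∀ᶠ x : U in nhds i, ((Z.localTriv i) (G x)).2 = ((Z.localTriv i) (G i)).2 := by
    have hsrc : G i ∈ (Z.localTriv i).source := by
      have h : (G i).proj ∈ s i := by rw [hG' i]; exact hmem i
      rw [Bundle.Trivialization.mem_source]
      exact h
    have hc : ContinuousAt (fun x : U => ((Z.localTriv i) (G x)).2) i :=
      continuous_snd.continuousAt.comp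
        (((Z.localTriv i).continuousAt hsrc).comp (f := G) (x := i) G.continuous.continuousAt)
    have hc' := hc.tendsto
    rw [nhds_discrete (DiscreteCopy F), Filter.tendsto_pure] at hc'
    exact hc'
  have hfin : ∀ᶠ x : E in nhds p,
      P x = (show F from ((Z.localTriv i) (G i)).2) + f i x := by
    have h1 : ∀ᶠ x : U in nhds i, P x = (show F from ((Z.localTriv i) (G i)).2) + f i x := by
      filter_upwards [hcont, (hs i).mem_nhds (hmem i)] with x hx hx'
      rw [← hval x hx', hx]
    rw [← hU.isOpenEmbedding_subtypeVal.map_nhds_eq i]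
    exact h1
  exact ((hball i p (Metric.mem_ball_self (hr i))).2.const_add _).congr_of_eventuallyEq hfin

end Primitive

/-! ### Curvature of a plane field with an orthonormal frame -/

section Frame

variable {E : Type*} [NormedAddCommGroup E] [NormedSpace ℝ E]

/-- A smooth orthonormal frame of a field of planes of `ℝ⁴` on an open set. -/
structure IsOrthonormalFrameOn (W : E → Submodule ℝ R4) (e₁ e₂ : E → R4) (V : Set E) : Prop where
  isOpen : IsOpen V
  smooth_one : ContDiffOn ℝ ∞ e₁ V
  smooth_two : ContDiffOn ℝ ∞ e₂ V
  inner_one : ∀ q ∈ V, inner ℝ (e₁ q) (e₁ q) = 1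
  inner_two : ∀ q ∈ V, inner ℝ (e₂ q) (e₂ q) = 1
  inner_one_two : ∀ q ∈ V, inner ℝ (e₁ q) (e₂ q) = 0
  starProjection_eq : ∀ q ∈ V, ∀ w, (W q).starProjection w =
    inner ℝ (e₁ q) w • e₁ q + inner ℝ (e₂ q) w • e₂ q

/-- Projection of the derivative in the direction `u` to a field of planes. -/
def planeCov (W : E → Submodule ℝ R4) (u : E) (Y : E → R4) : E → R4 :=
  fun p => (W p).starProjection (fderiv ℝ Y p u)

/-- The connection form of an orthonormal frame. -/
def connectionForm (e₁ e₂ : E → R4) (q u : E) : ℝ := inner ℝ (e₂ q) (fderiv ℝ e₁ q u)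

theorem planeCov_congr {W : E → Submodule ℝ R4} {u : E} {Y Z : E → R4} {p : E}
    (h : Y =ᶠ[nhds p] Z) : planeCov W u Y p = planeCov W u Z p := by
  unfold planeCov; rw [h.fderiv_eq]

theorem contDiffOn_fderiv_apply {F : Type*} [NormedAddCommGroup F] [NormedSpace ℝ F] {f : E → F}
    {V : Set E} (hV : IsOpen V) (hf : ContDiffOn ℝ ∞ f V) (u : E) :
    ContDiffOn ℝ ∞ (fun q => fderiv ℝ f q u) V :=
  (((contDiffOn_infty_iff_fderiv_of_isOpen hV).1 hf).2).clm_apply contDiffOn_const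

theorem ContDiffOn.differentiableAt_of_isOpen {F : Type*} [NormedAddCommGroup F]
    [NormedSpace ℝ F] {f : E → F} {V : Set E} (hf : ContDiffOn ℝ ∞ f V) (hV : IsOpen V) {q : E}
    (hq : q ∈ V) : DifferentiableAt ℝ f q :=
  (hf.differentiableOn (by simp)).differentiableAt (hV.mem_nhds hq)

/-- Second derivatives of smooth functions commute. -/
theorem fderiv_fderiv_comm {F : Type*} [NormedAddCommGroup F]
    [NormedSpace ℝ F] {f : E → F} {V : Set E} (hV : IsOpen V) (hf : ContDiffOn ℝ ∞ f V) {q : E}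
    (hq : q ∈ V) (u v : E) :
    fderiv ℝ (fun x => fderiv ℝ f x v) q u = fderiv ℝ (fun x => fderiv ℝ f x u) q v := by
  have hd : DifferentiableAt ℝ (fderiv ℝ f) q :=
    ((contDiffOn_infty_iff_fderiv_of_isOpen hV).1 hf).2.differentiableAt_of_isOpen hV hq
  rw [← fderiv_clm_apply_const hd, ← fderiv_clm_apply_const hd]
  exact ((hf.contDiffAt (hV.mem_nhds hq)).isSymmSndFDerivAt (by simpa using ENat.LEInfty.out)) u v

namespace IsOrthonormalFrameOn

variable {W : E → Submodule ℝ R4} {e₁ e₂ : E → R4} {V : Set E}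

theorem connectionForm_smooth (h : IsOrthonormalFrameOn W e₁ e₂ V) (u : E) :
    ContDiffOn ℝ ∞ (fun q => connectionForm e₁ e₂ q u) V :=
  h.smooth_two.inner ℝ (contDiffOn_fderiv_apply h.isOpen h.smooth_one u)

/-- Differentiating the constant inner products of the frame shows that its connection matrix is
skew, so one form describes the whole connection. -/
theorem inner_fderiv (h : IsOrthonormalFrameOn W e₁ e₂ V) {p : E} (hp : p ∈ V) (u : E) :
    inner ℝ (e₁ p) (fderiv ℝ e₁ p u) = 0 ∧ inner ℝ (e₂ p) (fderiv ℝ e₂ p u) = 0 ∧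
      inner ℝ (e₁ p) (fderiv ℝ e₂ p u) = -connectionForm e₁ e₂ p u := by
  have d1 := h.smooth_one.differentiableAt_of_isOpen h.isOpen hp
  have d2 := h.smooth_two.differentiableAt_of_isOpen h.isOpen hp
  have key : ∀ (a b : E → R4) (c : ℝ), DifferentiableAt ℝ a p → DifferentiableAt ℝ b p →
      (∀ q ∈ V, inner ℝ (a q) (b q) = c) →
      inner ℝ (a p) (fderiv ℝ b p u) + inner ℝ (fderiv ℝ a p u) (b p) = 0 := by
    intro a b c ha hb hc
    rw [← fderiv_inner_apply ℝ ha hb]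
    have : (fun q => inner ℝ (a q) (b q)) =ᶠ[nhds p] fun _ => c := by
      filter_upwards [h.isOpen.mem_nhds hp] with q hq using hc q hq
    rw [this.fderiv_eq]; simp
  have k1 := key e₁ e₁ 1 d1 d1 h.inner_one
  have k2 := key e₂ e₂ 1 d2 d2 h.inner_two
  have k3 := key e₁ e₂ 0 d1 d2 h.inner_one_two
  rw [real_inner_comm (e₁ p)] at k1
  rw [real_inner_comm (e₂ p)] at k2
  rw [real_inner_comm (e₂ p)] at k3
  refine ⟨?_, ?_, ?_⟩
  · linarith
  · linarith
  · unfold connectionForm; linarith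

theorem planeCov_combination (h : IsOrthonormalFrameOn W e₁ e₂ V) {p : E} (hp : p ∈ V) (u : E)
    {y₁ y₂ : E → ℝ} (h₁ : DifferentiableAt ℝ y₁ p) (h₂ : DifferentiableAt ℝ y₂ p) :
    planeCov W u (fun q => y₁ q • e₁ q + y₂ q • e₂ q) p =
      (fderiv ℝ y₁ p u - y₂ p * connectionForm e₁ e₂ p u) • e₁ p +
        (fderiv ℝ y₂ p u + y₁ p * connectionForm e₁ e₂ p u) • e₂ p := by
  have d1 := h.smooth_one.differentiableAt_of_isOpen h.isOpen hp
  have d2 := h.smooth_two.differentiableAt_of_isOpen h.isOpen hp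
  obtain ⟨i1, i2, i3⟩ := h.inner_fderiv hp u
  have i4 : inner ℝ (e₂ p) (fderiv ℝ e₁ p u) = connectionForm e₁ e₂ p u := rfl
  have hd : fderiv ℝ (fun q => y₁ q • e₁ q + y₂ q • e₂ q) p u =
      (y₁ p • fderiv ℝ e₁ p u + fderiv ℝ y₁ p u • e₁ p) +
        (y₂ p • fderiv ℝ e₂ p u + fderiv ℝ y₂ p u • e₂ p) := by
    rw [fderiv_fun_add (h₁.fun_smul d1) (h₂.fun_smul d2), fderiv_fun_smul h₁ d1, fderiv_fun_smul h₂ d2]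
    simp
  unfold planeCov
  rw [hd, h.starProjection_eq p hp]
  simp only [inner_add_right, inner_smul_right, i1, i2, i3, i4, h.inner_one p hp,
    h.inner_two p hp, h.inner_one_two p hp, real_inner_comm (e₁ p) (e₂ p)]
  congr 2 <;> ring

/-- The curvature of the connection of a plane field is the differential of the connection
form. -/
theorem planeCov_commutator (h : IsOrthonormalFrameOn W e₁ e₂ V) {p : E} (hp : p ∈ V) (u v : E)
    {Y : E → R4} (hY : ContDiffOn ℝ ∞ Y V) (hYW : ∀ q ∈ V, Y q ∈ W q) :
    planeCov W u (planeCov W v Y) p - planeCov W v (planeCov W u Y) p =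
      (fderiv ℝ (fun q => connectionForm e₁ e₂ q v) p u -
        fderiv ℝ (fun q => connectionForm e₁ e₂ q u) p v) •
        (inner ℝ (e₁ p) (Y p) • e₂ p - inner ℝ (e₂ p) (Y p) • e₁ p) := by
  set y₁ : E → ℝ := fun q => inner ℝ (e₁ q) (Y q) with hy₁
  set y₂ : E → ℝ := fun q => inner ℝ (e₂ q) (Y q) with hy₂
  have s1 : ContDiffOn ℝ ∞ y₁ V := h.smooth_one.inner ℝ hY
  have s2 : ContDiffOn ℝ ∞ y₂ V := h.smooth_two.inner ℝ hY
  have hYe : ∀ q ∈ V, Y q = y₁ q • e₁ q + y₂ q • e₂ q := fun q hq => by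
    rw [← h.starProjection_eq q hq, Submodule.starProjection_eq_self_iff.2 (hYW q hq)]
  -- An identity of germs, not just of values at p, is needed because this field is differentiated
  -- again.
  have hfirst : ∀ w, planeCov W w Y =ᶠ[nhds p] fun q =>
      (fderiv ℝ y₁ q w - y₂ q * connectionForm e₁ e₂ q w) • e₁ q +
        (fderiv ℝ y₂ q w + y₁ q * connectionForm e₁ e₂ q w) • e₂ q := by
    intro w
    filter_upwards [h.isOpen.mem_nhds hp] with q hq
    rw [← h.planeCov_combination hq w (s1.differentiableAt_of_isOpen h.isOpen hq)
      (s2.differentiableAt_of_isOpen h.isOpen hq)]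
    apply planeCov_congr
    filter_upwards [h.isOpen.mem_nhds hq] with x hx using hYe x hx
  have D : ∀ {f : E → ℝ}, ContDiffOn ℝ ∞ f V → DifferentiableAt ℝ f p :=
    fun hf => hf.differentiableAt_of_isOpen h.isOpen hp
  have t := fun w => D (h.connectionForm_smooth w)
  have f1 := fun w => D (contDiffOn_fderiv_apply h.isOpen s1 w)
  have f2 := fun w => D (contDiffOn_fderiv_apply h.isOpen s2 w)
  have hsecond : ∀ w z, planeCov W z (planeCov W w Y) p =
      ((fderiv ℝ (fun q => fderiv ℝ y₁ q w) p z -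
          (y₂ p * fderiv ℝ (fun q => connectionForm e₁ e₂ q w) p z +
            connectionForm e₁ e₂ p w * fderiv ℝ y₂ p z)) -
        (fderiv ℝ y₂ p w + y₁ p * connectionForm e₁ e₂ p w) * connectionForm e₁ e₂ p z) • e₁ p +
      ((fderiv ℝ (fun q => fderiv ℝ y₂ q w) p z +
          (y₁ p * fderiv ℝ (fun q => connectionForm e₁ e₂ q w) p z +
            connectionForm e₁ e₂ p w * fderiv ℝ y₁ p z)) +
        (fderiv ℝ y₁ p w - y₂ p * connectionForm e₁ e₂ p w) * connectionForm e₁ e₂ p z) • e₂ p := by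
    intro w z
    rw [planeCov_congr (hfirst w), h.planeCov_combination hp z
      ((f1 w).fun_sub ((D s2).fun_mul (t w))) ((f2 w).fun_add ((D s1).fun_mul (t w))),
      fderiv_fun_sub (f1 w) ((D s2).fun_mul (t w)), fderiv_fun_add (f2 w) ((D s1).fun_mul (t w)),
      fderiv_fun_mul (D s2) (t w), fderiv_fun_mul (D s1) (t w)]
    simp
  -- After antisymmetrization the second derivatives of the coefficients cancel, and so do the terms
  -- quadratic in the connection form, since the rotation group of a plane is commutative. Only the
  -- exterior derivative of the form survives.
  rw [hsecond v u, hsecond u v, fderiv_fderiv_comm h.isOpen s1 hp u v,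
    fderiv_fderiv_comm h.isOpen s2 hp u v]
  module

end IsOrthonormalFrameOn

end Frame

/-! ### Frames of `ℝ⁴` defined by pairs of unit quaternions -/

namespace Quaternion

/-- Multiplication by unit quaternions on both sides, as an isometry. -/
def sandwich (gp gm : ℍ[ℝ]) (hp : ‖gp‖ = 1) (hm : ‖gm‖ = 1) : ℍ[ℝ] →ₗᵢ[ℝ] ℍ[ℝ] where
  toFun X := star gp * X * gm
  map_add' X Y := by rw [mul_add, add_mul]
  map_smul' c X := by simp
  norm_map' X := by
    show ‖star gp * X * gm‖ = ‖X‖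
    rw [norm_mul, norm_mul, norm_star, hp, hm, one_mul, mul_one]

/-- The vector `gp⁻¹ X gm` of `ℝ⁴`, for unit quaternions `gp` and `gm`. -/
def frameVec (gp gm X : ℍ[ℝ]) : R4 := toR4 (star gp * X * gm)

section FrameVec

variable {gp gm : ℍ[ℝ]}

theorem inner_frameVec (hp : ‖gp‖ = 1) (hm : ‖gm‖ = 1) (X Y : ℍ[ℝ]) :
    inner ℝ (frameVec gp gm X) (frameVec gp gm Y) = inner ℝ X Y := by
  unfold frameVec
  rw [toR4.inner_map_map]
  exact (sandwich gp gm hp hm).inner_map_map X Y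

theorem frameVec_add (X Y : ℍ[ℝ]) :
    frameVec gp gm (X + Y) = frameVec gp gm X + frameVec gp gm Y := by
  simp [frameVec, mul_add, add_mul]

theorem frameVec_smul (c : ℝ) (X : ℍ[ℝ]) :
    frameVec gp gm (c • X) = c • frameVec gp gm X := by
  simp [frameVec]

theorem frameVec_surjective (hp : ‖gp‖ = 1) (hm : ‖gm‖ = 1) (w : R4) :
    ∃ X, frameVec gp gm X = w := by
  refine ⟨gp * toR4.symm w * star gm, ?_⟩
  unfold frameVec
  have : star gp * (gp * toR4.symm w * star gm) * gm = toR4.symm w := by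
    calc _ = (star gp * gp) * toR4.symm w * (star gm * gm) := by noncomm_ring
      _ = _ := by rw [star_mul_self_of_norm hp, star_mul_self_of_norm hm, one_mul, mul_one]
  rw [this, LinearIsometryEquiv.apply_symm_apply]

theorem inner_eq (X Y : ℍ[ℝ]) :
    inner ℝ X Y = X.re * Y.re + X.imI * Y.imI + X.imJ * Y.imJ + X.imK * Y.imK := by
  rw [Quaternion.inner_def]; simp

theorem eq_combination (X : ℍ[ℝ]) :
    X = X.re • (1 : ℍ[ℝ]) + X.imI • unitI + X.imJ • unitJ + X.imK • unitK := by
  apply Quaternion.ext <;> simp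

theorem frameVec_eq (X : ℍ[ℝ]) : frameVec gp gm X = X.re • frameVec gp gm 1 +
    X.imI • frameVec gp gm unitI + X.imJ • frameVec gp gm unitJ + X.imK • frameVec gp gm unitK := by
  conv_lhs => rw [eq_combination X]
  simp only [frameVec_add, frameVec_smul]

/-- A plane containing the vectors given by `J`, `K` and orthogonal to those given by `1`, `I`. -/
structure IsFramedBy (W : Submodule ℝ R4) (gp gm : ℍ[ℝ]) : Prop where
  norm_plus : ‖gp‖ = 1
  norm_minus : ‖gm‖ = 1
  mem_J : frameVec gp gm unitJ ∈ W
  mem_K : frameVec gp gm unitK ∈ W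
  mem_one : frameVec gp gm 1 ∈ Wᗮ
  mem_I : frameVec gp gm unitI ∈ Wᗮ

theorem IsFramedBy.starProjection {W : Submodule ℝ R4} (h : IsFramedBy W gp gm) (X : ℍ[ℝ]) :
    W.starProjection (frameVec gp gm X) =
      X.imJ • frameVec gp gm unitJ + X.imK • frameVec gp gm unitK := by
  apply Submodule.eq_starProjection_of_mem_of_inner_eq_zero
  · exact W.add_mem (W.smul_mem _ h.mem_J) (W.smul_mem _ h.mem_K)
  · intro w hw
    have h1 := (Submodule.mem_orthogonal' _ _).1 h.mem_one w hw
    have h2 := (Submodule.mem_orthogonal' _ _).1 h.mem_I w hw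
    rw [frameVec_eq X]
    simp only [inner_sub_left, inner_add_left, inner_smul_left, h1, h2]
    simp

theorem IsFramedBy.starProjection_orthogonal {W : Submodule ℝ R4} (h : IsFramedBy W gp gm)
    (X : ℍ[ℝ]) : Wᗮ.starProjection (frameVec gp gm X) =
      X.re • frameVec gp gm 1 + X.imI • frameVec gp gm unitI := by
  rw [Submodule.starProjection_orthogonal_val, h.starProjection]
  conv_lhs => rw [frameVec_eq X]
  abel

end FrameVec

end Quaternion

/-! ### Logarithmic derivatives and connection forms of quaternionic moving frames. -/

section MovingFrame

variable {E : Type*} [NormedAddCommGroup E] [NormedSpace ℝ E]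

/-- The logarithmic derivative `dg g⁻¹` of a map into the unit quaternions. -/
def quatLogDeriv (g : E → ℍ[ℝ]) (q : E) : E →L[ℝ] ℍ[ℝ] :=
  ((ContinuousLinearMap.mul ℝ ℍ[ℝ]).flip (star (g q))).comp (fderiv ℝ g q)

theorem quatLogDeriv_apply (g : E → ℍ[ℝ]) (q u : E) :
    quatLogDeriv g q u = fderiv ℝ g q u * star (g q) := by
  simp [quatLogDeriv]

variable {g gp gm : E → ℍ[ℝ]} {V : Set E}

/-- Quaternionic conjugation as a continuous linear map. -/
def Quaternion.starCLM : ℍ[ℝ] →L[ℝ] ℍ[ℝ] := LinearMap.toContinuousLinearMap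
  { toFun := fun q => star q
    map_add' := fun a b => star_add a b
    map_smul' := fun c a => by apply Quaternion.ext <;> simp }

theorem contDiff_star_quaternion : ContDiff ℝ ∞ (fun q : ℍ[ℝ] => star q) :=
  starCLM.contDiff

theorem ContDiffOn.quaternion_star (hg : ContDiffOn ℝ ∞ g V) :
    ContDiffOn ℝ ∞ (fun q => star (g q)) V :=
  contDiff_star_quaternion.comp_contDiffOn hg

theorem fderiv_quaternion_star {q : E} (hg : DifferentiableAt ℝ g q) (u : E) :
    fderiv ℝ (fun x => star (g x)) q u = star (fderiv ℝ g q u) := by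
  exact congrArg (fun L => L u) (starCLM.hasFDerivAt.comp q hg.hasFDerivAt).fderiv

theorem contDiffOn_quatLogDeriv (hV : IsOpen V) (hg : ContDiffOn ℝ ∞ g V) :
    ContDiffOn ℝ ∞ (quatLogDeriv g) V :=
  ContDiffOn.clm_comp
    ((ContinuousLinearMap.mul ℝ ℍ[ℝ]).flip.contDiff.comp_contDiffOn hg.quaternion_star)
    ((contDiffOn_infty_iff_fderiv_of_isOpen hV).1 hg).2

theorem fderiv_eq_quatLogDeriv_mul {q : E} (hn : ‖g q‖ = 1) (u : E) :
    fderiv ℝ g q u = quatLogDeriv g q u * g q := by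
  rw [quatLogDeriv_apply, mul_assoc, star_mul_self_of_norm hn, mul_one]

theorem fderiv_quaternion_mul {a b : E → ℍ[ℝ]} {q : E} (ha : DifferentiableAt ℝ a q)
    (hb : DifferentiableAt ℝ b q) (u : E) :
    fderiv ℝ (fun x => a x * b x) q u = a q * fderiv ℝ b q u + fderiv ℝ a q u * b q := by
  have h : fderiv ℝ (fun x => a x * b x) q = _ := (ha.hasFDerivAt.mul' hb.hasFDerivAt).fderiv
  rw [h]; simp

/-- Obtained by differentiating gḡ = 1: the Lie algebra of the unit quaternions is the imaginary
space. -/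
theorem star_quatLogDeriv (hV : IsOpen V) (hg : ContDiffOn ℝ ∞ g V) (hn : ∀ q ∈ V, ‖g q‖ = 1)
    {q : E} (hq : q ∈ V) (u : E) : star (quatLogDeriv g q u) = -quatLogDeriv g q u := by
  have hd := hg.differentiableAt_of_isOpen hV hq
  have hs := hg.quaternion_star.differentiableAt_of_isOpen hV hq
  have h1 : (fun x => g x * star (g x)) =ᶠ[nhds q] fun _ => 1 := by
    filter_upwards [hV.mem_nhds hq] with x hx using self_mul_star_of_norm (hn x hx)
  have h2 := congrArg (fun L : E →L[ℝ] ℍ[ℝ] => L u) (h1.fderiv_eq (𝕜 := ℝ))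
  simp only [fderiv_quaternion_mul hd hs, fderiv_quaternion_star hd] at h2
  rw [quatLogDeriv_apply, star_mul, star_star, eq_neg_iff_add_eq_zero, h2]
  simp

theorem re_quatLogDeriv (hV : IsOpen V) (hg : ContDiffOn ℝ ∞ g V) (hn : ∀ q ∈ V, ‖g q‖ = 1)
    {q : E} (hq : q ∈ V) (u : E) : (quatLogDeriv g q u).re = 0 := by
  have := congrArg (fun x : ℍ[ℝ] => x.re) (star_quatLogDeriv hV hg hn hq u)
  simp only [Quaternion.re_star, Quaternion.re_neg] at this
  linarith

theorem contDiffOn_frameVec (hgp : ContDiffOn ℝ ∞ gp V) (hgm : ContDiffOn ℝ ∞ gm V) (X : ℍ[ℝ]) :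
    ContDiffOn ℝ ∞ (fun q => frameVec (gp q) (gm q) X) V :=
  toR4.contDiff.comp_contDiffOn ((hgp.quaternion_star.mul contDiffOn_const).mul hgm)

/-- The Leibniz rule for ḡ₊Xg₋: the left factor contributes ḡ₊āX = -ḡ₊aX, the right factor Xb. All
the geometry of the frame is read from Xb - aX. -/
theorem fderiv_frameVec {q : E} (hgp : DifferentiableAt ℝ gp q) (hgm : DifferentiableAt ℝ gm q)
    {u : E} {a b : ℍ[ℝ]} (ha : fderiv ℝ gp q u = a * gp q) (hb : fderiv ℝ gm q u = b * gm q)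
    (hs : star a = -a) (X : ℍ[ℝ]) :
    fderiv ℝ (fun x => frameVec (gp x) (gm x) X) q u =
      frameVec (gp q) (gm q) (X * b - a * X) := by
  have hst : DifferentiableAt ℝ (fun x => star (gp x)) q :=
    contDiff_star_quaternion.differentiable (by simp) |>.differentiableAt.comp q hgp
  have hsX : DifferentiableAt ℝ (fun x => star (gp x) * X) q :=
    hst.fun_mul (differentiableAt_const X)
  have h1 : (fun x => frameVec (gp x) (gm x) X) = toR4 ∘ fun x => star (gp x) * X * gm x := rfl
  rw [h1, toR4.comp_fderiv]
  show toR4 (fderiv ℝ (fun x => star (gp x) * X * gm x) q u) = _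
  rw [fderiv_quaternion_mul hsX hgm, fderiv_quaternion_mul hst (differentiableAt_const X),
    fderiv_quaternion_star hgp, ha, hb, star_mul, hs]
  unfold frameVec
  congr 1
  simp
  noncomm_ring

variable {W : E → Submodule ℝ R4}

theorem isOrthonormalFrameOn_tangent (hV : IsOpen V) (hgp : ContDiffOn ℝ ∞ gp V)
    (hgm : ContDiffOn ℝ ∞ gm V) (h : ∀ q ∈ V, IsFramedBy (W q) (gp q) (gm q)) :
    IsOrthonormalFrameOn W (fun q => frameVec (gp q) (gm q) unitJ)
      (fun q => frameVec (gp q) (gm q) unitK) V where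
  isOpen := hV
  smooth_one := contDiffOn_frameVec hgp hgm _
  smooth_two := contDiffOn_frameVec hgp hgm _
  inner_one q hq := by
    rw [inner_frameVec (h q hq).norm_plus (h q hq).norm_minus, inner_eq]; simp
  inner_two q hq := by
    rw [inner_frameVec (h q hq).norm_plus (h q hq).norm_minus, inner_eq]; simp
  inner_one_two q hq := by
    rw [inner_frameVec (h q hq).norm_plus (h q hq).norm_minus, inner_eq]; simp
  starProjection_eq q hq w := by
    obtain ⟨X, rfl⟩ := frameVec_surjective (h q hq).norm_plus (h q hq).norm_minus w
    rw [(h q hq).starProjection, inner_frameVec (h q hq).norm_plus (h q hq).norm_minus,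
      inner_frameVec (h q hq).norm_plus (h q hq).norm_minus, inner_eq, inner_eq]
    simp

theorem isOrthonormalFrameOn_normal (hV : IsOpen V) (hgp : ContDiffOn ℝ ∞ gp V)
    (hgm : ContDiffOn ℝ ∞ gm V) (h : ∀ q ∈ V, IsFramedBy (W q) (gp q) (gm q)) :
    IsOrthonormalFrameOn (fun q => (W q)ᗮ) (fun q => frameVec (gp q) (gm q) 1)
      (fun q => frameVec (gp q) (gm q) unitI) V where
  isOpen := hV
  smooth_one := contDiffOn_frameVec hgp hgm _
  smooth_two := contDiffOn_frameVec hgp hgm _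
  inner_one q hq := by
    rw [inner_frameVec (h q hq).norm_plus (h q hq).norm_minus, inner_eq]; simp
  inner_two q hq := by
    rw [inner_frameVec (h q hq).norm_plus (h q hq).norm_minus, inner_eq]; simp
  inner_one_two q hq := by
    rw [inner_frameVec (h q hq).norm_plus (h q hq).norm_minus, inner_eq]; simp
  starProjection_eq q hq w := by
    obtain ⟨X, rfl⟩ := frameVec_surjective (h q hq).norm_plus (h q hq).norm_minus w
    rw [(h q hq).starProjection_orthogonal, inner_frameVec (h q hq).norm_plus (h q hq).norm_minus,
      inner_frameVec (h q hq).norm_plus (h q hq).norm_minus, inner_eq, inner_eq]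
    simp

/-- With a = η₊ and b = η₋ the form is the K-coefficient of Jb - aJ. As JI = -K and IJ = K, only the
I-parts contribute, both with a minus sign. -/
theorem connectionForm_tangent (hV : IsOpen V) (hgp : ContDiffOn ℝ ∞ gp V)
    (hgm : ContDiffOn ℝ ∞ gm V) (hnp : ∀ q ∈ V, ‖gp q‖ = 1) (hnm : ∀ q ∈ V, ‖gm q‖ = 1)
    {q : E} (hq : q ∈ V) (u : E) :
    connectionForm (fun q => frameVec (gp q) (gm q) unitJ)
      (fun q => frameVec (gp q) (gm q) unitK) q u =
      -(quatLogDeriv gp q u).imI - (quatLogDeriv gm q u).imI := by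
  unfold connectionForm
  rw [fderiv_frameVec (hgp.differentiableAt_of_isOpen hV hq)
    (hgm.differentiableAt_of_isOpen hV hq) (fderiv_eq_quatLogDeriv_mul (hnp q hq) u)
    (fderiv_eq_quatLogDeriv_mul (hnm q hq) u) (star_quatLogDeriv hV hgp hnp hq u),
    inner_frameVec (hnp q hq) (hnm q hq), inner_eq]
  simp
  ring

/-- Here X = 1, so the form is the I-coefficient of b - a. Together with the tangent form it
determines both I-parts. -/
theorem connectionForm_normal (hV : IsOpen V) (hgp : ContDiffOn ℝ ∞ gp V)
    (hgm : ContDiffOn ℝ ∞ gm V) (hnp : ∀ q ∈ V, ‖gp q‖ = 1) (hnm : ∀ q ∈ V, ‖gm q‖ = 1)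
    {q : E} (hq : q ∈ V) (u : E) :
    connectionForm (fun q => frameVec (gp q) (gm q) 1)
      (fun q => frameVec (gp q) (gm q) unitI) q u =
      (quatLogDeriv gm q u).imI - (quatLogDeriv gp q u).imI := by
  unfold connectionForm
  rw [fderiv_frameVec (hgp.differentiableAt_of_isOpen hV hq)
    (hgm.differentiableAt_of_isOpen hV hq) (fderiv_eq_quatLogDeriv_mul (hnp q hq) u)
    (fderiv_eq_quatLogDeriv_mul (hnm q hq) u) (star_quatLogDeriv hV hgp hnp hq u),
    inner_frameVec (hnp q hq) (hnm q hq), inner_eq]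
  simp

end MovingFrame

/-! ### Curvatures of a framed surface -/

section Curvatures

variable {E : Type*} [NormedAddCommGroup E] [NormedSpace ℝ E] {f : E → R4} {V : Set E}

theorem fderiv_mem_tangentPlane (f : E → R4) (p u : E) : fderiv ℝ f p u ∈ tangentPlane f p :=
  ⟨u, rfl⟩

theorem gaussCurvature_eq {e₁ e₂ : E → R4} (h : IsOrthonormalFrameOn (tangentPlane f) e₁ e₂ V)
    (hf : ContDiffOn ℝ ∞ f V) {p : E} (hp : p ∈ V) (u v : E) :
    gaussCurvature f u v p = (fderiv ℝ (fun q => connectionForm e₁ e₂ q v) p u -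
        fderiv ℝ (fun q => connectionForm e₁ e₂ q u) p v) *
      (inner ℝ (e₁ p) (fderiv ℝ f p v) * inner ℝ (e₂ p) (fderiv ℝ f p u) -
        inner ℝ (e₂ p) (fderiv ℝ f p v) * inner ℝ (e₁ p) (fderiv ℝ f p u)) / areaSq f u v p := by
  have hc := h.planeCov_commutator hp u v (contDiffOn_fderiv_apply h.isOpen hf v)
    (fun q _ => fderiv_mem_tangentPlane f q v)
  have : gaussCurvature f u v p = inner ℝ (planeCov (tangentPlane f) u
      (planeCov (tangentPlane f) v fun q => fderiv ℝ f q v) p - planeCov (tangentPlane f) v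
      (planeCov (tangentPlane f) u fun q => fderiv ℝ f q v) p) (fderiv ℝ f p u) /
        areaSq f u v p := rfl
  rw [this, hc, real_inner_smul_left, inner_sub_left, real_inner_smul_left, real_inner_smul_left]

/-- A Gram determinant is the square of the determinant of the coordinates in an orthonormal basis.
For an immersion this makes the second factor in `gaussCurvature_eq` nonzero, so zero curvature does
force a closed connection form. -/
theorem areaSq_eq {e₁ e₂ : E → R4} (h : IsOrthonormalFrameOn (tangentPlane f) e₁ e₂ V)
    {p : E} (hp : p ∈ V) (u v : E) :
    areaSq f u v p = (inner ℝ (e₁ p) (fderiv ℝ f p v) * inner ℝ (e₂ p) (fderiv ℝ f p u) -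
        inner ℝ (e₂ p) (fderiv ℝ f p v) * inner ℝ (e₁ p) (fderiv ℝ f p u)) ^ 2 := by
  have he : ∀ w, fderiv ℝ f p w = inner ℝ (e₁ p) (fderiv ℝ f p w) • e₁ p +
      inner ℝ (e₂ p) (fderiv ℝ f p w) • e₂ p := fun w => by
    rw [← h.starProjection_eq p hp,
      Submodule.starProjection_eq_self_iff.2 (fderiv_mem_tangentPlane f p w)]
  have h1 := h.inner_one p hp
  have h2 := h.inner_two p hp
  have h3 := h.inner_one_two p hp
  have h4 : inner ℝ (e₂ p) (e₁ p) = 0 := by rw [real_inner_comm, h3]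
  unfold areaSq
  rw [← real_inner_self_eq_norm_sq, ← real_inner_self_eq_norm_sq]
  generalize ha : inner ℝ (e₁ p) (fderiv ℝ f p u) = a
  generalize hb : inner ℝ (e₂ p) (fderiv ℝ f p u) = b
  generalize hc : inner ℝ (e₁ p) (fderiv ℝ f p v) = c
  generalize hd : inner ℝ (e₂ p) (fderiv ℝ f p v) = d
  rw [he u, he v, ha, hb, hc, hd]
  simp only [inner_add_left, inner_add_right, real_inner_smul_left, real_inner_smul_right, h1, h2,
    h3, h4]
  ring

theorem normalCurvature_eq {e₁ e₂ : E → R4}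
    (h : IsOrthonormalFrameOn (fun q => (tangentPlane f q)ᗮ) e₁ e₂ V) {p : E} (hp : p ∈ V)
    (u v : E) (n₀ : R4) {n₁ : R4} (hn : n₁ ∈ (tangentPlane f p)ᗮ) :
    normalCurvature f u v n₀ n₁ p = (fderiv ℝ (fun q => connectionForm e₁ e₂ q v) p u -
        fderiv ℝ (fun q => connectionForm e₁ e₂ q u) p v) *
      (inner ℝ (e₁ p) n₁ * inner ℝ (e₂ p) n₀ - inner ℝ (e₂ p) n₁ * inner ℝ (e₁ p) n₀) /
        Real.sqrt (areaSq f u v p) := by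
  -- The extension of `n₁` prescribed by the definition is a smooth section of the normal bundle
  -- with value `n₁` at p, so the commutator formula applies to it.
  set Y : E → R4 := fun q => (tangentPlane f q)ᗮ.starProjection n₁ with hY
  have hYs : ContDiffOn ℝ ∞ Y V := by
    have : ContDiffOn ℝ ∞ (fun q => inner ℝ (e₁ q) n₁ • e₁ q + inner ℝ (e₂ q) n₁ • e₂ q) V :=
      ((h.smooth_one.inner ℝ contDiffOn_const).smul h.smooth_one).add
        ((h.smooth_two.inner ℝ contDiffOn_const).smul h.smooth_two)
    exact this.congr fun q hq => h.starProjection_eq q hq n₁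
  have hc := h.planeCov_commutator hp u v hYs (fun q _ => Submodule.starProjection_apply_mem _ _)
  have hYp : Y p = n₁ := Submodule.starProjection_eq_self_iff.2 hn
  have : normalCurvature f u v n₀ n₁ p = inner ℝ (planeCov (fun q => (tangentPlane f q)ᗮ) u
      (planeCov (fun q => (tangentPlane f q)ᗮ) v Y) p - planeCov (fun q => (tangentPlane f q)ᗮ) v
      (planeCov (fun q => (tangentPlane f q)ᗮ) u Y) p) n₀ / Real.sqrt (areaSq f u v p) := rfl
  rw [this, hc, real_inner_smul_left, inner_sub_left, real_inner_smul_left, real_inner_smul_left,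
    hYp]

variable {gp gm : E → ℍ[ℝ]}

/-- If the logarithmic derivatives of the frame have no component along `I`, the tangent and the
normal bundles are flat. -/
theorem hasZeroCurvaturesOn_of_imI_eq_zero (hV : IsOpen V) (hf : ContDiffOn ℝ ∞ f V)
    (hgp : ContDiffOn ℝ ∞ gp V) (hgm : ContDiffOn ℝ ∞ gm V)
    (hF : ∀ q ∈ V, IsFramedBy (tangentPlane f q) (gp q) (gm q))
    (hp0 : ∀ q ∈ V, ∀ u, (quatLogDeriv gp q u).imI = 0)
    (hm0 : ∀ q ∈ V, ∀ u, (quatLogDeriv gm q u).imI = 0) : HasZeroCurvaturesOn f V := by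
  have hnp := fun q hq => (hF q hq).norm_plus
  have hnm := fun q hq => (hF q hq).norm_minus
  have zero : ∀ {e₁ e₂ : E → R4}, (∀ q ∈ V, ∀ u, connectionForm e₁ e₂ q u = 0) →
      ∀ p ∈ V, ∀ u v, fderiv ℝ (fun q => connectionForm e₁ e₂ q v) p u = 0 := by
    intro e₁ e₂ h p hp u v
    have : (fun q => connectionForm e₁ e₂ q v) =ᶠ[nhds p] fun _ => 0 := by
      filter_upwards [hV.mem_nhds hp] with q hq using h q hq v
    rw [this.fderiv_eq]; simp
  have zT := zero (fun q hq u => by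
    rw [connectionForm_tangent hV hgp hgm hnp hnm hq u, hp0 q hq, hm0 q hq]; simp)
  have zN := zero (fun q hq u => by
    rw [connectionForm_normal hV hgp hgm hnp hnm hq u, hp0 q hq, hm0 q hq]; simp)
  intro p hp u v _
  refine ⟨?_, fun n₀ _ n₁ hn₁ _ => ?_⟩
  · rw [gaussCurvature_eq (isOrthonormalFrameOn_tangent hV hgp hgm hF) hf hp, zT p hp, zT p hp]
    simp
  · rw [normalCurvature_eq (isOrthonormalFrameOn_normal hV hgp hgm hF) hp u v n₀ hn₁, zN p hp,
      zN p hp]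
    simp

/-- The strict Cauchy–Schwarz inequality: equality would make the images of u and v proportional. -/
theorem areaSq_pos (f : E → R4) {p : E} (hi : Function.Injective (fderiv ℝ f p)) {u v : E}
    (huv : LinearIndependent ℝ ![u, v]) : 0 < areaSq f u v p := by
  have hli : LinearIndependent ℝ ![fderiv ℝ f p u, fderiv ℝ f p v] := by
    rw [LinearIndependent.pair_iff] at huv ⊢
    intro s t hst
    exact huv s t (hi (by rw [map_add, map_smul, map_smul, map_zero, hst]))
  unfold areaSq
  have hle := abs_real_inner_le_norm (fderiv ℝ f p u) (fderiv ℝ f p v)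
  have hne : fderiv ℝ f p u ≠ 0 := hli.ne_zero 0
  have hlt : |inner ℝ (fderiv ℝ f p u) (fderiv ℝ f p v)| <
      ‖fderiv ℝ f p u‖ * ‖fderiv ℝ f p v‖ := by
    refine lt_of_le_of_ne hle fun heq => ?_
    obtain ⟨r, -, hr⟩ := (norm_inner_eq_norm_iff (𝕜 := ℝ) hne (hli.ne_zero 1)).1
      (by rw [Real.norm_eq_abs]; exact heq)
    simp only [Matrix.cons_val_one, Matrix.cons_val_zero] at hr
    rw [LinearIndependent.pair_iff] at hli
    have := hli r (-1) (by rw [hr]; module)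
    norm_num at this
  have := sq_lt_sq' (by linarith [abs_nonneg (inner ℝ (fderiv ℝ f p u) (fderiv ℝ f p v))]) hlt
  rw [sq_abs] at this
  nlinarith

/-- The curvatures only control independent pairs. On a dependent pair the exterior derivative
vanishes because it is bilinear and alternating. -/
theorem closed_of_linearIndependent {η : E → E →L[ℝ] ℝ} {p : E} (hη : DifferentiableAt ℝ η p)
    (h : ∀ u v, LinearIndependent ℝ ![u, v] →
      fderiv ℝ (fun q => η q v) p u - fderiv ℝ (fun q => η q u) p v = 0) (u v : E) :
    fderiv ℝ (fun q => η q v) p u = fderiv ℝ (fun q => η q u) p v := by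
  by_cases huv : LinearIndependent ℝ ![u, v]
  · exact sub_eq_zero.1 (h u v huv)
  rw [← fderiv_clm_apply_const hη, ← fderiv_clm_apply_const hη]
  rw [LinearIndependent.pair_iff] at huv
  push Not at huv
  obtain ⟨s, t, hst, hne⟩ := huv
  by_cases hs : s = 0
  · have ht := hne hs
    have hv : v = 0 := by simpa [hs, ht] using hst
    simp [hv]
  · have hu : u = (-(t / s)) • v := by
      have h2 : s • u = -(t • v) := eq_neg_of_add_eq_zero_left hst
      calc u = s⁻¹ • (s • u) := by rw [smul_smul, inv_mul_cancel₀ hs, one_smul]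
        _ = _ := by rw [h2]; module
    rw [hu]; simp

/-- For a flat surface with flat normal bundle, the components along `I` of the logarithmic
derivatives of a frame are closed. -/
theorem imI_closed_of_hasZeroCurvaturesOn (hV : IsOpen V) (hf : IsImmersedOn f V)
    (hgp : ContDiffOn ℝ ∞ gp V) (hgm : ContDiffOn ℝ ∞ gm V)
    (hF : ∀ q ∈ V, IsFramedBy (tangentPlane f q) (gp q) (gm q)) (hK : HasZeroCurvaturesOn f V)
    {p : E} (hp : p ∈ V) (u v : E) :
    fderiv ℝ (fun q => (quatLogDeriv gp q v).imI) p u =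
        fderiv ℝ (fun q => (quatLogDeriv gp q u).imI) p v ∧
      fderiv ℝ (fun q => (quatLogDeriv gm q v).imI) p u =
        fderiv ℝ (fun q => (quatLogDeriv gm q u).imI) p v := by
  have hnp := fun q hq => (hF q hq).norm_plus
  have hnm := fun q hq => (hF q hq).norm_minus
  let ap : E → E →L[ℝ] ℝ := fun q => imICLM.comp (quatLogDeriv gp q)
  let am : E → E →L[ℝ] ℝ := fun q => imICLM.comp (quatLogDeriv gm q)
  have hap : DifferentiableAt ℝ ap p :=
    (contDiffOn_const.clm_comp (contDiffOn_quatLogDeriv hV hgp)).differentiableAt_of_isOpen hV hp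
  have ham : DifferentiableAt ℝ am p :=
    (contDiffOn_const.clm_comp (contDiffOn_quatLogDeriv hV hgm)).differentiableAt_of_isOpen hV hp
  have hapv : ∀ w, DifferentiableAt ℝ (fun q => ap q w) p := fun w =>
    hap.clm_apply (differentiableAt_const w)
  have hamv : ∀ w, DifferentiableAt ℝ (fun q => am q w) p := fun w =>
    ham.clm_apply (differentiableAt_const w)
  have main : ∀ u v, LinearIndependent ℝ ![u, v] →
      (fderiv ℝ (fun q => ap q v) p u - fderiv ℝ (fun q => ap q u) p v = 0) ∧
      (fderiv ℝ (fun q => am q v) p u - fderiv ℝ (fun q => am q u) p v = 0) := by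
    intro u v huv
    have hpos := areaSq_pos f (hf.2 p hp) huv
    obtain ⟨hG, hN⟩ := hK p hp u v huv
    have eT : ∀ w z, fderiv ℝ (fun q => connectionForm (fun q => frameVec (gp q) (gm q) unitJ)
        (fun q => frameVec (gp q) (gm q) unitK) q w) p z =
        -fderiv ℝ (fun q => ap q w) p z - fderiv ℝ (fun q => am q w) p z := by
      intro w z
      have : (fun q => connectionForm (fun q => frameVec (gp q) (gm q) unitJ)
          (fun q => frameVec (gp q) (gm q) unitK) q w) =ᶠ[nhds p] fun q => -ap q w - am q w := by
        filter_upwards [hV.mem_nhds hp] with q hq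
        exact connectionForm_tangent hV hgp hgm hnp hnm hq w
      rw [this.fderiv_eq, fderiv_fun_sub (hapv w).fun_neg (hamv w), fderiv_fun_neg]
      rfl
    have eN : ∀ w z, fderiv ℝ (fun q => connectionForm (fun q => frameVec (gp q) (gm q) 1)
        (fun q => frameVec (gp q) (gm q) unitI) q w) p z =
        fderiv ℝ (fun q => am q w) p z - fderiv ℝ (fun q => ap q w) p z := by
      intro w z
      have : (fun q => connectionForm (fun q => frameVec (gp q) (gm q) 1)
          (fun q => frameVec (gp q) (gm q) unitI) q w) =ᶠ[nhds p] fun q => am q w - ap q w := by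
        filter_upwards [hV.mem_nhds hp] with q hq
        exact connectionForm_normal hV hgp hgm hnp hnm hq w
      rw [this.fderiv_eq, fderiv_fun_sub (hamv w) (hapv w)]
      rfl
    have hT := isOrthonormalFrameOn_tangent hV hgp hgm hF
    have hNf := isOrthonormalFrameOn_normal hV hgp hgm hF
    rw [gaussCurvature_eq hT hf.1 hp, eT, eT] at hG
    have har := areaSq_eq hT hp u v
    have h1 : (-fderiv ℝ (fun q => ap q v) p u - fderiv ℝ (fun q => am q v) p u) -
        (-fderiv ℝ (fun q => ap q u) p v - fderiv ℝ (fun q => am q u) p v) = 0 := by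
      rcases div_eq_zero_iff.1 hG with h | h
      · rcases mul_eq_zero.1 h with h | h
        · exact h
        · rw [har, h] at hpos; norm_num at hpos
      · exact absurd h hpos.ne'
    -- Choosing the frame itself as normal basis, with `n₁` given by 1 and `n₀` by I, makes the
    -- algebraic factor in `normalCurvature_eq` equal to 1.
    have hN' := hN (frameVec (gp p) (gm p) unitI) (hF p hp).mem_I (frameVec (gp p) (gm p) 1)
      (hF p hp).mem_one (by
        rw [orthonormal_iff_ite]
        intro i j
        have a1 := hNf.inner_one p hp
        have a2 := hNf.inner_two p hp
        have a3 := hNf.inner_one_two p hp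
        have a4 := a3
        rw [real_inner_comm] at a4
        have n1 := norm_eq_sqrt_real_inner (frameVec (gp p) (gm p) 1)
        have n2 := norm_eq_sqrt_real_inner (frameVec (gp p) (gm p) unitI)
        rw [a1, Real.sqrt_one] at n1
        rw [a2, Real.sqrt_one] at n2
        fin_cases i <;> fin_cases j <;> simp [n1, n2, a3, a4])
    rw [normalCurvature_eq hNf hp u v _ (hF p hp).mem_one, eN, eN, hNf.inner_one p hp,
      hNf.inner_two p hp, real_inner_comm, hNf.inner_one_two p hp] at hN'
    have h2 : (fderiv ℝ (fun q => am q v) p u - fderiv ℝ (fun q => ap q v) p u) -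
        (fderiv ℝ (fun q => am q u) p v - fderiv ℝ (fun q => ap q u) p v) = 0 := by
      rcases div_eq_zero_iff.1 hN' with h | h
      · linarith
      · exact absurd h (Real.sqrt_pos.2 hpos).ne'
    -- The tangent equation kills the sum of the two exterior derivatives, the normal one their
    -- difference.
    constructor <;> linarith
  exact ⟨closed_of_linearIndependent hap (fun u v h => (main u v h).1) u v,
    closed_of_linearIndependent ham (fun u v h => (main u v h).2) u v⟩

end Curvatures

/-! ### The direct statement -/

namespace Quaternion

/-- Products of two vectors in the J, K plane lie in the span of 1 and I. This is why a frame
without I-parts moves the tangent vectors in normal directions only. -/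
theorem circleJK_mul (s t : ℝ) :
    circleJK s * circleJK t = -Real.cos (t - s) • (1 : ℍ[ℝ]) + Real.sin (t - s) • unitI := by
  apply Quaternion.ext <;> simp [circleJK, Real.cos_sub, Real.sin_sub] <;> ring

@[simp] theorem re_circleJK (t : ℝ) : (circleJK t).re = 0 := by simp [circleJK]
@[simp] theorem imI_circleJK (t : ℝ) : (circleJK t).imI = 0 := by simp [circleJK]
@[simp] theorem imJ_circleJK (t : ℝ) : (circleJK t).imJ = Real.cos t := by simp [circleJK]
@[simp] theorem imK_circleJK (t : ℝ) : (circleJK t).imK = Real.sin t := by simp [circleJK]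

theorem star_circleJK (t : ℝ) : star (circleJK t) = -circleJK t := by
  apply Quaternion.ext <;> simp

theorem circleJK_add_pi_div_two (t : ℝ) :
    circleJK (t + Real.pi / 2) = -Real.sin t • unitJ + Real.cos t • unitK := by
  apply Quaternion.ext <;> simp [Real.cos_add_pi_div_two, Real.sin_add_pi_div_two]

theorem contDiff_circleJK : ContDiff ℝ ∞ circleJK := by
  unfold circleJK
  exact (Real.contDiff_cos.smul contDiff_const).add (Real.contDiff_sin.smul contDiff_const)

theorem hasDerivAt_circleJK (t : ℝ) : HasDerivAt circleJK (circleJK (t + Real.pi / 2)) t := by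
  rw [circleJK_add_pi_div_two]
  exact ((Real.hasDerivAt_cos t).smul_const unitJ).add ((Real.hasDerivAt_sin t).smul_const unitK)

end Quaternion

/-! ### Derivatives of tangent fields with variable coefficients. -/

section MovingFrame

variable {E : Type*} [NormedAddCommGroup E] [NormedSpace ℝ E] {gp gm X : E → ℍ[ℝ]}

theorem fderiv_smul_circleJK {l θ : E → ℝ} {q : E} (hl : DifferentiableAt ℝ l q)
    (hθ : DifferentiableAt ℝ θ q) (u : E) :
    fderiv ℝ (fun x => l x • circleJK (θ x)) q u = fderiv ℝ l q u • circleJK (θ q) +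
      (l q * fderiv ℝ θ q u) • circleJK (θ q + Real.pi / 2) := by
  have h1 := (hasDerivAt_circleJK (θ q)).hasFDerivAt.comp q hθ.hasFDerivAt
  have h2 := (hl.hasFDerivAt.fun_smul h1).fderiv
  have h3 : (fun x => l x • circleJK (θ x)) = fun y => l y • (circleJK ∘ θ) y := rfl
  rw [h3, h2]
  simp [smul_smul]
  rw [add_comm]

theorem contDiffOn_frameVec_field {V : Set E} (hgp : ContDiffOn ℝ ∞ gp V)
    (hgm : ContDiffOn ℝ ∞ gm V) (hX : ContDiffOn ℝ ∞ X V) :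
    ContDiffOn ℝ ∞ (fun q => frameVec (gp q) (gm q) (X q)) V :=
  toR4.contDiff.comp_contDiffOn ((hgp.quaternion_star.mul hX).mul hgm)

theorem fderiv_frameVec_field {q : E} (hgp : DifferentiableAt ℝ gp q)
    (hgm : DifferentiableAt ℝ gm q) (hX : DifferentiableAt ℝ X q)
    {u : E} {a b : ℍ[ℝ]} (ha : fderiv ℝ gp q u = a * gp q) (hb : fderiv ℝ gm q u = b * gm q)
    (hs : star a = -a) :
    fderiv ℝ (fun x => frameVec (gp x) (gm x) (X x)) q u =
      frameVec (gp q) (gm q) (fderiv ℝ X q u + (X q * b - a * X q)) := by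
  have hst : DifferentiableAt ℝ (fun x => star (gp x)) q :=
    contDiff_star_quaternion.differentiable (by simp) |>.differentiableAt.comp q hgp
  have hsX : DifferentiableAt ℝ (fun x => star (gp x) * X x) q := hst.fun_mul hX
  have h1 : (fun x => frameVec (gp x) (gm x) (X x)) =
    toR4 ∘ fun x => star (gp x) * X x * gm x := rfl
  rw [h1, toR4.comp_fderiv]
  show toR4 (fderiv ℝ (fun x => star (gp x) * X x * gm x) q u) = _
  rw [fderiv_quaternion_mul hsX hgm, fderiv_quaternion_mul hst hX,
    fderiv_quaternion_star hgp, ha, hb, star_mul, hs]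
  unfold frameVec
  congr 1
  noncomm_ring

end MovingFrame

/-! ### The coframe and the spinor of representation data in real terms. -/

namespace IsRepresentationData

variable {U : Set LorentzNumber} {ψ : LorentzNumber → LorentzNumber} {l m : LorentzNumber → ℝ}
  {g : LorentzNumber → LorentzQuaternion} {ω₂ ω₃ : LorentzNumber → (LorentzNumber →L[ℝ] ℝ)}

theorem ne_zero (h : IsRepresentationData U ψ l m g ω₂ ω₃) {a : LorentzNumber} (ha : a ∈ U) :
    l a ≠ 0 ∧ m a ≠ 0 :=
  ⟨left_ne_zero_of_mul (h.mul_pos a ha).ne', right_ne_zero_of_mul (h.mul_pos a ha).ne'⟩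

theorem eq_combination (h : IsRepresentationData U ψ l m g ω₂ ω₃) {a : LorentzNumber} (ha : a ∈ U)
    (k : LorentzNumber) :
    k = (Real.sin (ψ a).re * l a * k.re + Real.cos (ψ a).re * m a * k.im) • frameTwo ψ l m a +
      (-Real.cos (ψ a).re * l a * k.re + Real.sin (ψ a).re * m a * k.im) •
        frameThree ψ l m a := by
  obtain ⟨hl, hm⟩ := h.ne_zero ha
  have hsc := Real.sin_sq_add_cos_sq (ψ a).re
  ext
  · simp only [frameTwo, frameThree, QuadraticAlgebra.re_add, QuadraticAlgebra.re_smul,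
      smul_eq_mul]
    field_simp
    linear_combination (-(l a * k.re)) * hsc
  · simp only [frameTwo, frameThree, QuadraticAlgebra.im_add, QuadraticAlgebra.im_smul,
      smul_eq_mul]
    field_simp
    linear_combination (-(m a * k.im)) * hsc

theorem coframe_apply (h : IsRepresentationData U ψ l m g ω₂ ω₃) {a : LorentzNumber} (ha : a ∈ U)
    (k : LorentzNumber) :
    ω₂ a k = Real.sin (ψ a).re * l a * k.re + Real.cos (ψ a).re * m a * k.im ∧
      ω₃ a k = -Real.cos (ψ a).re * l a * k.re + Real.sin (ψ a).re * m a * k.im := by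
  obtain ⟨h1, h2, h3, h4⟩ := h.dual a ha
  constructor
  · conv_lhs => rw [h.eq_combination ha k]
    rw [map_add, map_smul, map_smul, h1, h2]; simp
  · conv_lhs => rw [h.eq_combination ha k]
    rw [map_add, map_smul, map_smul, h3, h4]; simp

/-- Inverting the orthogonal change of basis diagonalizes the coframe: in the frame rotated by θ₁ it
is (-λ dx, μ dy), so the metric is λ²dx² + μ²dy². -/
theorem coframe_combination (h : IsRepresentationData U ψ l m g ω₂ ω₃) {a : LorentzNumber}
    (ha : a ∈ U) (k : LorentzNumber) :
    ω₂ a k • unitJ + ω₃ a k • unitK = (-(l a) * k.re) • circleJK ((ψ a).re + Real.pi / 2) +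
      (m a * k.im) • circleJK (ψ a).re := by
  rw [(h.coframe_apply ha k).1, (h.coframe_apply ha k).2, circleJK_add_pi_div_two]
  unfold circleJK
  module

theorem norm_eq_one (h : IsRepresentationData U ψ l m g ω₂ ω₃) {a : LorentzNumber} (ha : a ∈ U) :
    ‖LorentzQuaternion.plus (g a)‖ = 1 ∧ ‖LorentzQuaternion.minus (g a)‖ = 1 :=
  LorentzQuaternion.mem_spin4_iff.1 (h.g_mem a ha)

theorem smooth_plus (h : IsRepresentationData U ψ l m g ω₂ ω₃) :
    ContDiffOn ℝ ∞ (fun a => LorentzQuaternion.plus (g a)) U :=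
  LorentzQuaternion.plus.contDiff.comp_contDiffOn h.g_conformal.1

theorem smooth_minus (h : IsRepresentationData U ψ l m g ω₂ ω₃) :
    ContDiffOn ℝ ∞ (fun a => LorentzQuaternion.minus (g a)) U :=
  LorentzQuaternion.minus.contDiff.comp_contDiffOn h.g_conformal.1

/-- Combining dg = g' da with the formula for g'g⁻¹ and taking idempotent components gives η± = d(x
± y) times the unit vector of angle θ₁ ± θ₂ in the J, K plane. -/
theorem fderiv_plus_minus (h : IsRepresentationData U ψ l m g ω₂ ω₃) (hU : IsOpen U)
    {a : LorentzNumber} (ha : a ∈ U) (k : LorentzNumber) :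
    fderiv ℝ (fun b => LorentzQuaternion.plus (g b)) a k =
        (LorentzNumber.plus k • circleJK (LorentzNumber.plus (ψ a))) *
          LorentzQuaternion.plus (g a) ∧
      fderiv ℝ (fun b => LorentzQuaternion.minus (g b)) a k =
        (LorentzNumber.minus k • circleJK (LorentzNumber.minus (ψ a))) *
          LorentzQuaternion.minus (g a) := by
  have hd := h.g_conformal.1.differentiableAt_of_isOpen hU ha
  have h1 : fderiv ℝ (fun b => LorentzQuaternion.plus (g b)) a k =
      LorentzQuaternion.plus (fderiv ℝ g a k) :=
    congrArg (fun L : LorentzNumber →L[ℝ] ℍ[ℝ] => L k)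
      (LorentzQuaternion.plus.hasFDerivAt.comp a hd.hasFDerivAt).fderiv
  have h2 : fderiv ℝ (fun b => LorentzQuaternion.minus (g b)) a k =
      LorentzQuaternion.minus (fderiv ℝ g a k) :=
    congrArg (fun L : LorentzNumber →L[ℝ] ℍ[ℝ] => L k)
      (LorentzQuaternion.minus.hasFDerivAt.comp a hd.hasFDerivAt).fderiv
  have hg := h.g_deriv a ha
  obtain ⟨np, nm⟩ := h.norm_eq_one ha
  rw [h1, h2, h.g_conformal.fderiv_eq ha k, LorentzQuaternion.plus_smul,
    LorentzQuaternion.minus_smul]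
  have e1 := congrArg LorentzQuaternion.plus hg
  have e2 := congrArg LorentzQuaternion.minus hg
  simp only [map_add, LorentzQuaternion.plus_mul, LorentzQuaternion.minus_mul,
    LorentzQuaternion.plus_star, LorentzQuaternion.minus_star, LorentzQuaternion.plus_smul,
    LorentzQuaternion.minus_smul, LorentzQuaternion.plus_J, LorentzQuaternion.plus_K,
    LorentzQuaternion.minus_J, LorentzQuaternion.minus_K, LorentzNumber.plus_cos,
    LorentzNumber.plus_sin, LorentzNumber.minus_cos, LorentzNumber.minus_sin] at e1 e2
  constructor
  · rw [circleJK, ← e1, smul_mul_assoc, mul_assoc, star_mul_self_of_norm np, mul_one]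
  · rw [circleJK, ← e2, smul_mul_assoc, mul_assoc, star_mul_self_of_norm nm, mul_one]

/-- The representation form as a continuous linear map with values in `ℝ⁴`. -/
theorem representationForm_eq_iff (h : IsRepresentationData U ψ l m g ω₂ ω₃)
    {a : LorentzNumber} (ha : a ∈ U) (k : LorentzNumber) (x : R4) :
    LorentzQuaternion.ofR4 x = representationForm g ω₂ ω₃ a k ↔
      x = frameVec (LorentzQuaternion.plus (g a)) (LorentzQuaternion.minus (g a))
        ((-(l a) * k.re) • circleJK ((ψ a).re + Real.pi / 2) +
          (m a * k.im) • circleJK (ψ a).re) := by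
  unfold representationForm
  have hp : LorentzQuaternion.plus
      ((ω₂ a k) • LorentzQuaternion.J + (ω₃ a k) • LorentzQuaternion.K) =
        ω₂ a k • unitJ + ω₃ a k • unitK := by
    rw [map_add, map_smul, map_smul, LorentzQuaternion.plus_J, LorentzQuaternion.plus_K]
  have hm : LorentzQuaternion.minus
      ((ω₂ a k) • LorentzQuaternion.J + (ω₃ a k) • LorentzQuaternion.K) =
        ω₂ a k • unitJ + ω₃ a k • unitK := by
    rw [map_add, map_smul, map_smul, LorentzQuaternion.minus_J, LorentzQuaternion.minus_K]
  rw [LorentzQuaternion.ofR4_eq_sandwich_iff _ _ _ (by rw [hp, hm]) (by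
    rw [hp]; apply Quaternion.ext <;> simp), hp, h.coframe_combination ha k]
  rfl

end IsRepresentationData

/-! ### Second-order computations in characteristic coordinates. -/

section Adapted

variable {gp gm : LorentzNumber → ℍ[ℝ]} {ψ : LorentzNumber → LorentzNumber}

theorem fderiv_re {a : LorentzNumber} (h : DifferentiableAt ℝ ψ a) (k : LorentzNumber) :
    fderiv ℝ (fun b => (ψ b).re) a k = (fderiv ℝ ψ a k).re := by
  have h1 : (fun b => (ψ b).re) = LorentzNumber.reCLM ∘ ψ := by
    ext b; exact (LorentzNumber.reCLM_apply _).symm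
  rw [h1, (LorentzNumber.reCLM.hasFDerivAt.comp a h.hasFDerivAt).fderiv]
  exact LorentzNumber.reCLM_apply _

theorem fderiv_im {a : LorentzNumber} (h : DifferentiableAt ℝ ψ a) (k : LorentzNumber) :
    fderiv ℝ (fun b => (ψ b).im) a k = (fderiv ℝ ψ a k).im := by
  have h1 : (fun b => (ψ b).im) = LorentzNumber.imCLM ∘ ψ := by
    ext b; exact (LorentzNumber.imCLM_apply _).symm
  rw [h1, (LorentzNumber.imCLM.hasFDerivAt.comp a h.hasFDerivAt).fderiv]
  exact LorentzNumber.imCLM_apply _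

theorem ContDiffOn.lorentz_re {U : Set LorentzNumber} (h : ContDiffOn ℝ ∞ ψ U) :
    ContDiffOn ℝ ∞ (fun b => (ψ b).re) U :=
  (LorentzNumber.reCLM.contDiff.comp_contDiffOn h).congr
    fun _ _ => (LorentzNumber.reCLM_apply _).symm

/-- Derivative of a tangent field in the frame of principal directions. -/
theorem fderiv_adapted_frame {a : LorentzNumber} (hgp : DifferentiableAt ℝ gp a)
    (hgm : DifferentiableAt ℝ gm a) {θ A B : LorentzNumber → ℝ} {θ₂ : ℝ}
    {k : LorentzNumber}
    (hp : fderiv ℝ gp a k = (LorentzNumber.plus k • circleJK (θ a + θ₂)) * gp a)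
    (hm : fderiv ℝ gm a k = (LorentzNumber.minus k • circleJK (θ a - θ₂)) * gm a)
    (hθ : DifferentiableAt ℝ θ a) (hA : DifferentiableAt ℝ A a) (hB : DifferentiableAt ℝ B a) :
    fderiv ℝ (fun b => frameVec (gp b) (gm b)
        (A b • circleJK (θ b + Real.pi / 2) + B b • circleJK (θ b))) a k =
      frameVec (gp a) (gm a)
        ((fderiv ℝ A a k + B a * fderiv ℝ θ a k) • circleJK (θ a + Real.pi / 2) +
          (fderiv ℝ B a k - A a * fderiv ℝ θ a k) • circleJK (θ a) +
          ((2 * A a * k.re) • (Real.sin θ₂ • (1 : ℍ[ℝ]) - Real.cos θ₂ • unitI) +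
          (2 * B a * k.im) • (Real.cos θ₂ • (1 : ℍ[ℝ]) + Real.sin θ₂ • unitI))) := by
  have hθ' : DifferentiableAt ℝ (fun b => θ b + Real.pi / 2) a := hθ.add_const _
  have d1 : DifferentiableAt ℝ (fun b => A b • circleJK (θ b + Real.pi / 2)) a :=
    hA.fun_smul ((contDiff_circleJK.differentiable (by simp)).differentiableAt.comp a hθ')
  have d2 : DifferentiableAt ℝ (fun b => B b • circleJK (θ b)) a :=
    hB.fun_smul ((contDiff_circleJK.differentiable (by simp)).differentiableAt.comp a hθ)
  rw [fderiv_frameVec_field hgp hgm (d1.fun_add d2) hp hm (by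
    rw [Quaternion.star_smul, star_circleJK, smul_neg])]
  congr 1
  rw [fderiv_fun_add d1 d2, add_apply, fderiv_smul_circleJK hA hθ', fderiv_smul_circleJK hB hθ,
    fderiv_add_const]
  -- Differentiating the coefficients and the angle gives the two tangent terms. The products Xb -
  -- aX are purely normal by `circleJK_mul`; with the angles θ ± θ₂ they depend only on θ₂, and A is
  -- coupled to dx alone, B to dy alone.
  have e1 : circleJK (θ a + Real.pi / 2 + Real.pi / 2) = -circleJK (θ a) := by
    apply Quaternion.ext <;> simp [Real.cos_add_pi_div_two, Real.sin_add_pi_div_two]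
  have e2 : LorentzNumber.plus k = k.re + k.im := rfl
  have e3 : LorentzNumber.minus k = k.re - k.im := rfl
  have a1 : θ a - θ₂ - (θ a + Real.pi / 2) = -(θ₂ + Real.pi / 2) := by ring
  have a2 : θ a - θ₂ - θ a = -θ₂ := by ring
  have a3 : θ a + Real.pi / 2 - (θ a + θ₂) = Real.pi / 2 - θ₂ := by ring
  have a4 : θ a - (θ a + θ₂) = -θ₂ := by ring
  rw [e1, e2, e3, add_mul, mul_add]
  simp only [smul_mul_assoc, mul_smul_comm, circleJK_mul, a1, a2, a3, a4, Real.cos_neg,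
    Real.sin_neg, Real.cos_add_pi_div_two, Real.sin_add_pi_div_two, Real.cos_pi_div_two_sub,
    Real.sin_pi_div_two_sub]
  module

theorem IsLorentzConformalOn.cauchyRiemann {U : Set LorentzNumber}
    (h : IsLorentzConformalOn ψ U) (hU : IsOpen U) {a : LorentzNumber} (ha : a ∈ U) :
    fderiv ℝ (fun b => (ψ b).re) a LorentzNumber.sigma = fderiv ℝ (fun b => (ψ b).im) a 1 ∧
      fderiv ℝ (fun b => (ψ b).im) a LorentzNumber.sigma =
        fderiv ℝ (fun b => (ψ b).re) a 1 := by
  have hd := h.1.differentiableAt_of_isOpen hU ha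
  have h1 := h.2 a ha 1
  rw [mul_one] at h1
  rw [fderiv_re hd, fderiv_re hd, fderiv_im hd, fderiv_im hd, h1]
  simp [LorentzNumber.sigma]

end Adapted

/-! ### Closedness of the form, its primitives and their flatness. -/

namespace IsRepresentationData

variable {U : Set LorentzNumber} {ψ : LorentzNumber → LorentzNumber} {l m : LorentzNumber → ℝ}
  {g : LorentzNumber → LorentzQuaternion} {ω₂ ω₃ : LorentzNumber → (LorentzNumber →L[ℝ] ℝ)}

/-- The vector of `ℝ⁴` corresponding to the value of the representation form. -/
theorem contDiffOn_field (h : IsRepresentationData U ψ l m g ω₂ ω₃) (k : LorentzNumber) :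
    ContDiffOn ℝ ∞ (fun a => frameVec (LorentzQuaternion.plus (g a))
      (LorentzQuaternion.minus (g a)) ((-(l a) * k.re) • circleJK ((ψ a).re + Real.pi / 2) +
        (m a * k.im) • circleJK (ψ a).re)) U := by
  have hre := h.psi_conformal.1.lorentz_re
  refine contDiffOn_frameVec_field h.smooth_plus h.smooth_minus ?_
  exact ((h.l_smooth.neg.mul contDiffOn_const).smul
    (contDiff_circleJK.comp_contDiffOn (hre.add contDiffOn_const))).add
    ((h.m_smooth.mul contDiffOn_const).smul (contDiff_circleJK.comp_contDiffOn hre))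

/-- The one-form with values in `ℝ⁴` corresponding to the representation form. -/
def form (ψ : LorentzNumber → LorentzNumber) (l m : LorentzNumber → ℝ)
    (g : LorentzNumber → LorentzQuaternion) (a : LorentzNumber) : LorentzNumber →L[ℝ] R4 :=
  LorentzNumber.reCLM.smulRight (frameVec (LorentzQuaternion.plus (g a))
      (LorentzQuaternion.minus (g a))
      ((-(l a) * (1 : LorentzNumber).re) • circleJK ((ψ a).re + Real.pi / 2) +
        (m a * (1 : LorentzNumber).im) • circleJK (ψ a).re)) +
    LorentzNumber.imCLM.smulRight (frameVec (LorentzQuaternion.plus (g a))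
      (LorentzQuaternion.minus (g a))
      ((-(l a) * LorentzNumber.sigma.re) • circleJK ((ψ a).re + Real.pi / 2) +
        (m a * LorentzNumber.sigma.im) • circleJK (ψ a).re))

theorem form_apply (a k : LorentzNumber) : form ψ l m g a k =
    frameVec (LorentzQuaternion.plus (g a)) (LorentzQuaternion.minus (g a))
      ((-(l a) * k.re) • circleJK ((ψ a).re + Real.pi / 2) +
        (m a * k.im) • circleJK (ψ a).re) := by
  simp only [form, add_apply, ContinuousLinearMap.smulRight_apply,
    LorentzNumber.reCLM_apply, LorentzNumber.imCLM_apply, ← frameVec_smul, ← frameVec_add]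
  congr 1
  simp only [LorentzNumber.sigma, QuadraticAlgebra.re_one, QuadraticAlgebra.im_one]
  module

theorem contDiffOn_form (h : IsRepresentationData U ψ l m g ω₂ ω₃) :
    ContDiffOn ℝ ∞ (form ψ l m g) U :=
  (contDiffOn_const.smulRight (h.contDiffOn_field 1)).add
    (contDiffOn_const.smulRight (h.contDiffOn_field LorentzNumber.sigma))

/-- The derivative along u of the value at v has normal coefficients proportional to `u.re * v.re`
and `u.im * v.im`, symmetric without any hypothesis on λ and μ. Symmetry of the tangent part
requires ∂_yλ = -μ∂ₓθ₁ and ∂ₓμ = λ∂_yθ₁, and Cauchy–Riemann turns these into the given system. -/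
theorem form_closed (h : IsRepresentationData U ψ l m g ω₂ ω₃) (hU : IsOpen U)
    {a : LorentzNumber} (ha : a ∈ U) (u v : LorentzNumber) :
    fderiv ℝ (fun b => form ψ l m g b v) a u = fderiv ℝ (fun b => form ψ l m g b u) a v := by
  simp only [form_apply]
  have hψ := h.psi_conformal.1
  have hre := hψ.lorentz_re.differentiableAt_of_isOpen hU ha
  have hl := h.l_smooth.differentiableAt_of_isOpen hU ha
  have hm := h.m_smooth.differentiableAt_of_isOpen hU ha
  have key : ∀ u v : LorentzNumber, _ := fun u v => fderiv_adapted_frame (θ := fun b => (ψ b).re)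
    (A := fun b => -(l b) * v.re) (B := fun b => m b * v.im) (k := u) (θ₂ := (ψ a).im)
    (h.smooth_plus.differentiableAt_of_isOpen hU ha)
    (h.smooth_minus.differentiableAt_of_isOpen hU ha)
    (h.fderiv_plus_minus hU ha u).1 (h.fderiv_plus_minus hU ha u).2 hre
    (hl.fun_neg.mul_const _) (hm.mul_const _)
  rw [key u v, key v u]
  congr 1
  have dA : ∀ u v : LorentzNumber, fderiv ℝ (fun b => -(l b) * v.re) a u =
      -(v.re * (u.re * fderiv ℝ l a 1 + u.im * fderiv ℝ l a LorentzNumber.sigma)) := by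
    intro u v
    rw [fderiv_mul_const hl.fun_neg, fderiv_fun_neg]
    conv_lhs => rw [LorentzNumber.eq_smul_add_smul u]
    simp
  have dB : ∀ u v : LorentzNumber, fderiv ℝ (fun b => m b * v.im) a u =
      v.im * (u.re * fderiv ℝ m a 1 + u.im * fderiv ℝ m a LorentzNumber.sigma) := by
    intro u v
    rw [fderiv_mul_const hm]
    conv_lhs => rw [LorentzNumber.eq_smul_add_smul u]
    simp
  have dθ : ∀ u : LorentzNumber, fderiv ℝ (fun b => (ψ b).re) a u =
      u.re * fderiv ℝ (fun b => (ψ b).re) a 1 +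
        u.im * fderiv ℝ (fun b => (ψ b).re) a LorentzNumber.sigma := by
    intro u
    conv_lhs => rw [LorentzNumber.eq_smul_add_smul u]
    simp
  obtain ⟨c1, c2⟩ := h.psi_conformal.cauchyRiemann hU ha
  rw [dA, dA, dB, dB, dθ u, dθ v, h.system_x a ha, h.system_y a ha, ← c1, c2]
  module

theorem isPrimitiveOn_iff (h : IsRepresentationData U ψ l m g ω₂ ω₃) {F : LorentzNumber → R4} :
    IsPrimitiveOn F (representationForm g ω₂ ω₃) U ↔
      ∀ a ∈ U, HasFDerivAt F (form ψ l m g a) a := by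
  constructor
  · intro hF a ha
    obtain ⟨h1, h2⟩ := hF a ha
    have : fderiv ℝ F a = form ψ l m g a := by
      ext1 k
      rw [form_apply]
      exact (h.representationForm_eq_iff ha k _).1 (h2 k)
    rw [← this]
    exact h1.hasFDerivAt
  · intro hF a ha
    refine ⟨(hF a ha).differentiableAt, fun k => ?_⟩
    rw [h.representationForm_eq_iff ha, (hF a ha).fderiv, form_apply]

theorem exists_isPrimitiveOn (h : IsRepresentationData U ψ l m g ω₂ ω₃) (hU : IsOpen U)
    [SimplyConnectedSpace U] :
    ∃ F : LorentzNumber → R4, IsPrimitiveOn F (representationForm g ω₂ ω₃) U := by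
  obtain ⟨F, hF⟩ := exists_primitive_of_simplyConnected hU (η := form ψ l m g) (by
    intro p hp
    obtain ⟨r, hr, hball⟩ := Metric.isOpen_iff.1 hU p hp
    obtain ⟨f, -, hf⟩ := exists_primitive_ball (h.contDiffOn_form.mono hball)
      (fun q hq u v => h.form_closed hU (hball hq) u v)
    exact ⟨f, by filter_upwards [Metric.ball_mem_nhds p hr] with q hq using hf q hq⟩)
  exact ⟨F, h.isPrimitiveOn_iff.2 hF⟩

theorem isImmersedOn_and_hasZeroCurvaturesOn (h : IsRepresentationData U ψ l m g ω₂ ω₃)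
    (hU : IsOpen U) {F : LorentzNumber → R4}
    (hF : IsPrimitiveOn F (representationForm g ω₂ ω₃) U) :
    IsImmersedOn F U ∧ HasZeroCurvaturesOn F U := by
  have hF' := h.isPrimitiveOn_iff.1 hF
  have hsm : ContDiffOn ℝ ∞ F U := by
    rw [contDiffOn_infty_iff_fderiv_of_isOpen hU]
    exact ⟨fun a ha => (hF' a ha).differentiableAt.differentiableWithinAt,
      h.contDiffOn_form.congr fun a ha => (hF' a ha).fderiv⟩
  have hval : ∀ a ∈ U, ∀ k, fderiv ℝ F a k = frameVec (LorentzQuaternion.plus (g a))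
      (LorentzQuaternion.minus (g a)) (ω₂ a k • unitJ + ω₃ a k • unitK) := fun a ha k => by
    rw [(hF' a ha).fderiv, form_apply, h.coframe_combination ha]
  have hframe : ∀ a ∈ U, IsFramedBy (tangentPlane F a) (LorentzQuaternion.plus (g a))
      (LorentzQuaternion.minus (g a)) := by
    intro a ha
    obtain ⟨np, nm⟩ := h.norm_eq_one ha
    obtain ⟨d1, d2, d3, d4⟩ := h.dual a ha
    refine ⟨np, nm, ⟨frameTwo ψ l m a, ?_⟩, ⟨frameThree ψ l m a, ?_⟩, ?_, ?_⟩
    · refine (hval a ha _).trans ?_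
      rw [d1, d3]; simp
    · refine (hval a ha _).trans ?_
      rw [d2, d4]; simp
    all_goals
      rw [Submodule.mem_orthogonal]
      rintro w ⟨k, rfl⟩
      refine (congrArg (fun x => inner ℝ x _) (hval a ha k)).trans ?_
      rw [inner_frameVec np nm, inner_eq]; simp
  refine ⟨⟨hsm, fun a ha k₁ k₂ hk => ?_⟩, ?_⟩
  · obtain ⟨np, nm⟩ := h.norm_eq_one ha
    rw [hval a ha, hval a ha] at hk
    -- The frame coordinates of dF are ω₂ and ω₃, and a vector is determined by its two coframe
    -- values, so dF is injective.
    have h2 := congrArg (fun x => inner ℝ (frameVec (LorentzQuaternion.plus (g a))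
      (LorentzQuaternion.minus (g a)) unitJ) x) hk
    have h3 := congrArg (fun x => inner ℝ (frameVec (LorentzQuaternion.plus (g a))
      (LorentzQuaternion.minus (g a)) unitK) x) hk
    simp only [inner_frameVec np nm, inner_eq] at h2 h3
    simp at h2 h3
    rw [h.eq_combination ha k₁, h.eq_combination ha k₂, ← (h.coframe_apply ha k₁).1,
      ← (h.coframe_apply ha k₁).2, ← (h.coframe_apply ha k₂).1, ← (h.coframe_apply ha k₂).2, h2, h3]
  -- Both logarithmic derivatives are multiples of vectors of the J, K plane, hence have no I-part.
  · refine hasZeroCurvaturesOn_of_imI_eq_zero hU hsm h.smooth_plus h.smooth_minus hframe ?_ ?_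
    · intro a ha k
      rw [quatLogDeriv_apply, (h.fderiv_plus_minus hU ha k).1, mul_assoc,
        self_mul_star_of_norm (h.norm_eq_one ha).1]
      simp
    · intro a ha k
      rw [quatLogDeriv_apply, (h.fderiv_plus_minus hU ha k).2, mul_assoc,
        self_mul_star_of_norm (h.norm_eq_one ha).2]
      simp

end IsRepresentationData

/-! ### Recovering the data in adapted coordinates -/

section Recover

theorem Quaternion.frameVec_injective {gp gm : ℍ[ℝ]} (hp : ‖gp‖ = 1) (hm : ‖gm‖ = 1) :
    Function.Injective (frameVec gp gm) := fun X Y h => by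
  have h2 := toR4.injective h
  exact (sandwich gp gm hp hm).injective h2

variable {U : Set LorentzNumber} {ψ : LorentzNumber → LorentzNumber}
  {gp gm : LorentzNumber → ℍ[ℝ]} {F : LorentzNumber → R4}

/-- The component of the differential of `F` along a vector of the moving frame. -/
def frameComponent (gp gm : LorentzNumber → ℍ[ℝ]) (F : LorentzNumber → R4) (X : ℍ[ℝ])
    (a : LorentzNumber) : LorentzNumber →L[ℝ] ℝ :=
  (innerSL ℝ (frameVec (gp a) (gm a) X)).comp (fderiv ℝ F a)

theorem frameComponent_apply (X : ℍ[ℝ]) (a k : LorentzNumber) :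
    frameComponent gp gm F X a k = inner ℝ (frameVec (gp a) (gm a) X) (fderiv ℝ F a k) := rfl

/-- Once the frame has the right logarithmic derivatives, only λ, μ and their equations are missing,
and they follow from the symmetry of the second derivatives of F. This is the computation of
`form_closed` read backwards. -/
theorem exists_isRepresentationData_of_adapted (hU : IsOpen U) (hψ : IsLorentzConformalOn ψ U)
    (hgp : ContDiffOn ℝ ∞ gp U) (hgm : ContDiffOn ℝ ∞ gm U) (hF : ContDiffOn ℝ ∞ F U)
    (hnp : ∀ a ∈ U, ‖gp a‖ = 1) (hnm : ∀ a ∈ U, ‖gm a‖ = 1)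
    (hdp : ∀ a ∈ U, ∀ k, fderiv ℝ gp a k =
      (LorentzNumber.plus k • circleJK (LorentzNumber.plus (ψ a))) * gp a)
    (hdm : ∀ a ∈ U, ∀ k, fderiv ℝ gm a k =
      (LorentzNumber.minus k • circleJK (LorentzNumber.minus (ψ a))) * gm a)
    (htan : ∀ a ∈ U, ∀ k, fderiv ℝ F a k = frameVec (gp a) (gm a)
      (frameComponent gp gm F unitJ a k • unitJ + frameComponent gp gm F unitK a k • unitK))
    (hor : ∀ a ∈ U, 0 < frameComponent gp gm F unitJ a 1 *
        frameComponent gp gm F unitK a LorentzNumber.sigma -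
      frameComponent gp gm F unitK a 1 * frameComponent gp gm F unitJ a LorentzNumber.sigma) :
    ∃ (l m : LorentzNumber → ℝ) (g : LorentzNumber → LorentzQuaternion)
      (ω₂ ω₃ : LorentzNumber → (LorentzNumber →L[ℝ] ℝ)),
      IsRepresentationData U ψ l m g ω₂ ω₃ ∧
        IsPrimitiveOn F (representationForm g ω₂ ω₃) U := by
  set ω₂ := frameComponent gp gm F unitJ with hω₂
  set ω₃ := frameComponent gp gm F unitK with hω₃
  -- `A k` and `B k` are the coefficients of dF(k) on the unit tangent vectors of angles θ₁ + π/2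
  -- and θ₁. They will turn out to be -λ dx and μ dy.
  let A : LorentzNumber → LorentzNumber → ℝ := fun k a =>
    -Real.sin (ψ a).re * ω₂ a k + Real.cos (ψ a).re * ω₃ a k
  let B : LorentzNumber → LorentzNumber → ℝ := fun k a =>
    Real.cos (ψ a).re * ω₂ a k + Real.sin (ψ a).re * ω₃ a k
  have hre := hψ.1.lorentz_re
  have sω : ∀ X k, ContDiffOn ℝ ∞ (fun a => frameComponent gp gm F X a k) U := fun X k =>
    (contDiffOn_frameVec hgp hgm X).inner ℝ (contDiffOn_fderiv_apply hU hF k)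
  have scos : ContDiffOn ℝ ∞ (fun a => Real.cos (ψ a).re) U :=
    Real.contDiff_cos.comp_contDiffOn hre
  have ssin : ContDiffOn ℝ ∞ (fun a => Real.sin (ψ a).re) U :=
    Real.contDiff_sin.comp_contDiffOn hre
  have sA : ∀ k, ContDiffOn ℝ ∞ (A k) U := fun k =>
    (ssin.neg.mul (sω unitJ k)).add (scos.mul (sω unitK k))
  have sB : ∀ k, ContDiffOn ℝ ∞ (B k) U := fun k =>
    (scos.mul (sω unitJ k)).add (ssin.mul (sω unitK k))
  have hcomb : ∀ a k, ω₂ a k • unitJ + ω₃ a k • unitK =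
      A k a • circleJK ((ψ a).re + Real.pi / 2) + B k a • circleJK (ψ a).re := by
    intro a k
    have hsc := Real.sin_sq_add_cos_sq (ψ a).re
    rw [circleJK_add_pi_div_two]
    apply Quaternion.ext <;> simp [A, B]
    · linear_combination (-(ω₂ a k)) * hsc
    · linear_combination (-(ω₃ a k)) * hsc
  have hdF : ∀ a ∈ U, ∀ k, fderiv ℝ F a k = frameVec (gp a) (gm a)
      (A k a • circleJK ((ψ a).re + Real.pi / 2) + B k a • circleJK (ψ a).re) :=
    fun a ha k => by rw [htan a ha k, hcomb]
  have second : ∀ a ∈ U, ∀ k z, fderiv ℝ (fun b => fderiv ℝ F b k) a z =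
      frameVec (gp a) (gm a)
        ((fderiv ℝ (A k) a z + B k a * fderiv ℝ (fun b => (ψ b).re) a z) •
            circleJK ((ψ a).re + Real.pi / 2) +
          (fderiv ℝ (B k) a z - A k a * fderiv ℝ (fun b => (ψ b).re) a z) •
            circleJK (ψ a).re +
          ((2 * A k a * z.re) • (Real.sin (ψ a).im • (1 : ℍ[ℝ]) - Real.cos (ψ a).im • unitI) +
          (2 * B k a * z.im) • (Real.cos (ψ a).im • (1 : ℍ[ℝ]) + Real.sin (ψ a).im • unitI))) := by
    intro a ha k z
    have hev : (fun b => fderiv ℝ F b k) =ᶠ[nhds a] fun b => frameVec (gp b) (gm b)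
        (A k b • circleJK ((ψ b).re + Real.pi / 2) + B k b • circleJK (ψ b).re) := by
      filter_upwards [hU.mem_nhds ha] with b hb using hdF b hb k
    rw [hev.fderiv_eq]
    exact fderiv_adapted_frame (θ := fun b => (ψ b).re) (hgp.differentiableAt_of_isOpen hU ha)
      (hgm.differentiableAt_of_isOpen hU ha) (hdp a ha z) (hdm a ha z)
      (hre.differentiableAt_of_isOpen hU ha) ((sA k).differentiableAt_of_isOpen hU ha)
      ((sB k).differentiableAt_of_isOpen hU ha)
  have comm : ∀ a ∈ U, _ := fun a ha =>
    frameVec_injective (hnp a ha) (hnm a ha) (((second a ha 1 LorentzNumber.sigma).symm.trans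
      (fderiv_fderiv_comm hU hF ha LorentzNumber.sigma 1)).trans
        (second a ha LorentzNumber.sigma 1))
  have σre : LorentzNumber.sigma.re = 0 := rfl
  have σim : LorentzNumber.sigma.im = 1 := rfl
  -- The 1- and I-components of ∂ₓ∂_yF = ∂_y∂ₓF form an invertible system (a rotation by θ₂, up to
  -- signs) for the off-diagonal coefficients, which therefore vanish.
  have hzero : ∀ a ∈ U, B 1 a = 0 ∧ A LorentzNumber.sigma a = 0 := by
    intro a ha
    have h0 := congrArg (fun x : ℍ[ℝ] => x.re) (comm a ha)
    have h1 := congrArg (fun x : ℍ[ℝ] => x.imI) (comm a ha)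
    simp [σre, σim, QuadraticAlgebra.re_one, QuadraticAlgebra.im_one] at h0 h1
    have hsc := Real.sin_sq_add_cos_sq (ψ a).im
    constructor
    · linear_combination (Real.cos (ψ a).im / 2) * h0 + (Real.sin (ψ a).im / 2) * h1 -
        B 1 a * hsc
    · linear_combination (-(Real.sin (ψ a).im) / 2) * h0 + (Real.cos (ψ a).im / 2) * h1 -
        A LorentzNumber.sigma a * hsc
  have hzero' : ∀ a ∈ U, ∀ z, fderiv ℝ (B 1) a z = 0 ∧
      fderiv ℝ (A LorentzNumber.sigma) a z = 0 := by
    intro a ha z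
    have e1 : B 1 =ᶠ[nhds a] fun _ => 0 := by
      filter_upwards [hU.mem_nhds ha] with b hb using (hzero b hb).1
    have e2 : A LorentzNumber.sigma =ᶠ[nhds a] fun _ => 0 := by
      filter_upwards [hU.mem_nhds ha] with b hb using (hzero b hb).2
    rw [e1.fderiv_eq, e2.fderiv_eq]; simp
  -- The J- and K-components of the same symmetry, rotated back by θ₁, with the off-diagonal
  -- coefficients and their derivatives now zero.
  have hsys : ∀ a ∈ U,
      fderiv ℝ (A 1) a LorentzNumber.sigma =
        B LorentzNumber.sigma a * fderiv ℝ (fun b => (ψ b).re) a 1 ∧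
      -(A 1 a) * fderiv ℝ (fun b => (ψ b).re) a LorentzNumber.sigma =
        fderiv ℝ (B LorentzNumber.sigma) a 1 := by
    intro a ha
    obtain ⟨z1, z2⟩ := hzero a ha
    have z3 := (hzero' a ha LorentzNumber.sigma).1
    have z4 := (hzero' a ha 1).2
    have h2 := congrArg (fun x : ℍ[ℝ] => x.imJ) (comm a ha)
    have h3 := congrArg (fun x : ℍ[ℝ] => x.imK) (comm a ha)
    simp [σre, σim, QuadraticAlgebra.re_one, QuadraticAlgebra.im_one, z1, z2, z3, z4,
      Real.cos_add_pi_div_two, Real.sin_add_pi_div_two] at h2 h3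
    have hsc := Real.sin_sq_add_cos_sq (ψ a).re
    constructor
    · linear_combination (-Real.sin (ψ a).re) * h2 + Real.cos (ψ a).re * h3 -
        (fderiv ℝ (A 1) a LorentzNumber.sigma -
          B LorentzNumber.sigma a * fderiv ℝ (fun b => (ψ b).re) a 1) * hsc
    · linear_combination Real.cos (ψ a).re * h2 + Real.sin (ψ a).re * h3 -
        (-(A 1 a) * fderiv ℝ (fun b => (ψ b).re) a LorentzNumber.sigma -
        fderiv ℝ (B LorentzNumber.sigma) a 1) * hsc
  have hAk : ∀ a ∈ U, ∀ k, A k a = k.re * A 1 a ∧ B k a = k.im * B LorentzNumber.sigma a := by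
    intro a ha k
    obtain ⟨z1, z2⟩ := hzero a ha
    have hl : ∀ η : LorentzNumber →L[ℝ] ℝ, η k = k.re * η 1 + k.im * η LorentzNumber.sigma := by
      intro η
      conv_lhs => rw [LorentzNumber.eq_smul_add_smul k]
      simp
    simp only [A, B] at z1 z2 ⊢
    rw [hl (ω₂ a), hl (ω₃ a)]
    constructor
    · linear_combination k.im * z2
    · linear_combination k.re * z1
  have hω : ∀ a ∈ U, ∀ k, ω₂ a k = -Real.sin (ψ a).re * (k.re * A 1 a) +
        Real.cos (ψ a).re * (k.im * B LorentzNumber.sigma a) ∧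
      ω₃ a k = Real.cos (ψ a).re * (k.re * A 1 a) +
        Real.sin (ψ a).re * (k.im * B LorentzNumber.sigma a) := by
    intro a ha k
    have h := hcomb a k
    rw [(hAk a ha k).1, (hAk a ha k).2] at h
    have h2 := congrArg (fun x : ℍ[ℝ] => x.imJ) h
    have h3 := congrArg (fun x : ℍ[ℝ] => x.imK) h
    simp [Real.cos_add_pi_div_two, Real.sin_add_pi_div_two] at h2 h3
    constructor
    · linear_combination h2
    · linear_combination h3
  -- By the diagonal form, λμ is the determinant of (ω₂, ω₃) on (1, σ), which the orientation
  -- hypothesis makes positive.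
  have hpos : ∀ a ∈ U, 0 < -(A 1 a) * B LorentzNumber.sigma a := by
    intro a ha
    have := hor a ha
    rw [(hω a ha 1).1, (hω a ha 1).2, (hω a ha LorentzNumber.sigma).1,
      (hω a ha LorentzNumber.sigma).2] at this
    simp only [σre, σim, QuadraticAlgebra.re_one, QuadraticAlgebra.im_one] at this
    have hsc := Real.sin_sq_add_cos_sq (ψ a).re
    have e : -(A 1 a) * B LorentzNumber.sigma a =
      -(A 1 a) * B LorentzNumber.sigma a * (Real.sin (ψ a).re ^ 2 + Real.cos (ψ a).re ^ 2) := by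
      rw [hsc, mul_one]
    rw [e]
    linarith
  let g : LorentzNumber → LorentzQuaternion := fun a => LorentzQuaternion.ofPlusMinus (gp a, gm a)
  have hgs : ContDiffOn ℝ ∞ g U :=
    LorentzQuaternion.ofPlusMinus.contDiff.comp_contDiffOn (hgp.prodMk hgm)
  have hgd : ∀ a ∈ U, ∀ k, fderiv ℝ g a k = k • LorentzQuaternion.ofPlusMinus
      (circleJK (LorentzNumber.plus (ψ a)) * gp a,
        circleJK (LorentzNumber.minus (ψ a)) * gm a) := by
    intro a ha k
    have h1 : fderiv ℝ g a k = LorentzQuaternion.ofPlusMinus (fderiv ℝ gp a k, fderiv ℝ gm a k) :=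
      congrArg (fun L : LorentzNumber →L[ℝ] LorentzQuaternion => L k)
        (LorentzQuaternion.ofPlusMinus.hasFDerivAt.comp a
          ((hgp.differentiableAt_of_isOpen hU ha).hasFDerivAt.prodMk
            (hgm.differentiableAt_of_isOpen hU ha).hasFDerivAt)).fderiv
    rw [h1, hdp a ha, hdm a ha]
    apply LorentzQuaternion.ext_plus_minus <;> simp
  have hdata : IsRepresentationData U ψ (fun a => -(A 1 a)) (B LorentzNumber.sigma) g ω₂ ω₃ :=
    { psi_conformal := hψ
      l_smooth := (sA 1).neg
      m_smooth := sB _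
      mul_pos := hpos
      system_x := fun a ha => by
        rw [← (hψ.cauchyRiemann hU ha).1, (hsys a ha).2]
      system_y := fun a ha => by
        rw [(hψ.cauchyRiemann hU ha).2, fderiv_fun_neg, neg_apply, (hsys a ha).1, neg_mul]
      g_mem := fun a ha => by
        rw [LorentzQuaternion.mem_spin4_iff]
        simp only [g, LorentzQuaternion.plus_ofPlusMinus, LorentzQuaternion.minus_ofPlusMinus]
        exact ⟨hnp a ha, hnm a ha⟩
      g_conformal := isLorentzConformalOn_of_fderiv hgs _ hgd
      g_deriv := fun a ha => by
        rw [lorentzDeriv, hgd a ha, one_smul]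
        apply LorentzQuaternion.ext_plus_minus
        · simp [g, mul_assoc, self_mul_star_of_norm (hnp a ha), circleJK]
        · simp [g, mul_assoc, self_mul_star_of_norm (hnm a ha), circleJK]
      dual := fun a ha => by
        have hl : A 1 a ≠ 0 := fun h => by have := hpos a ha; rw [h] at this; simp at this
        have hm : B LorentzNumber.sigma a ≠ 0 := fun h => by
          have := hpos a ha; rw [h] at this; simp at this
        have hsc := Real.sin_sq_add_cos_sq (ψ a).re
        rw [(hω a ha _).1, (hω a ha _).1, (hω a ha _).2, (hω a ha _).2]
        simp only [frameTwo, frameThree]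
        refine ⟨?_, ?_, ?_, ?_⟩ <;> field_simp <;> linarith }
  refine ⟨_, _, g, ω₂, ω₃, hdata, fun a ha => ⟨hF.differentiableAt_of_isOpen hU ha, fun k => ?_⟩⟩
  rw [hdata.representationForm_eq_iff ha, ← hdata.coframe_combination ha]
  simp only [g, LorentzQuaternion.plus_ofPlusMinus, LorentzQuaternion.minus_ofPlusMinus]
  exact htan a ha k

end Recover

/-! ### Adapted frames of immersed surfaces -/

section Lift

variable {E : Type*} [NormedAddCommGroup E] [NormedSpace ℝ E] {V : Set E}

/-- A smooth field of unit imaginary quaternions is locally conjugate to `I`. -/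
theorem exists_conjugation_to_unitI (hV : IsOpen V) {i : E → ℍ[ℝ]} (hi : ContDiffOn ℝ ∞ i V)
    (hn : ∀ q ∈ V, ‖i q‖ = 1) (hre : ∀ q ∈ V, (i q).re = 0) {p : E} (hp : p ∈ V) :
    ∃ (V' : Set E) (g : E → ℍ[ℝ]), IsOpen V' ∧ p ∈ V' ∧ V' ⊆ V ∧ ContDiffOn ℝ ∞ g V' ∧
      (∀ q ∈ V', ‖g q‖ = 1) ∧ ∀ q ∈ V', unitI * g q = g q * i q := by
  -- For every c the quaternion w = c - I c i satisfies Iw = wi, because I² = i² = -1; it only has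
  -- to be nonzero. The choice c = 1 has real part 1 + i₁, where i₁ is the I-coefficient of i, and
  -- so fails only when i₁ = -1; then c = J works.
  obtain ⟨c, hc⟩ : ∃ c : ℍ[ℝ], c - unitI * c * i p ≠ 0 := by
    by_cases h : (i p).imI = -1
    · refine ⟨unitJ, fun h0 => ?_⟩
      have := congrArg (fun x : ℍ[ℝ] => x.imJ) h0
      simp [h] at this
    · refine ⟨1, fun h0 => h ?_⟩
      have := congrArg (fun x : ℍ[ℝ] => x.re) h0
      simp at this
      linarith
  set w : E → ℍ[ℝ] := fun q => c - unitI * c * i q with hw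
  have hws : ContDiffOn ℝ ∞ w V := contDiffOn_const.sub (contDiffOn_const.mul hi)
  have hII : unitI * unitI = -1 := by apply Quaternion.ext <;> simp
  have hii : ∀ q ∈ V, i q * i q = -1 := by
    intro q hq
    have hs : star (i q) = -i q := by
      apply Quaternion.ext <;> simp [hre q hq]
    have := self_mul_star_of_norm (hn q hq)
    rw [hs, mul_neg] at this
    rw [← this, neg_neg]
  have hcomm : ∀ q ∈ V, unitI * w q = w q * i q := by
    intro q hq
    simp only [hw, mul_sub, sub_mul]
    have e1 : unitI * (unitI * c * i q) = -(c * i q) := by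
      rw [← mul_assoc, ← mul_assoc, hII]; simp
    have e2 : unitI * c * i q * i q = -(unitI * c) := by
      rw [mul_assoc (unitI * c), hii q hq]; simp
    rw [e1, e2]; abel
  refine ⟨V ∩ w ⁻¹' {0}ᶜ, fun q => ‖w q‖⁻¹ • w q,
    hws.continuousOn.isOpen_inter_preimage hV isOpen_compl_singleton, ⟨hp, hc⟩,
    Set.inter_subset_left, ?_, ?_, ?_⟩
  · have hw' := hws.mono (Set.inter_subset_left (t := w ⁻¹' {0}ᶜ))
    exact ((hw'.norm ℝ fun q hq => hq.2).inv fun q hq => norm_ne_zero_iff.2 hq.2).smul hw'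
  · intro q hq
    rw [norm_smul, norm_inv, norm_norm, inv_mul_cancel₀ (norm_ne_zero_iff.2 hq.2)]
  · intro q hq
    rw [mul_smul_comm, smul_mul_assoc, hcomm q hq.1]

/-- Multiplying by x on the right: if yx̄ is real, then y and x are linearly dependent over ℝ. -/
theorem Quaternion.sub_coe_re_eq_zero_imp {x y : ℍ[ℝ]}
    (h : y * star x - ((y * star x).re : ℍ[ℝ]) = 0) :
    (normSq x) • y - (y * star x).re • x = 0 := by
  have h1 : (y * star x - ((y * star x).re : ℍ[ℝ])) * x = 0 := by rw [h, zero_mul]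
  rw [sub_mul, mul_assoc, star_mul_self, Quaternion.mul_coe_eq_smul, Quaternion.coe_mul_eq_smul]
    at h1
  exact h1

variable {f : E → R4} {u₀ v₀ : E}

/-- An immersed surface has, locally, a smooth frame given by a pair of unit quaternions. -/
theorem exists_isFramedBy (hV : IsOpen V) (hf : IsImmersedOn f V)
    (hli : LinearIndependent ℝ ![u₀, v₀]) (hspan : ∀ w : E, ∃ a b : ℝ, w = a • u₀ + b • v₀)
    {p : E} (hp : p ∈ V) :
    ∃ (V' : Set E) (gp gm : E → ℍ[ℝ]), IsOpen V' ∧ p ∈ V' ∧ V' ⊆ V ∧ ContDiffOn ℝ ∞ gp V' ∧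
      ContDiffOn ℝ ∞ gm V' ∧ ∀ q ∈ V', IsFramedBy (tangentPlane f q) (gp q) (gm q) := by
  let x : E → ℍ[ℝ] := fun q => toR4.symm (fderiv ℝ f q u₀)
  let y : E → ℍ[ℝ] := fun q => toR4.symm (fderiv ℝ f q v₀)
  have hx : ContDiffOn ℝ ∞ x V :=
    toR4.symm.contDiff.comp_contDiffOn (contDiffOn_fderiv_apply hV hf.1 u₀)
  have hy : ContDiffOn ℝ ∞ y V :=
    toR4.symm.contDiff.comp_contDiffOn (contDiffOn_fderiv_apply hV hf.1 v₀)
  have hxy : ∀ q ∈ V, ∀ s t : ℝ, s • x q + t • y q = 0 → s = 0 ∧ t = 0 := by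
    intro q hq s t h
    rw [LinearIndependent.pair_iff] at hli
    apply hli s t
    apply hf.2 q hq
    apply toR4.symm.injective
    rw [map_add, map_smul, map_smul, map_add, map_smul, map_smul, map_zero, map_zero]
    exact h
  have hx0 : ∀ q ∈ V, x q ≠ 0 := fun q hq h => by
    have := (hxy q hq 1 0 (by simp [h])).1
    norm_num at this
  -- These are Im(yx̄) and -Im(x̄y), the two halves of the bivector x ∧ y. The relations z ↦ `mp`z =
  -- -z`mm` hold on x and y, and conjugating both normalized quaternions to I turns them into
  -- anticommutation with I, that is, into membership in the span of J and K.
  let mp : E → ℍ[ℝ] := fun q => y q * star (x q) - ((y q * star (x q)).re : ℍ[ℝ])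
  let mm : E → ℍ[ℝ] := fun q => ((star (x q) * y q).re : ℍ[ℝ]) - star (x q) * y q
  have hcoe : ∀ {h : E → ℍ[ℝ]}, ContDiffOn ℝ ∞ h V →
      ContDiffOn ℝ ∞ (fun q => ((h q).re : ℍ[ℝ])) V := fun {h} hh => by
    have h1 : ContDiffOn ℝ ∞ (fun q => (h q).re • (1 : ℍ[ℝ])) V :=
      (reCLM.contDiff.comp_contDiffOn hh).smul contDiffOn_const
    refine h1.congr fun q _ => ?_
    apply Quaternion.ext <;> simp
  have hmp : ContDiffOn ℝ ∞ mp V :=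
    (hy.mul hx.quaternion_star).sub (hcoe (hy.mul hx.quaternion_star))
  have hmm : ContDiffOn ℝ ∞ mm V :=
    (hcoe (hx.quaternion_star.mul hy)).sub (hx.quaternion_star.mul hy)
  have hre : ∀ q, (star (x q) * y q).re = (y q * star (x q)).re := fun q => by simp; ring
  have hmx : ∀ q, mp q * x q = -(x q * mm q) := by
    intro q
    simp only [mp, mm, sub_mul, mul_sub, hre q]
    rw [mul_assoc, star_mul_self, ← mul_assoc, self_mul_star, Quaternion.mul_coe_eq_smul,
      Quaternion.coe_mul_eq_smul, Quaternion.coe_mul_eq_smul, Quaternion.mul_coe_eq_smul]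
    abel
  have hmy : ∀ q, mp q * y q = -(y q * mm q) := by
    intro q
    simp only [mp, mm, sub_mul, mul_sub, hre q]
    rw [Quaternion.coe_mul_eq_smul, Quaternion.mul_coe_eq_smul, mul_assoc]
    abel
  have hmp0 : ∀ q ∈ V, mp q ≠ 0 := by
    intro q hq h
    have h1 := Quaternion.sub_coe_re_eq_zero_imp h
    have h2 := (hxy q hq (-(y q * star (x q)).re) (normSq (x q)) (by rw [← h1]; module)).2
    exact hx0 q hq (normSq_eq_zero.1 h2)
  have hnorm : ∀ q ∈ V, ‖mm q‖ = ‖mp q‖ := by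
    intro q hq
    have h1 := congrArg norm (hmx q)
    rw [norm_neg, norm_mul, norm_mul, mul_comm] at h1
    exact (mul_left_cancel₀ (norm_ne_zero_iff.2 (hx0 q hq)) h1).symm
  have hmm0 : ∀ q ∈ V, mm q ≠ 0 := fun q hq => by
    rw [← norm_ne_zero_iff, hnorm q hq]; exact norm_ne_zero_iff.2 (hmp0 q hq)
  have normalize : ∀ {h : E → ℍ[ℝ]}, ContDiffOn ℝ ∞ h V → (∀ q ∈ V, h q ≠ 0) →
      ContDiffOn ℝ ∞ (fun q => ‖h q‖⁻¹ • h q) V ∧ ∀ q ∈ V, ‖‖h q‖⁻¹ • h q‖ = 1 :=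
    fun {h} hh h0 => ⟨((hh.norm ℝ h0).inv fun q hq => norm_ne_zero_iff.2 (h0 q hq)).smul hh,
      fun q hq => by
        rw [norm_smul, norm_inv, norm_norm, inv_mul_cancel₀ (norm_ne_zero_iff.2 (h0 q hq))]⟩
  obtain ⟨sip, nip⟩ := normalize hmp hmp0
  obtain ⟨sim, nim⟩ := normalize hmm hmm0
  obtain ⟨V₁, gp, oV₁, pV₁, subV₁, sgp, ngp, cgp⟩ := exists_conjugation_to_unitI hV sip nip
    (fun q _ => by simp [mp]) hp
  obtain ⟨V₂, gm, oV₂, pV₂, subV₂, sgm, ngm, cgm⟩ := exists_conjugation_to_unitI hV sim nim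
    (fun q _ => by simp [mm]) hp
  refine ⟨V₁ ∩ V₂, gp, gm, oV₁.inter oV₂, ⟨pV₁, pV₂⟩, fun q hq => subV₁ hq.1,
    sgp.mono Set.inter_subset_left, sgm.mono Set.inter_subset_right, ?_⟩
  rintro q ⟨h₁, h₂⟩
  have hq := subV₁ h₁
  have np := ngp q h₁
  have nm := ngm q h₂
  have cp := cgp q h₁
  have cm := cgm q h₂
  rw [hnorm q hq] at cm
  -- vectors anticommuting with the two complex structures are combinations of `J` and `K`
  have htan : ∀ z : ℍ[ℝ], mp q * z = -(z * mm q) → ∀ X, X = gp q * z * star (gm q) →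
      X.re = 0 ∧ X.imI = 0 := by
    intro z hz X hX
    have e1 : unitI * X = -(X * unitI) := by
      have e2 : (‖mp q‖⁻¹ • mm q) * star (gm q) = star (gm q) * unitI := by
        calc (‖mp q‖⁻¹ • mm q) * star (gm q)
            = (star (gm q) * gm q) * (‖mp q‖⁻¹ • mm q) * star (gm q) := by
              rw [star_mul_self_of_norm nm, one_mul]
          _ = star (gm q) * (gm q * (‖mp q‖⁻¹ • mm q)) * star (gm q) := by noncomm_ring
          _ = star (gm q) * unitI * (gm q * star (gm q)) := by rw [← cm]; noncomm_ring
          _ = _ := by rw [self_mul_star_of_norm nm, mul_one]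
      calc unitI * X = (unitI * gp q) * z * star (gm q) := by rw [hX]; noncomm_ring
        _ = gp q * (‖mp q‖⁻¹ • (mp q * z)) * star (gm q) := by
          rw [cp]; simp only [mul_smul_comm, smul_mul_assoc, mul_assoc]
        _ = -(gp q * z * ((‖mp q‖⁻¹ • mm q) * star (gm q))) := by
          rw [hz]; simp only [mul_smul_comm, smul_mul_assoc, mul_assoc, mul_neg, neg_mul, smul_neg]
        _ = _ := by rw [e2, hX]; noncomm_ring
    have h1 := congrArg (fun x : ℍ[ℝ] => x.re) e1
    have h2 := congrArg (fun x : ℍ[ℝ] => x.imI) e1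
    simp at h1 h2
    constructor <;> linarith
  set X := gp q * x q * star (gm q) with hX
  set Y := gp q * y q * star (gm q) with hY
  obtain ⟨X0, X1⟩ := htan (x q) (hmx q) X hX
  obtain ⟨Y0, Y1⟩ := htan (y q) (hmy q) Y hY
  have hback : ∀ z : ℍ[ℝ], frameVec (gp q) (gm q) (gp q * z * star (gm q)) = toR4 z := by
    intro z
    unfold frameVec
    congr 1
    calc _ = (star (gp q) * gp q) * z * (star (gm q) * gm q) := by noncomm_ring
      _ = z := by rw [star_mul_self_of_norm np, star_mul_self_of_norm nm, one_mul, mul_one]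
  have fX : frameVec (gp q) (gm q) X = fderiv ℝ f q u₀ := by
    rw [hX, hback]; exact toR4.apply_symm_apply _
  have fY : frameVec (gp q) (gm q) Y = fderiv ℝ f q v₀ := by
    rw [hY, hback]; exact toR4.apply_symm_apply _
  have hXY : ∀ s t : ℝ, s • X + t • Y = 0 → s = 0 ∧ t = 0 := by
    intro s t h
    apply hxy q hq
    apply toR4.injective
    rw [← hback, map_zero, mul_add, add_mul, mul_smul_comm, mul_smul_comm, smul_mul_assoc,
      smul_mul_assoc, ← hX, ← hY, h]
    simp [frameVec]
  have hd : X.imJ * Y.imK - X.imK * Y.imJ ≠ 0 := by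
    intro hd
    have k1 := hXY (Y.imK) (-X.imK) (by
      apply Quaternion.ext <;> simp [X0, X1, Y0, Y1] <;> linarith)
    have k2 := hXY (Y.imJ) (-X.imJ) (by
      apply Quaternion.ext <;> simp [X0, X1, Y0, Y1] <;> linarith)
    have hX' : X = 0 := by
      apply Quaternion.ext <;> simp [X0, X1]
      · linarith [k2.2]
      · linarith [k1.2]
    have := (hXY 1 0 (by rw [hX']; simp)).1
    norm_num at this
  -- The inverse determinant, for expressing J and K in X and Y by Cramer's rule.
  obtain ⟨e, he⟩ : ∃ e, (X.imJ * Y.imK - X.imK * Y.imJ) * e = 1 := ⟨_, mul_inv_cancel₀ hd⟩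
  have hmem : ∀ s t : ℝ, frameVec (gp q) (gm q) (s • X + t • Y) ∈ tangentPlane f q := by
    intro s t
    rw [frameVec_add, frameVec_smul, frameVec_smul, fX, fY]
    exact add_mem (Submodule.smul_mem _ _ (fderiv_mem_tangentPlane f q u₀))
      (Submodule.smul_mem _ _ (fderiv_mem_tangentPlane f q v₀))
  have horth : ∀ Z : ℍ[ℝ], Z.imJ = 0 → Z.imK = 0 →
      frameVec (gp q) (gm q) Z ∈ (tangentPlane f q)ᗮ := by
    intro Z hZJ hZK
    rw [Submodule.mem_orthogonal]
    rintro _ ⟨w, rfl⟩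
    obtain ⟨a, b, rfl⟩ := hspan w
    show inner ℝ (fderiv ℝ f q (a • u₀ + b • v₀)) _ = 0
    rw [map_add, map_smul, map_smul, ← fX, ← fY, ← frameVec_smul, ← frameVec_smul,
      ← frameVec_add, inner_frameVec np nm, inner_eq]
    simp [X0, X1, Y0, Y1, hZJ, hZK]
  refine ⟨np, nm, ?_, ?_, horth 1 (by simp) (by simp), horth unitI (by simp) (by simp)⟩
  · have : unitJ = (Y.imK * e) • X + (-X.imK * e) • Y := by
      apply Quaternion.ext <;> simp [X0, X1, Y0, Y1]
      · linear_combination -he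
      · ring
    rw [this]; exact hmem _ _
  · have : unitK = (-Y.imJ * e) • X + (X.imJ * e) • Y := by
      apply Quaternion.ext <;> simp [X0, X1, Y0, Y1]
      · ring
      · linear_combination -he
    rw [this]; exact hmem _ _

end Lift

/-! ### Parallel frames -/

namespace Quaternion

/-- The unit quaternion `cos t + sin t I`. -/
def circleI (t : ℝ) : ℍ[ℝ] := Real.cos t • (1 : ℍ[ℝ]) + Real.sin t • unitI

@[simp] theorem re_circleI (t : ℝ) : (circleI t).re = Real.cos t := by simp [circleI]
@[simp] theorem imI_circleI (t : ℝ) : (circleI t).imI = Real.sin t := by simp [circleI]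
@[simp] theorem imJ_circleI (t : ℝ) : (circleI t).imJ = 0 := by simp [circleI]
@[simp] theorem imK_circleI (t : ℝ) : (circleI t).imK = 0 := by simp [circleI]

theorem norm_circleI (t : ℝ) : ‖circleI t‖ = 1 := by
  have h : ‖circleI t‖ * ‖circleI t‖ = 1 := by
    rw [← Quaternion.normSq_eq_norm_mul_self, Quaternion.normSq_def']; simp
  nlinarith [norm_nonneg (circleI t)]

theorem contDiff_circleI : ContDiff ℝ ∞ circleI := by
  unfold circleI
  exact (Real.contDiff_cos.smul contDiff_const).add (Real.contDiff_sin.smul contDiff_const)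

theorem hasDerivAt_circleI (t : ℝ) : HasDerivAt circleI (unitI * circleI t) t := by
  have h := ((Real.hasDerivAt_cos t).smul_const (1 : ℍ[ℝ])).add
    ((Real.hasDerivAt_sin t).smul_const unitI)
  have e : unitI * circleI t = -Real.sin t • (1 : ℍ[ℝ]) + Real.cos t • unitI := by
    apply Quaternion.ext <;> simp
  rw [e]; exact h

end Quaternion

section Gauge

variable {E : Type*} [NormedAddCommGroup E] [NormedSpace ℝ E] {V : Set E} {g : E → ℍ[ℝ]}
  {φ : E → ℝ}

/-- The logarithmic derivative of cg is cηc⁻¹ + dc c⁻¹. For c = cos φ + sin φ I, conjugation fixes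
the I-part and the second term is dφ I. -/
theorem imI_quatLogDeriv_circleI_mul (hV : IsOpen V) (hg : ContDiffOn ℝ ∞ g V)
    (hn : ∀ q ∈ V, ‖g q‖ = 1) {q : E} (hq : q ∈ V) (hφ : DifferentiableAt ℝ φ q) (u : E) :
    (quatLogDeriv (fun x => circleI (φ x) * g x) q u).imI =
      (quatLogDeriv g q u).imI + fderiv ℝ φ q u := by
  have hd := hg.differentiableAt_of_isOpen hV hq
  have hc := (hasDerivAt_circleI (φ q)).hasFDerivAt.comp q hφ.hasFDerivAt
  have hc' : fderiv ℝ (fun x => circleI (φ x)) q u =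
      fderiv ℝ φ q u • (unitI * circleI (φ q)) := by
    have : (fun x => circleI (φ x)) = circleI ∘ φ := rfl
    rw [this, hc.fderiv]; simp
  have hcd : DifferentiableAt ℝ (fun x => circleI (φ x)) q := hc.differentiableAt
  rw [quatLogDeriv_apply, fderiv_quaternion_mul hcd hd, hc',
    fderiv_eq_quatLogDeriv_mul (hn q hq), star_mul]
  have e : (circleI (φ q) * (quatLogDeriv g q u * g q) +
      fderiv ℝ φ q u • (unitI * circleI (φ q)) * g q) * (star (g q) * star (circleI (φ q))) =
      circleI (φ q) * quatLogDeriv g q u * star (circleI (φ q)) + fderiv ℝ φ q u • unitI := by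
    calc _ = circleI (φ q) * quatLogDeriv g q u * (g q * star (g q)) * star (circleI (φ q)) +
        fderiv ℝ φ q u • (unitI * (circleI (φ q) * (g q * star (g q)) *
          star (circleI (φ q)))) := by
          simp only [add_mul, smul_mul_assoc, mul_assoc]
      _ = _ := by
        rw [self_mul_star_of_norm (hn q hq), mul_one, mul_one,
          self_mul_star_of_norm (norm_circleI _), mul_one]
  rw [e]
  have hsc := Real.sin_sq_add_cos_sq (φ q)
  simp
  linear_combination (quatLogDeriv g q u).imI * hsc

/-- X ↦ c̄Xc' with c, c' in the circle through 1 and I preserves both the span of 1, I and the span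
of J, K. These are the rotations of the tangent and normal planes, so the gauge change leaves the
planes unchanged. -/
theorem Quaternion.IsFramedBy.circleI_mul {W : Submodule ℝ R4} {gp gm : ℍ[ℝ]}
    (h : IsFramedBy W gp gm) (s t : ℝ) : IsFramedBy W (circleI s * gp) (circleI t * gm) := by
  have key : ∀ X, frameVec (circleI s * gp) (circleI t * gm) X =
      frameVec gp gm (star (circleI s) * X * circleI t) := by
    intro X
    unfold frameVec
    congr 1
    rw [star_mul]; noncomm_ring
  have hW : ∀ X : ℍ[ℝ], X.re = 0 → X.imI = 0 → frameVec gp gm X ∈ W := by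
    intro X h0 h1
    rw [frameVec_eq X, h0, h1]
    simpa using W.add_mem (W.smul_mem X.imJ h.mem_J) (W.smul_mem X.imK h.mem_K)
  have hN : ∀ X : ℍ[ℝ], X.imJ = 0 → X.imK = 0 → frameVec gp gm X ∈ Wᗮ := by
    intro X h0 h1
    rw [frameVec_eq X, h0, h1]
    simpa using Wᗮ.add_mem (Wᗮ.smul_mem X.re h.mem_one) (Wᗮ.smul_mem X.imI h.mem_I)
  refine ⟨?_, ?_, ?_, ?_, ?_, ?_⟩
  · rw [norm_mul, norm_circleI, h.norm_plus, one_mul]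
  · rw [norm_mul, norm_circleI, h.norm_minus, one_mul]
  · rw [key]; exact hW _ (by simp) (by simp)
  · rw [key]; exact hW _ (by simp) (by simp)
  · rw [key]; exact hN _ (by simp) (by simp)
  · rw [key]; exact hN _ (by simp) (by simp)

/-- On a ball, a frame whose logarithmic derivative has a closed component along `I` can be
rotated so that this component vanishes. -/
theorem exists_gauge {p : E} {r : ℝ} (hg : ContDiffOn ℝ ∞ g (Metric.ball p r))
    (hn : ∀ q ∈ Metric.ball p r, ‖g q‖ = 1)
    (hc : ∀ q ∈ Metric.ball p r, ∀ u v, fderiv ℝ (fun q => (quatLogDeriv g q v).imI) q u =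
      fderiv ℝ (fun q => (quatLogDeriv g q u).imI) q v) :
    ∃ φ : E → ℝ, ContDiffOn ℝ ∞ φ (Metric.ball p r) ∧ ∀ q ∈ Metric.ball p r, ∀ u,
      (quatLogDeriv (fun x => circleI (φ x) * g x) q u).imI = 0 := by
  have hs : ContDiffOn ℝ ∞ (fun q => imICLM.comp (quatLogDeriv g q)) (Metric.ball p r) :=
    contDiffOn_const.clm_comp (contDiffOn_quatLogDeriv Metric.isOpen_ball hg)
  obtain ⟨φ, sφ, hφ⟩ := exists_primitive_ball hs hc
  refine ⟨fun q => -φ q, sφ.neg, fun q hq u => ?_⟩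
  rw [imI_quatLogDeriv_circleI_mul Metric.isOpen_ball hg hn hq (hφ q hq).differentiableAt.fun_neg,
    fderiv_fun_neg, (hφ q hq).fderiv]
  simp

variable {f : E → R4} {u₀ v₀ : E}

/-- A flat surface with flat normal bundle has parallel frames. -/
theorem exists_parallel_frame (hV : IsOpen V) (hf : IsImmersedOn f V)
    (hK : HasZeroCurvaturesOn f V)
    (hli : LinearIndependent ℝ ![u₀, v₀]) (hspan : ∀ w : E, ∃ a b : ℝ, w = a • u₀ + b • v₀)
    {p : E} (hp : p ∈ V) :
    ∃ (r : ℝ) (gp gm : E → ℍ[ℝ]), 0 < r ∧ Metric.ball p r ⊆ V ∧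
      ContDiffOn ℝ ∞ gp (Metric.ball p r) ∧ ContDiffOn ℝ ∞ gm (Metric.ball p r) ∧
      (∀ q ∈ Metric.ball p r, IsFramedBy (tangentPlane f q) (gp q) (gm q)) ∧
      (∀ q ∈ Metric.ball p r, ∀ u, (quatLogDeriv gp q u).imI = 0) ∧
      (∀ q ∈ Metric.ball p r, ∀ u, (quatLogDeriv gm q u).imI = 0) := by
  obtain ⟨V', gp, gm, oV', pV', sub, sgp, sgm, hF⟩ := exists_isFramedBy hV hf hli hspan hp
  obtain ⟨r, hr, hb⟩ := Metric.isOpen_iff.1 oV' p pV'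
  have hf' : IsImmersedOn f (Metric.ball p r) :=
    ⟨hf.1.mono (hb.trans sub), fun q hq => hf.2 q (sub (hb hq))⟩
  have hK' : HasZeroCurvaturesOn f (Metric.ball p r) := fun q hq => hK q (sub (hb hq))
  have hF' : ∀ q ∈ Metric.ball p r, IsFramedBy (tangentPlane f q) (gp q) (gm q) :=
    fun q hq => hF q (hb hq)
  have hcl := fun q (hq : q ∈ Metric.ball p r) u v => imI_closed_of_hasZeroCurvaturesOn
    Metric.isOpen_ball hf' (sgp.mono hb) (sgm.mono hb) hF' hK' hq u v
  obtain ⟨φ, sφ, hφ⟩ := exists_gauge (sgp.mono hb) (fun q hq => (hF' q hq).norm_plus)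
    (fun q hq u v => (hcl q hq u v).1)
  obtain ⟨χ, sχ, hχ⟩ := exists_gauge (sgm.mono hb) (fun q hq => (hF' q hq).norm_minus)
    (fun q hq u v => (hcl q hq u v).2)
  exact ⟨r, _, _, hr, hb.trans sub, (contDiff_circleI.comp_contDiffOn sφ).mul (sgp.mono hb),
    (contDiff_circleI.comp_contDiffOn sχ).mul (sgm.mono hb),
    fun q hq => (hF' q hq).circleI_mul _ _, hφ, hχ⟩

/-- Structure equation of a map into the unit quaternions. -/
theorem fderiv_quatLogDeriv (hV : IsOpen V) (hg : ContDiffOn ℝ ∞ g V)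
    (hn : ∀ q ∈ V, ‖g q‖ = 1) {q : E} (hq : q ∈ V) (u v : E) :
    fderiv ℝ (fun x => quatLogDeriv g x u) q v - fderiv ℝ (fun x => quatLogDeriv g x v) q u =
      quatLogDeriv g q v * quatLogDeriv g q u - quatLogDeriv g q u * quatLogDeriv g q v := by
  have hd := hg.differentiableAt_of_isOpen hV hq
  have key : ∀ u v, fderiv ℝ (fun x => quatLogDeriv g x u) q v =
      fderiv ℝ (fun x => fderiv ℝ g x u) q v * star (g q) -
        quatLogDeriv g q u * quatLogDeriv g q v := by
    intro u v
    have e : (fun x => quatLogDeriv g x u) = fun x => fderiv ℝ g x u * star (g x) := by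
      ext1 x; exact quatLogDeriv_apply g x u
    rw [e, fderiv_quaternion_mul
      ((contDiffOn_fderiv_apply hV hg u).differentiableAt_of_isOpen hV hq)
      (hg.quaternion_star.differentiableAt_of_isOpen hV hq), fderiv_quaternion_star hd,
      fderiv_eq_quatLogDeriv_mul (hn q hq) v, star_mul, star_quatLogDeriv hV hg hn hq,
      ← mul_assoc, ← quatLogDeriv_apply]
    rw [mul_neg, sub_eq_add_neg, add_comm]
  rw [key u v, key v u, fderiv_fderiv_comm hV hg hq u v]
  abel

/-- The components along `J` and `K` of the logarithmic derivative of a parallel frame are closed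
and proportional. -/
theorem structure_equations (hV : IsOpen V) (hg : ContDiffOn ℝ ∞ g V)
    (hn : ∀ q ∈ V, ‖g q‖ = 1) (h0 : ∀ q ∈ V, ∀ u, (quatLogDeriv g q u).imI = 0)
    {q : E} (hq : q ∈ V) (u v : E) :
    fderiv ℝ (fun x => imJCLM.comp (quatLogDeriv g x) v) q u =
        fderiv ℝ (fun x => imJCLM.comp (quatLogDeriv g x) u) q v ∧
      fderiv ℝ (fun x => imKCLM.comp (quatLogDeriv g x) v) q u =
        fderiv ℝ (fun x => imKCLM.comp (quatLogDeriv g x) u) q v ∧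
      imJCLM.comp (quatLogDeriv g q) u * imKCLM.comp (quatLogDeriv g q) v =
        imJCLM.comp (quatLogDeriv g q) v * imKCLM.comp (quatLogDeriv g q) u := by
  have hd : ∀ w, DifferentiableAt ℝ (fun x => quatLogDeriv g x w) q := fun w =>
    ((contDiffOn_quatLogDeriv hV hg).clm_apply contDiffOn_const).differentiableAt_of_isOpen hV hq
  have hcomp : ∀ (L : ℍ[ℝ] →L[ℝ] ℝ) (w z : E), fderiv ℝ (fun x => L.comp (quatLogDeriv g x) w) q z =
      L (fderiv ℝ (fun x => quatLogDeriv g x w) q z) := fun L w z =>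
    congrArg (fun T : E →L[ℝ] ℝ => T z) (L.hasFDerivAt.comp q (hd w).hasFDerivAt).fderiv
  have hre := fun w => re_quatLogDeriv hV hg hn hq w
  have heq := fderiv_quatLogDeriv hV hg hn hq u v
  -- Two vectors of the J, K plane have a commutator along I. So the J- and K-components of the
  -- Maurer–Cartan equation express closedness, while the I-component, whose left side is zero here,
  -- says that the commutator vanishes.
  have hI : ∀ w z, imICLM (fderiv ℝ (fun x => quatLogDeriv g x w) q z) = 0 := by
    intro w z
    rw [← hcomp]
    have : (fun x => imICLM.comp (quatLogDeriv g x) w) =ᶠ[nhds q] fun _ => 0 := by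
      filter_upwards [hV.mem_nhds hq] with x hx using h0 x hx w
    rw [this.fderiv_eq]; simp
  have e1 := congrArg imICLM heq
  have e2 := congrArg imJCLM heq
  have e3 := congrArg imKCLM heq
  rw [map_sub, hI, hI] at e1
  rw [map_sub, ← hcomp, ← hcomp] at e2 e3
  simp [hre, h0 q hq] at e1 e2 e3
  refine ⟨?_, ?_, ?_⟩
  · show fderiv ℝ (fun x => (quatLogDeriv g x v).imJ) q u =
      fderiv ℝ (fun x => (quatLogDeriv g x u).imJ) q v
    linarith
  · show fderiv ℝ (fun x => (quatLogDeriv g x v).imK) q u =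
      fderiv ℝ (fun x => (quatLogDeriv g x u).imK) q v
    linarith
  · simp; linarith

end Gauge

/-! ### Regularity of the Gauss map -/

section Gauss

variable {E : Type*} [NormedAddCommGroup E] [NormedSpace ℝ E] {V : Set E} {f : E → R4}
  {gp gm : E → ℍ[ℝ]} {u₀ v₀ : E}

theorem fderiv_wedge_eq_zero {a b : E → R4} {p : E} (ha : DifferentiableAt ℝ a p)
    (hb : DifferentiableAt ℝ b p) {h : E} (h1 : fderiv ℝ a p h = 0) (h2 : fderiv ℝ b p h = 0) :
    fderiv ℝ (fun q => wedge (a q) (b q)) p h = 0 := by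
  let W : R4 × R4 → Fin 4 → Fin 4 → ℝ := fun x => wedge x.1 x.2
  have hW : Differentiable ℝ W := by
    unfold W wedge
    fun_prop
  have e := (hW.differentiableAt (x := (a p, b p))).hasFDerivAt.comp p
    (ha.hasFDerivAt.prodMk hb.hasFDerivAt)
  have e2 : fderiv ℝ (fun q => wedge (a q) (b q)) p = _ := e.fderiv
  rw [e2]
  show fderiv ℝ W (a p, b p) (fderiv ℝ a p h, fderiv ℝ b p h) = 0
  rw [h1, h2]
  exact map_zero _

/-- The Gauss map agrees up to sign with the bivector of the moving frame. -/
theorem gaussMap_eventuallyEq (hV : IsOpen V) (hf : IsImmersedOn f V) (hgp : ContDiffOn ℝ ∞ gp V)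
    (hgm : ContDiffOn ℝ ∞ gm V) (hF : ∀ q ∈ V, IsFramedBy (tangentPlane f q) (gp q) (gm q))
    (hli : LinearIndependent ℝ ![u₀, v₀]) {p : E} (hp : p ∈ V) :
    ∃ ε : ℝ, gaussMap f u₀ v₀ =ᶠ[nhds p] fun q => ε •
      wedge (frameVec (gp q) (gm q) unitJ) (frameVec (gp q) (gm q) unitK) := by
  have hT := isOrthonormalFrameOn_tangent hV hgp hgm hF
  -- Up to sign, the determinant of (df u₀, df v₀) in the frame. It is continuous and nonzero at p,
  -- so its sign, and hence ε, is constant near p.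
  let d : E → ℝ := fun q =>
    inner ℝ (frameVec (gp q) (gm q) unitJ) (fderiv ℝ f q v₀) *
        inner ℝ (frameVec (gp q) (gm q) unitK) (fderiv ℝ f q u₀) -
      inner ℝ (frameVec (gp q) (gm q) unitK) (fderiv ℝ f q v₀) *
        inner ℝ (frameVec (gp q) (gm q) unitJ) (fderiv ℝ f q u₀)
  have hds : ContDiffOn ℝ ∞ d V :=
    ((hT.smooth_one.inner ℝ (contDiffOn_fderiv_apply hV hf.1 v₀)).mul
      (hT.smooth_two.inner ℝ (contDiffOn_fderiv_apply hV hf.1 u₀))).sub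
    ((hT.smooth_two.inner ℝ (contDiffOn_fderiv_apply hV hf.1 v₀)).mul
      (hT.smooth_one.inner ℝ (contDiffOn_fderiv_apply hV hf.1 u₀)))
  have hdc : ContinuousAt d p := (hds.differentiableAt_of_isOpen hV hp).continuousAt
  have har : ∀ q ∈ V, Real.sqrt (areaSq f u₀ v₀ q) = |d q| := fun q hq => by
    rw [areaSq_eq hT hq, Real.sqrt_sq_eq_abs]
  have hdp : d p ≠ 0 := fun h => by
    have := areaSq_pos f (hf.2 p hp) hli
    rw [areaSq_eq hT hp] at this
    change 0 < d p ^ 2 at this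
    rw [h] at this; norm_num at this
  have hval : ∀ q ∈ V, gaussMap f u₀ v₀ q = (-(|d q|⁻¹ * d q)) •
      wedge (frameVec (gp q) (gm q) unitJ) (frameVec (gp q) (gm q) unitK) := by
    intro q hq
    have he : ∀ w, fderiv ℝ f q w = inner ℝ (frameVec (gp q) (gm q) unitJ) (fderiv ℝ f q w) •
        frameVec (gp q) (gm q) unitJ + inner ℝ (frameVec (gp q) (gm q) unitK) (fderiv ℝ f q w) •
        frameVec (gp q) (gm q) unitK := fun w => by
      rw [← hT.starProjection_eq q hq,
        Submodule.starProjection_eq_self_iff.2 (fderiv_mem_tangentPlane f q w)]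
    have hw : wedge (fderiv ℝ f q u₀) (fderiv ℝ f q v₀) = (-d q) •
        wedge (frameVec (gp q) (gm q) unitJ) (frameVec (gp q) (gm q) unitK) := by
      simp only [d]
      generalize ha : inner ℝ (frameVec (gp q) (gm q) unitJ) (fderiv ℝ f q u₀) = a
      generalize hb : inner ℝ (frameVec (gp q) (gm q) unitK) (fderiv ℝ f q u₀) = b
      generalize hc : inner ℝ (frameVec (gp q) (gm q) unitJ) (fderiv ℝ f q v₀) = c
      generalize hd : inner ℝ (frameVec (gp q) (gm q) unitK) (fderiv ℝ f q v₀) = e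
      rw [he u₀, he v₀, ha, hb, hc, hd]
      ext i j
      simp [wedge]
      ring
    unfold gaussMap
    rw [har q hq, hw, smul_smul]
    congr 1; ring
  rcases lt_or_gt_of_ne hdp with h | h
  · refine ⟨1, ?_⟩
    filter_upwards [hV.mem_nhds hp, hdc.eventually (gt_mem_nhds h)] with q hq hq'
    rw [hval q hq, abs_of_neg hq']
    congr 1
    field_simp
    exact div_self hq'.ne
  · refine ⟨-1, ?_⟩
    filter_upwards [hV.mem_nhds hp, hdc.eventually (lt_mem_nhds h)] with q hq hq'
    rw [hval q hq, abs_of_pos hq']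
    congr 1
    field_simp

/-- At a regular point of the Gauss map, the logarithmic derivatives of a parallel frame have no
common kernel. -/
theorem eq_zero_of_quatLogDeriv_eq_zero (hV : IsOpen V) (hf : IsImmersedOn f V)
    (hgp : ContDiffOn ℝ ∞ gp V) (hgm : ContDiffOn ℝ ∞ gm V)
    (hF : ∀ q ∈ V, IsFramedBy (tangentPlane f q) (gp q) (gm q)) (hreg : HasRegularGaussMapOn f V)
    (hli : LinearIndependent ℝ ![u₀, v₀]) {p : E} (hp : p ∈ V) {h : E}
    (h1 : quatLogDeriv gp p h = 0) (h2 : quatLogDeriv gm p h = 0) : h = 0 := by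
  obtain ⟨ε, hε⟩ := gaussMap_eventuallyEq hV hf hgp hgm hF hli hp
  apply hreg p hp u₀ v₀ hli
  rw [map_zero, hε.fderiv_eq]
  -- A direction killed by both logarithmic derivatives leaves the whole frame stationary, hence
  -- also the Gauss map.
  have hd : ∀ X, fderiv ℝ (fun q => frameVec (gp q) (gm q) X) p h = 0 := by
    intro X
    rw [fderiv_frameVec (hgp.differentiableAt_of_isOpen hV hp)
      (hgm.differentiableAt_of_isOpen hV hp)
      (fderiv_eq_quatLogDeriv_mul (hF p hp).norm_plus h)
      (fderiv_eq_quatLogDeriv_mul (hF p hp).norm_minus h) (by rw [h1]; simp), h1, h2]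
    simp [frameVec]
  have hT := isOrthonormalFrameOn_tangent hV hgp hgm hF
  have d1 := hT.smooth_one.differentiableAt_of_isOpen hV hp
  have d2 := hT.smooth_two.differentiableAt_of_isOpen hV hp
  have hw := fderiv_wedge_eq_zero d1 d2 (hd unitJ) (hd unitK)
  have e : (fun q => ε • wedge (frameVec (gp q) (gm q) unitJ) (frameVec (gp q) (gm q) unitK)) =
    ε • fun q => wedge (frameVec (gp q) (gm q) unitJ) (frameVec (gp q) (gm q) unitK) := rfl
  rw [e, fderiv_const_smul_field, Pi.smul_apply, smul_apply, hw, smul_zero]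

end Gauss

/-! ### Phase and characteristic coordinate of a pair of proportional closed forms -/

section Phase

variable {E : Type*} [NormedAddCommGroup E] [NormedSpace ℝ E] {a b : E → E →L[ℝ] ℝ}
  {p : E} {r : ℝ}

/-- A smooth choice of the argument of `x + i y` near a point where it does not vanish. -/
theorem exists_smooth_arg {x y : E → ℝ} (hr : 0 < r) (hx : ContDiffOn ℝ ∞ x (Metric.ball p r))
    (hy : ContDiffOn ℝ ∞ y (Metric.ball p r)) (h : ¬ (x p = 0 ∧ y p = 0)) :
    ∃ (r' : ℝ) (ψ n : E → ℝ), 0 < r' ∧ r' ≤ r ∧ ContDiffOn ℝ ∞ ψ (Metric.ball p r') ∧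
      ∀ q ∈ Metric.ball p r', n q ≠ 0 ∧ x q = n q * Real.cos (ψ q) ∧
        y q = n q * Real.sin (ψ q) := by
  let Z : E → ℂ := fun q => Complex.equivRealProdCLM.symm (x q, y q)
  have hZ : ContDiffOn ℝ ∞ Z (Metric.ball p r) :=
    Complex.equivRealProdCLM.symm.contDiff.comp_contDiffOn (hx.prodMk hy)
  have hZp : Z p ≠ 0 := fun h0 => h ⟨congrArg Complex.re h0, congrArg Complex.im h0⟩
  -- Dividing by the value at p puts the function near 1, inside the slit plane, where the logarithm
  -- is smooth; the argument of `Z p` is added back afterwards.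
  have hW : ContDiffOn ℝ ∞ (fun q => Z q / Z p) (Metric.ball p r) := by
    simp only [div_eq_mul_inv]
    exact hZ.mul contDiffOn_const
  have ho : IsOpen (Metric.ball p r ∩ (fun q => Z q / Z p) ⁻¹' Complex.slitPlane) :=
    hW.continuousOn.isOpen_inter_preimage Metric.isOpen_ball Complex.isOpen_slitPlane
  have hp : p ∈ Metric.ball p r ∩ (fun q => Z q / Z p) ⁻¹' Complex.slitPlane := by
    refine ⟨Metric.mem_ball_self hr, ?_⟩
    show Z p / Z p ∈ Complex.slitPlane
    rw [div_self hZp]; exact Complex.one_mem_slitPlane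
  obtain ⟨r₁, hr₁, hb⟩ := Metric.isOpen_iff.1 ho p hp
  have hsub : Metric.ball p (min r₁ r) ⊆ Metric.ball p r₁ :=
    Metric.ball_subset_ball (min_le_left _ _)
  refine ⟨min r₁ r, fun q => (Z p).arg + (Complex.log (Z q / Z p)).im, fun q => ‖Z q‖,
    lt_min hr₁ hr, min_le_right _ _, ?_, fun q hq => ?_⟩
  · refine contDiffOn_const.add (Complex.imCLM.contDiff.comp_contDiffOn
      (f := fun q => Complex.log (Z q / Z p)) fun q hq => ?_)
    have h1 := hb (hsub hq)
    exact ((Complex.contDiffAt_log (n := ∞) h1.2).restrict_scalars ℝ).comp_contDiffWithinAt q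
      (hW.mono (hsub.trans (hb.trans Set.inter_subset_left)) q hq)
  · have h1 := hb (hsub hq)
    have hq0 : Z q ≠ 0 := fun h0 => by
      have := h1.2
      simp [h0] at this
    have key : Z q = ‖Z q‖ * Complex.exp
        (((Z p).arg + (Complex.log (Z q / Z p)).im : ℝ) * Complex.I) := by
      rw [Complex.log_im, Complex.ofReal_add, add_mul, Complex.exp_add]
      have e1 := Complex.norm_mul_exp_arg_mul_I (Z p)
      have e2 := Complex.norm_mul_exp_arg_mul_I (Z q / Z p)
      have e3 : Z q = Z p * (Z q / Z p) := by field_simp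
      have e4 : ‖Z q‖ = ‖Z p‖ * ‖Z q / Z p‖ := by rw [← norm_mul, ← e3]
      rw [e4]
      push_cast
      calc Z q = Z p * (Z q / Z p) := e3
        _ = (‖Z p‖ * Complex.exp ((Z p).arg * Complex.I)) *
            (‖Z q / Z p‖ * Complex.exp ((Z q / Z p).arg * Complex.I)) := by rw [e1, e2]
        _ = _ := by ring
    refine ⟨norm_ne_zero_iff.2 hq0, ?_, ?_⟩
    · have := congrArg Complex.re key
      rwa [Complex.re_ofReal_mul, Complex.exp_ofReal_mul_I_re] at this
    · have := congrArg Complex.im key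
      rwa [Complex.im_ofReal_mul, Complex.exp_ofReal_mul_I_im] at this

/-- `IsPhaseOn a b ψ s ν O`: on `O` one has `a = cos ψ ds` and `b = sin ψ ds` with `ds = ν` and
`dψ ∧ ds = 0`. -/
structure IsPhaseOn (a b : E → E →L[ℝ] ℝ) (ψ s : E → ℝ) (ν : E → E →L[ℝ] ℝ) (O : Set E) :
    Prop where
  smooth_phase : ContDiffOn ℝ ∞ ψ O
  smooth_coord : ContDiffOn ℝ ∞ s O
  hasFDerivAt : ∀ q ∈ O, HasFDerivAt s (ν q) q
  left_eq : ∀ q ∈ O, a q = Real.cos (ψ q) • ν q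
  right_eq : ∀ q ∈ O, b q = Real.sin (ψ q) • ν q
  wedge : ∀ q ∈ O, ∀ u v, fderiv ℝ ψ q u * ν q v = fderiv ℝ ψ q v * ν q u

/-- Since a ∧ b = 0, the vector (a, b) has a common direction (cos ψ, sin ψ), which may be read from
the values on a single v. Rotating the equations da = db = 0 by ψ separates them into dν = 0 and dψ
∧ ν = 0. -/
theorem exists_isPhaseOn (hr : 0 < r) (ha : ContDiffOn ℝ ∞ a (Metric.ball p r))
    (hb : ContDiffOn ℝ ∞ b (Metric.ball p r))
    (hca : ∀ q ∈ Metric.ball p r, ∀ u v,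
      fderiv ℝ (fun x => a x v) q u = fderiv ℝ (fun x => a x u) q v)
    (hcb : ∀ q ∈ Metric.ball p r, ∀ u v,
      fderiv ℝ (fun x => b x v) q u = fderiv ℝ (fun x => b x u) q v)
    (hab : ∀ q ∈ Metric.ball p r, ∀ u v, a q u * b q v = a q v * b q u)
    {v : E} (hv : ¬ (a p v = 0 ∧ b p v = 0)) :
    ∃ (r' : ℝ) (ψ s : E → ℝ) (ν : E → E →L[ℝ] ℝ), 0 < r' ∧ r' ≤ r ∧
      IsPhaseOn a b ψ s ν (Metric.ball p r') := by
  obtain ⟨r', ψ, n, hr', hle, hψ, hn⟩ := exists_smooth_arg (x := fun q => a q v)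
    (y := fun q => b q v) hr (ha.clm_apply contDiffOn_const) (hb.clm_apply contDiffOn_const) hv
  have hsub : Metric.ball p r' ⊆ Metric.ball p r := Metric.ball_subset_ball hle
  let ν : E → E →L[ℝ] ℝ := fun q => Real.cos (ψ q) • a q + Real.sin (ψ q) • b q
  have hcos := Real.contDiff_cos.comp_contDiffOn hψ
  have hsin := Real.contDiff_sin.comp_contDiffOn hψ
  have hν : ContDiffOn ℝ ∞ ν (Metric.ball p r') :=
    (hcos.smul (ha.mono hsub)).add (hsin.smul (hb.mono hsub))
  have hrel : ∀ q ∈ Metric.ball p r', ∀ u, a q u * Real.sin (ψ q) = b q u * Real.cos (ψ q) := by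
    intro q hq u
    obtain ⟨h0, h1, h2⟩ := hn q hq
    have := hab q (hsub hq) u v
    rw [h1, h2] at this
    apply mul_left_cancel₀ h0
    linarith
  have hae : ∀ q ∈ Metric.ball p r', a q = Real.cos (ψ q) • ν q := fun q hq => by
    ext u
    have h1 := hrel q hq u
    have h2 := Real.sin_sq_add_cos_sq (ψ q)
    simp only [ν, smul_apply, add_apply, smul_eq_mul]
    linear_combination (-a q u) * h2 + Real.sin (ψ q) * h1
  have hbe : ∀ q ∈ Metric.ball p r', b q = Real.sin (ψ q) • ν q := fun q hq => by
    ext u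
    have h1 := hrel q hq u
    have h2 := Real.sin_sq_add_cos_sq (ψ q)
    simp only [ν, smul_apply, add_apply, smul_eq_mul]
    linear_combination (-b q u) * h2 - Real.cos (ψ q) * h1
  have hstr : ∀ q ∈ Metric.ball p r', ∀ u w,
      fderiv ℝ ψ q u * ν q w = fderiv ℝ ψ q w * ν q u ∧
      fderiv ℝ (fun x => ν x w) q u = fderiv ℝ (fun x => ν x u) q w := by
    intro q hq u w
    have dψ := (hψ.differentiableAt_of_isOpen Metric.isOpen_ball hq).hasFDerivAt
    have dν : ∀ z, HasFDerivAt (fun x => ν x z) (fderiv ℝ (fun x => ν x z) q) q := fun z =>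
      ((hν.clm_apply contDiffOn_const).differentiableAt_of_isOpen Metric.isOpen_ball hq).hasFDerivAt
    have da : ∀ z y, fderiv ℝ (fun x => a x z) q y =
        Real.cos (ψ q) * fderiv ℝ (fun x => ν x z) q y -
          Real.sin (ψ q) * fderiv ℝ ψ q y * ν q z := by
      intro z y
      have e : (fun x => a x z) =ᶠ[nhds q] fun x => Real.cos (ψ x) * ν x z := by
        filter_upwards [Metric.isOpen_ball.mem_nhds hq] with x hx
        rw [hae x hx]; rfl
      rw [e.fderiv_eq, fderiv_fun_mul dψ.cos.differentiableAt (dν z).differentiableAt, dψ.cos.fderiv]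
      simp
      ring
    have db : ∀ z y, fderiv ℝ (fun x => b x z) q y =
        Real.sin (ψ q) * fderiv ℝ (fun x => ν x z) q y +
          Real.cos (ψ q) * fderiv ℝ ψ q y * ν q z := by
      intro z y
      have e : (fun x => b x z) =ᶠ[nhds q] fun x => Real.sin (ψ x) * ν x z := by
        filter_upwards [Metric.isOpen_ball.mem_nhds hq] with x hx
        rw [hbe x hx]; rfl
      rw [e.fderiv_eq, fderiv_fun_mul dψ.sin.differentiableAt (dν z).differentiableAt, dψ.sin.fderiv]
      simp
      ring
    have h1 := hca q (hsub hq) u w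
    have h2 := hcb q (hsub hq) u w
    rw [da, da] at h1
    rw [db, db] at h2
    have h3 := Real.sin_sq_add_cos_sq (ψ q)
    generalize Real.cos (ψ q) = c at *
    generalize Real.sin (ψ q) = d at *
    constructor
    · linear_combination (-(fderiv ℝ ψ q u * ν q w - fderiv ℝ ψ q w * ν q u)) * h3 - d * h1 + c * h2
    · linear_combination (-(fderiv ℝ (fun x => ν x w) q u - fderiv ℝ (fun x => ν x u) q w)) * h3
        + c * h1 + d * h2
  obtain ⟨s, hs, hs'⟩ := exists_primitive_ball hν fun q hq u w => (hstr q hq u w).2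
  exact ⟨r', ψ, s, ν, hr', hle, hψ, hs, hs', hae, hbe, fun q hq u w => (hstr q hq u w).1⟩

end Phase

/-! ### Polar form of parallel frames -/

section Polar

variable {E : Type*} [NormedAddCommGroup E] [NormedSpace ℝ E] {V : Set E} {f : E → R4}
  {u₀ v₀ : E}

/-- Two proportional linear forms on a plane have a common kernel vector; it is read off from
whichever form is nonzero. -/
theorem exists_ne_zero_of_wedge_eq_zero (hli : LinearIndependent ℝ ![u₀, v₀]) (a b : E →L[ℝ] ℝ)
    (h : a u₀ * b v₀ = a v₀ * b u₀) : ∃ w, w ≠ 0 ∧ a w = 0 ∧ b w = 0 := by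
  rw [LinearIndependent.pair_iff] at hli
  have key : ∀ x y : ℝ, ¬ (x = 0 ∧ y = 0) → x • u₀ + y • v₀ ≠ 0 := fun x y hxy h0 =>
    hxy (hli x y h0)
  by_cases ha : a u₀ = 0 ∧ a v₀ = 0
  · by_cases hb : b u₀ = 0 ∧ b v₀ = 0
    · exact ⟨(1 : ℝ) • u₀ + (0 : ℝ) • v₀, key 1 0 (by simp), by simp [ha.1], by simp [hb.1]⟩
    · refine ⟨b v₀ • u₀ + (-b u₀) • v₀, key _ _ (fun h => hb ⟨neg_eq_zero.1 h.2, h.1⟩), ?_, ?_⟩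
      · simp [ha.1, ha.2]
      · simp; ring
  · refine ⟨a v₀ • u₀ + (-a u₀) • v₀, key _ _ (fun h => ha ⟨neg_eq_zero.1 h.2, h.1⟩), ?_, ?_⟩
    · simp; ring
    · simp; linarith

/-- `g` takes unit values on `O` and `dg g⁻¹ = ds (cos ψ J + sin ψ K)` with `ds = ν` and
`dψ ∧ ds = 0`. -/
structure IsPolarOn (g : E → ℍ[ℝ]) (ψ s : E → ℝ) (ν : E → E →L[ℝ] ℝ) (O : Set E) : Prop where
  smooth_frame : ContDiffOn ℝ ∞ g O
  smooth_phase : ContDiffOn ℝ ∞ ψ O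
  smooth_coord : ContDiffOn ℝ ∞ s O
  hasFDerivAt : ∀ q ∈ O, HasFDerivAt s (ν q) q
  fderiv_frame : ∀ q ∈ O, ∀ u, fderiv ℝ g q u = (ν q u • circleJK (ψ q)) * g q
  wedge : ∀ q ∈ O, ∀ u v, fderiv ℝ ψ q u * ν q v = fderiv ℝ ψ q v * ν q u

variable {g : E → ℍ[ℝ]} {ψ s : E → ℝ} {ν : E → E →L[ℝ] ℝ} {O O' : Set E}

theorem IsPolarOn.mono (h : IsPolarOn g ψ s ν O) (hO : O' ⊆ O) : IsPolarOn g ψ s ν O' where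
  smooth_frame := h.smooth_frame.mono hO
  smooth_phase := h.smooth_phase.mono hO
  smooth_coord := h.smooth_coord.mono hO
  hasFDerivAt q hq := h.hasFDerivAt q (hO hq)
  fderiv_frame q hq := h.fderiv_frame q (hO hq)
  wedge q hq := h.wedge q (hO hq)

/-- The polar form is unique only up to (ψ, s) ↦ (ψ + π, -s). This freedom reverses the orientation
of (s₊, s₋) without touching the frame. -/
theorem IsPolarOn.flip (h : IsPolarOn g ψ s ν O) :
    IsPolarOn g (fun q => ψ q + Real.pi) (fun q => -s q) (fun q => -ν q) O where
  smooth_frame := h.smooth_frame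
  smooth_phase := h.smooth_phase.add contDiffOn_const
  smooth_coord := h.smooth_coord.neg
  hasFDerivAt q hq := (h.hasFDerivAt q hq).neg
  fderiv_frame q hq u := by
    rw [h.fderiv_frame q hq u]
    simp [circleJK, Real.cos_add_pi, Real.sin_add_pi, smul_add]
  wedge q hq u v := by
    rw [fderiv_add_const]
    have := h.wedge q hq u v
    simp only [neg_apply]
    linarith

theorem exists_isPolarOn {p : E} {r : ℝ} (hr : 0 < r) (hg : ContDiffOn ℝ ∞ g (Metric.ball p r))
    (hn : ∀ q ∈ Metric.ball p r, ‖g q‖ = 1)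
    (h0 : ∀ q ∈ Metric.ball p r, ∀ u, (quatLogDeriv g q u).imI = 0)
    {v : E} (hv : quatLogDeriv g p v ≠ 0) :
    ∃ (r' : ℝ) (ψ s : E → ℝ) (ν : E → E →L[ℝ] ℝ), 0 < r' ∧ r' ≤ r ∧
      IsPolarOn g ψ s ν (Metric.ball p r') := by
  have hre := fun q hq u => re_quatLogDeriv Metric.isOpen_ball hg hn (q := q) hq u
  have hs := contDiffOn_quatLogDeriv Metric.isOpen_ball hg
  have hp : p ∈ Metric.ball p r := Metric.mem_ball_self hr
  obtain ⟨r', ψ, s, ν, hr', hle, h⟩ := exists_isPhaseOn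
    (a := fun q => imJCLM.comp (quatLogDeriv g q)) (b := fun q => imKCLM.comp (quatLogDeriv g q))
    (v := v) hr (contDiffOn_const.clm_comp hs) (contDiffOn_const.clm_comp hs)
    (fun q hq u v => (structure_equations Metric.isOpen_ball hg hn h0 hq u v).1)
    (fun q hq u v => (structure_equations Metric.isOpen_ball hg hn h0 hq u v).2.1)
    (fun q hq u v => (structure_equations Metric.isOpen_ball hg hn h0 hq u v).2.2)
    (fun hz => hv (by
      apply Quaternion.ext
      exacts [hre p hp v, h0 p hp v, hz.1, hz.2]))
  have hsub : Metric.ball p r' ⊆ Metric.ball p r := Metric.ball_subset_ball hle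
  refine ⟨r', ψ, s, ν, hr', hle, hg.mono hsub, h.smooth_phase, h.smooth_coord, h.hasFDerivAt,
    fun q hq u => ?_, h.wedge⟩
  rw [fderiv_eq_quatLogDeriv_mul (hn q (hsub hq)) u]
  congr 1
  have h1 : (quatLogDeriv g q u).imJ = Real.cos (ψ q) * ν q u :=
    congrArg (fun T : E →L[ℝ] ℝ => T u) (h.left_eq q hq)
  have h2 : (quatLogDeriv g q u).imK = Real.sin (ψ q) * ν q u :=
    congrArg (fun T : E →L[ℝ] ℝ => T u) (h.right_eq q hq)
  apply Quaternion.ext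
  · rw [hre q (hsub hq)]; simp [circleJK]
  · rw [h0 q (hsub hq)]; simp [circleJK]
  · rw [h1]; simp [circleJK]; ring
  · rw [h2]; simp [circleJK]; ring

/-- The orientation of the coordinates `(s₊, s₋)` relative to the moving frame. -/
def frameOrientation (f : E → R4) (gp gm : E → ℍ[ℝ]) (νp νm : E → E →L[ℝ] ℝ) (u v : E) (q : E) :
    ℝ :=
  (inner ℝ (frameVec (gp q) (gm q) unitJ) (fderiv ℝ f q v) *
        inner ℝ (frameVec (gp q) (gm q) unitK) (fderiv ℝ f q u) -
      inner ℝ (frameVec (gp q) (gm q) unitK) (fderiv ℝ f q v) *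
        inner ℝ (frameVec (gp q) (gm q) unitJ) (fderiv ℝ f q u)) *
    (νp q u * νm q v - νp q v * νm q u)

/-- A flat surface with flat normal bundle and regular Gauss map has a parallel frame in polar
form, with positively oriented coordinates. -/
theorem exists_polar_frame (hV : IsOpen V) (hf : IsImmersedOn f V)
    (hK : HasZeroCurvaturesOn f V) (hreg : HasRegularGaussMapOn f V)
    (hli : LinearIndependent ℝ ![u₀, v₀]) (hspan : ∀ w : E, ∃ a b : ℝ, w = a • u₀ + b • v₀)
    {p : E} (hp : p ∈ V) :
    ∃ (O : Set E) (gp gm : E → ℍ[ℝ]) (ψp sp ψm sm : E → ℝ) (νp νm : E → E →L[ℝ] ℝ),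
      IsOpen O ∧ p ∈ O ∧ O ⊆ V ∧ IsPolarOn gp ψp sp νp O ∧ IsPolarOn gm ψm sm νm O ∧
      (∀ q ∈ O, IsFramedBy (tangentPlane f q) (gp q) (gm q)) ∧
      ∀ q ∈ O, 0 < frameOrientation f gp gm νp νm u₀ v₀ q := by
  obtain ⟨r, gp, gm, hr, hb, sgp, sgm, hF, hIp, hIm⟩ :=
    exists_parallel_frame hV hf hK hli hspan hp
  have hf' : IsImmersedOn f (Metric.ball p r) :=
    ⟨hf.1.mono hb, fun q hq => hf.2 q (hb hq)⟩
  have hreg' : HasRegularGaussMapOn f (Metric.ball p r) := fun q hq => hreg q (hb hq)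
  have hpr : p ∈ Metric.ball p r := Metric.mem_ball_self hr
  have hker : ∀ q ∈ Metric.ball p r, ∀ h, quatLogDeriv gp q h = 0 → quatLogDeriv gm q h = 0 →
      h = 0 := fun q hq h h1 h2 =>
    eq_zero_of_quatLogDeriv_eq_zero Metric.isOpen_ball hf' sgp sgm hF hreg' hli hq h1 h2
  have hnp := fun q hq => (hF q hq).norm_plus
  have hnm := fun q hq => (hF q hq).norm_minus
  -- Neither logarithmic derivative may vanish at p: the other one has rank at most one there, so
  -- its kernel would be a common kernel.
  have hne : ∀ (g g' : E → ℍ[ℝ]), ContDiffOn ℝ ∞ g' (Metric.ball p r) →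
      (∀ q ∈ Metric.ball p r, ‖g' q‖ = 1) →
      (∀ q ∈ Metric.ball p r, ∀ u, (quatLogDeriv g' q u).imI = 0) →
      (∀ h, quatLogDeriv g p h = 0 → quatLogDeriv g' p h = 0 → h = 0) →
      ∃ v, quatLogDeriv g p v ≠ 0 := by
    intro g g' hg' hn' hI' hk
    by_contra! hz
    obtain ⟨w, hw, h1, h2⟩ := exists_ne_zero_of_wedge_eq_zero hli _ _
      (structure_equations Metric.isOpen_ball hg' hn' hI' hpr u₀ v₀).2.2
    refine hw (hk w (hz w) ?_)
    apply Quaternion.ext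
    exacts [re_quatLogDeriv Metric.isOpen_ball hg' hn' hpr w, hI' p hpr w, h1, h2]
  obtain ⟨vp, hvp⟩ := hne gp gm sgm hnm hIm (hker p hpr)
  obtain ⟨vm, hvm⟩ := hne gm gp sgp hnp hIp (fun h h1 h2 => hker p hpr h h2 h1)
  obtain ⟨r₁, ψp, sp, νp, hr₁, hle₁, hP⟩ := exists_isPolarOn hr sgp hnp hIp hvp
  obtain ⟨r₂, ψm, sm, νm, hr₂, hle₂, hM⟩ := exists_isPolarOn hr sgm hnm hIm hvm
  set B := Metric.ball p (min r₁ r₂) with hB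
  have oB : IsOpen B := Metric.isOpen_ball
  have pB : p ∈ B := Metric.mem_ball_self (lt_min hr₁ hr₂)
  have hP' : IsPolarOn gp ψp sp νp B := hP.mono (Metric.ball_subset_ball (min_le_left _ _))
  have hM' : IsPolarOn gm ψm sm νm B := hM.mono (Metric.ball_subset_ball (min_le_right _ _))
  have hBr : B ⊆ Metric.ball p r := Metric.ball_subset_ball ((min_le_left _ _).trans hle₁)
  have hFB : ∀ q ∈ B, IsFramedBy (tangentPlane f q) (gp q) (gm q) := fun q hq => hF q (hBr hq)
  have hT := isOrthonormalFrameOn_tangent oB (sgp.mono hBr) (sgm.mono hBr) hFB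
  have hνs : ∀ {s : E → ℝ} {ν : E → E →L[ℝ] ℝ} (_ : ContDiffOn ℝ ∞ s B)
      (_ : ∀ q ∈ B, HasFDerivAt s (ν q) q) (u : E), ContinuousOn (fun q => ν q u) B := by
    intro s ν hs hd u
    exact (contDiffOn_fderiv_apply oB hs u).continuousOn.congr fun q hq => by
      change ν q u = fderiv ℝ s q u
      rw [(hd q hq).fderiv]
  have hfs : ∀ u, ContDiffOn ℝ ∞ (fun q => fderiv ℝ f q u) B :=
    contDiffOn_fderiv_apply oB (hf'.1.mono hBr)
  have hcont : ∀ {ν : E → E →L[ℝ] ℝ}, (∀ u, ContinuousOn (fun q => ν q u) B) →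
      ContinuousOn (frameOrientation f gp gm ν νm u₀ v₀) B := by
    intro ν hν
    have hm := hνs hM'.smooth_coord hM'.hasFDerivAt
    exact ((((hT.smooth_one.inner ℝ (hfs v₀)).mul (hT.smooth_two.inner ℝ (hfs u₀))).sub
      ((hT.smooth_two.inner ℝ (hfs v₀)).mul (hT.smooth_one.inner ℝ (hfs u₀)))).continuousOn).mul
      (((hν u₀).mul (hm v₀)).sub ((hν v₀).mul (hm u₀)))
  have hne0 : frameOrientation f gp gm νp νm u₀ v₀ p ≠ 0 := by
    apply mul_ne_zero
    · intro h
      have := areaSq_pos f (hf.2 p hp) hli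
      rw [areaSq_eq hT pB, h] at this
      norm_num at this
    · intro h
      obtain ⟨w, hw, h1, h2⟩ := exists_ne_zero_of_wedge_eq_zero hli _ _ (sub_eq_zero.1 h)
      refine hw (hker p hpr w ?_ ?_)
      · rw [quatLogDeriv_apply, hP'.fderiv_frame p pB, h1]; simp
      · rw [quatLogDeriv_apply, hM'.fderiv_frame p pB, h2]; simp
  have main : ∀ {ψ s : E → ℝ} {ν : E → E →L[ℝ] ℝ}, IsPolarOn gp ψ s ν B →
      0 < frameOrientation f gp gm ν νm u₀ v₀ p →
      ∃ (O : Set E) (gp gm : E → ℍ[ℝ]) (ψp sp ψm sm : E → ℝ) (νp νm : E → E →L[ℝ] ℝ),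
      IsOpen O ∧ p ∈ O ∧ O ⊆ V ∧ IsPolarOn gp ψp sp νp O ∧ IsPolarOn gm ψm sm νm O ∧
      (∀ q ∈ O, IsFramedBy (tangentPlane f q) (gp q) (gm q)) ∧
      ∀ q ∈ O, 0 < frameOrientation f gp gm νp νm u₀ v₀ q := by
    intro ψ s ν h hpos
    refine ⟨B ∩ frameOrientation f gp gm ν νm u₀ v₀ ⁻¹' Set.Ioi 0, gp, gm, ψ, s, ψm, sm, ν, νm,
      (hcont (hνs h.smooth_coord h.hasFDerivAt)).isOpen_inter_preimage oB isOpen_Ioi,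
      ⟨pB, hpos⟩, fun q hq => hb (hBr hq.1), h.mono Set.inter_subset_left,
      hM'.mono Set.inter_subset_left, fun q hq => hFB q hq.1, fun q hq => hq.2⟩
  rcases lt_or_gt_of_ne hne0 with h | h
  -- Reversing s₊ alone changes the sign of the orientation.
  · refine main hP'.flip ?_
    have e : frameOrientation f gp gm (fun q => -νp q) νm u₀ v₀ p =
        -frameOrientation f gp gm νp νm u₀ v₀ p := by
      simp [frameOrientation]; ring
    rw [e]; linarith
  · exact main hP' h

end Polar

/-! ### Adapted coordinates -/

section Adapted

variable {f : R2 → R4} {u₀ v₀ : R2} {gp gm : R2 → ℍ[ℝ]} {ψp sp ψm sm : R2 → ℝ}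
  {νp νm : R2 → R2 →L[ℝ] ℝ} {O : Set R2}

namespace LorentzNumber

theorem contDiffOn_ofPlusMinus {E : Type*} [NormedAddCommGroup E] [NormedSpace ℝ E]
    {s t : E → ℝ} {O : Set E} (hs : ContDiffOn ℝ ∞ s O) (ht : ContDiffOn ℝ ∞ t O) :
    ContDiffOn ℝ ∞ (fun q => ofPlusMinus (s q) (t q)) O :=
  (hs.smul contDiffOn_const).add (ht.smul contDiffOn_const)

/-- The linear map with given idempotent components. -/
def clmOfPlusMinus {E : Type*} [NormedAddCommGroup E] [NormedSpace ℝ E] (s t : E →L[ℝ] ℝ) :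
    E →L[ℝ] LorentzNumber := s.smulRight ePlus + t.smulRight eMinus

theorem clmOfPlusMinus_apply {E : Type*} [NormedAddCommGroup E] [NormedSpace ℝ E]
    (s t : E →L[ℝ] ℝ) (h : E) : clmOfPlusMinus s t h = ofPlusMinus (s h) (t h) := rfl

theorem hasFDerivAt_ofPlusMinus {E : Type*} [NormedAddCommGroup E] [NormedSpace ℝ E]
    {s t : E → ℝ} {s' t' : E →L[ℝ] ℝ} {q : E} (hs : HasFDerivAt s s' q) (ht : HasFDerivAt t t' q) :
    HasFDerivAt (fun q => ofPlusMinus (s q) (t q)) (clmOfPlusMinus s' t') q :=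
  (hs.smul_const ePlus).add (ht.smul_const eMinus)

theorem finrank_eq : Module.finrank ℝ LorentzNumber = 2 := QuadraticAlgebra.finrank_eq_two 1 0

end LorentzNumber

theorem exists_linearEquiv_of_wedge_ne_zero (hspan : ∀ w : R2, ∃ a b : ℝ, w = a • u₀ + b • v₀)
    (s t : R2 →L[ℝ] ℝ) (h : s u₀ * t v₀ - s v₀ * t u₀ ≠ 0) :
    ∃ A : R2 ≃L[ℝ] LorentzNumber,
      (A : R2 →L[ℝ] LorentzNumber) = LorentzNumber.clmOfPlusMinus s t := by
  have hinj : Function.Injective (LorentzNumber.clmOfPlusMinus s t : R2 →ₗ[ℝ] LorentzNumber) := by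
    rw [← LinearMap.ker_eq_bot, LinearMap.ker_eq_bot']
    intro w hw
    have hw' : LorentzNumber.ofPlusMinus (s w) (t w) = 0 := hw
    have h1 : s w = 0 := by simpa using congrArg LorentzNumber.plus hw'
    have h2 : t w = 0 := by simpa using congrArg LorentzNumber.minus hw'
    obtain ⟨a, b, rfl⟩ := hspan w
    simp only [map_add, map_smul, smul_eq_mul] at h1 h2
    have ha : a = 0 := by
      apply mul_right_cancel₀ h
      linear_combination t v₀ * h1 - s v₀ * h2
    have hb : b = 0 := by
      apply mul_right_cancel₀ h
      linear_combination s u₀ * h2 - t u₀ * h1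
    simp [ha, hb]
  have hfr : Module.finrank ℝ R2 = Module.finrank ℝ LorentzNumber := by
    rw [LorentzNumber.finrank_eq]; simp
  exact ⟨(LinearEquiv.ofInjectiveOfFinrankEq _ hinj hfr).toContinuousLinearEquiv, by
    ext1 x; rfl⟩

/-- The coordinates `s₊, s₋` of a parallel frame in polar form give the representation. -/
theorem exists_chart_of_polar_frame (hO : IsOpen O) (hf : ContDiffOn ℝ ∞ f O)
    (hspan : ∀ w : R2, ∃ a b : ℝ, w = a • u₀ + b • v₀)
    (hP : IsPolarOn gp ψp sp νp O) (hM : IsPolarOn gm ψm sm νm O)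
    (hF : ∀ q ∈ O, IsFramedBy (tangentPlane f q) (gp q) (gm q))
    (hor : ∀ q ∈ O, 0 < frameOrientation f gp gm νp νm u₀ v₀ q) {p : R2} (hp : p ∈ O) :
    ∃ χ : OpenPartialHomeomorph R2 LorentzNumber, p ∈ χ.source ∧ χ.source ⊆ O ∧
      ContDiffOn ℝ ∞ χ χ.source ∧ ContDiffOn ℝ ∞ χ.symm χ.target ∧
      ∃ (ψ : LorentzNumber → LorentzNumber) (l m : LorentzNumber → ℝ)
        (g : LorentzNumber → LorentzQuaternion)
        (ω₂ ω₃ : LorentzNumber → (LorentzNumber →L[ℝ] ℝ)),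
        IsRepresentationData χ.target ψ l m g ω₂ ω₃ ∧
        IsPrimitiveOn (f ∘ χ.symm) (representationForm g ω₂ ω₃) χ.target := by
  let S : R2 → LorentzNumber := fun q => LorentzNumber.ofPlusMinus (sp q) (sm q)
  have hS : ContDiffOn ℝ ∞ S O :=
    LorentzNumber.contDiffOn_ofPlusMinus hP.smooth_coord hM.smooth_coord
  have hA : ∀ q ∈ O, ∃ A : R2 ≃L[ℝ] LorentzNumber,
      (A : R2 →L[ℝ] LorentzNumber) = LorentzNumber.clmOfPlusMinus (νp q) (νm q) :=
    fun q hq => exists_linearEquiv_of_wedge_ne_zero hspan _ _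
      (right_ne_zero_of_mul (hor q hq).ne')
  have : Nonempty (R2 ≃L[ℝ] LorentzNumber) := ⟨(hA p hp).choose⟩
  choose! A hA using hA
  have hdS : ∀ q ∈ O, HasFDerivAt S (A q : R2 →L[ℝ] LorentzNumber) q := fun q hq => by
    rw [hA q hq]
    exact LorentzNumber.hasFDerivAt_ofPlusMinus (hP.hasFDerivAt q hq) (hM.hasFDerivAt q hq)
  have hS' : ∀ q ∈ O, ContDiffAt ℝ ∞ S q := fun q hq => hS.contDiffAt (hO.mem_nhds hq)
  let e := ((hS' p hp).toOpenPartialHomeomorph S (hdS p hp) (by simp)).restrOpen O hO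
  have heS : ∀ q, e q = S q := fun q => rfl
  have hpe : p ∈ e.source :=
    ⟨(hS' p hp).mem_toOpenPartialHomeomorph_source (hdS p hp) (by simp), hp⟩
  have heO : e.source ⊆ O := fun q hq => hq.2
  have htO : ∀ a ∈ e.target, e.symm a ∈ O := fun a ha => heO (e.map_target ha)
  have hde : ∀ a ∈ e.target,
      HasFDerivAt e.symm ((A (e.symm a)).symm : LorentzNumber →L[ℝ] R2) a := fun a ha =>
    e.hasFDerivAt_symm ha (hdS _ (htO a ha))
  have hes : ContDiffOn ℝ ∞ e.symm e.target := fun a ha =>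
    (e.contDiffAt_symm ha (hdS _ (htO a ha)) (hS' _ (htO a ha))).contDiffWithinAt
  -- In the new chart ds₊ and ds₋ are the idempotent coefficients of da, so proportionality to ds±
  -- componentwise is the same as 𝒜-linearity.
  have hν : ∀ a ∈ e.target, ∀ k, νp (e.symm a) ((A (e.symm a)).symm k) = LorentzNumber.plus k ∧
      νm (e.symm a) ((A (e.symm a)).symm k) = LorentzNumber.minus k := by
    intro a ha k
    have h1 : LorentzNumber.ofPlusMinus (νp (e.symm a) ((A (e.symm a)).symm k))
        (νm (e.symm a) ((A (e.symm a)).symm k)) = k := by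
      rw [← LorentzNumber.clmOfPlusMinus_apply, ← hA _ (htO a ha)]
      exact (A (e.symm a)).apply_symm_apply k
    exact ⟨by simpa using congrArg LorentzNumber.plus h1,
      by simpa using congrArg LorentzNumber.minus h1⟩
  have hcomp : ∀ {G : Type} [NormedAddCommGroup G] [NormedSpace ℝ G] {φ : R2 → G},
      ContDiffOn ℝ ∞ φ O → ∀ a ∈ e.target, ∀ k, fderiv ℝ (φ ∘ e.symm) a k =
        fderiv ℝ φ (e.symm a) ((A (e.symm a)).symm k) := by
    intro G _ _ φ hφ a ha k
    rw [((hφ.differentiableAt_of_isOpen hO (htO a ha)).hasFDerivAt.comp a (hde a ha)).fderiv]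
    rfl
  have hsm : ∀ {G : Type} [NormedAddCommGroup G] [NormedSpace ℝ G] {φ : R2 → G},
      ContDiffOn ℝ ∞ φ O → ContDiffOn ℝ ∞ (φ ∘ e.symm) e.target := fun hφ =>
    hφ.comp hes htO
  have hT := isOrthonormalFrameOn_tangent hO hP.smooth_frame hM.smooth_frame hF
  let ψ : LorentzNumber → LorentzNumber := fun a =>
    LorentzNumber.ofPlusMinus (ψp (e.symm a)) (ψm (e.symm a))
  have hψ : IsLorentzConformalOn ψ e.target := by
    refine isLorentzConformalOn_of_fderiv (LorentzNumber.contDiffOn_ofPlusMinus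
      (hsm hP.smooth_phase) (hsm hM.smooth_phase))
      (fun a => LorentzNumber.ofPlusMinus
        (fderiv ℝ ψp (e.symm a) ((A (e.symm a)).symm 1))
        (fderiv ℝ ψm (e.symm a) ((A (e.symm a)).symm 1))) fun a ha k => ?_
    have hd1 := ((hsm hP.smooth_phase).differentiableAt_of_isOpen e.open_target ha).hasFDerivAt
    have hd2 := ((hsm hM.smooth_phase).differentiableAt_of_isOpen e.open_target ha).hasFDerivAt
    have e1 : fderiv ℝ ψ a k = LorentzNumber.ofPlusMinus (fderiv ℝ (ψp ∘ e.symm) a k)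
        (fderiv ℝ (ψm ∘ e.symm) a k) := by
      rw [(LorentzNumber.hasFDerivAt_ofPlusMinus hd1 hd2 : HasFDerivAt ψ _ a).fderiv]; rfl
    -- Taking 1 as second vector in dψ± ∧ ds± = 0 gives dψ±(k) = ds±(k) dψ±(1), which is
    -- conformality of ψ.
    have w1 := hP.wedge _ (htO a ha) ((A (e.symm a)).symm k) ((A (e.symm a)).symm 1)
    have w2 := hM.wedge _ (htO a ha) ((A (e.symm a)).symm k) ((A (e.symm a)).symm 1)
    rw [(hν a ha k).1, (hν a ha 1).1, LorentzNumber.plus_one, mul_one] at w1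
    rw [(hν a ha k).2, (hν a ha 1).2, LorentzNumber.minus_one, mul_one] at w2
    rw [e1, hcomp hP.smooth_phase a ha, hcomp hM.smooth_phase a ha, w1, w2, smul_eq_mul]
    apply LorentzNumber.ext_plus_minus
    · simp [mul_comm]
    · simp [mul_comm]
  obtain ⟨l, m, g, ω₂, ω₃, hd, hF'⟩ := exists_isRepresentationData_of_adapted (ψ := ψ)
    (gp := gp ∘ e.symm) (gm := gm ∘ e.symm) (F := f ∘ e.symm) e.open_target hψ
    (hsm hP.smooth_frame) (hsm hM.smooth_frame) (hsm hf)
    (fun a ha => (hF _ (htO a ha)).norm_plus) (fun a ha => (hF _ (htO a ha)).norm_minus)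
    (fun a ha k => by
      rw [hcomp hP.smooth_frame a ha, hP.fderiv_frame _ (htO a ha), (hν a ha k).1]
      simp [ψ])
    (fun a ha k => by
      rw [hcomp hM.smooth_frame a ha, hM.fderiv_frame _ (htO a ha), (hν a ha k).2]
      simp [ψ])
    (fun a ha k => by
      rw [frameComponent_apply, frameComponent_apply, hcomp hf a ha, frameVec_add, frameVec_smul,
        frameVec_smul]
      exact ((hT.starProjection_eq _ (htO a ha) _).symm.trans
        (Submodule.starProjection_eq_self_iff.2 (fderiv_mem_tangentPlane f _ _))).symm)
    (fun a ha => by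
      simp only [frameComponent_apply]
      rw [hcomp hf a ha, hcomp hf a ha]
      have h1 := hν a ha 1
      have h2 := hν a ha LorentzNumber.sigma
      have h0 := hor _ (htO a ha)
      obtain ⟨x, y, hxy⟩ := hspan ((A (e.symm a)).symm 1)
      obtain ⟨z, w, hzw⟩ := hspan ((A (e.symm a)).symm LorentzNumber.sigma)
      rw [hxy] at h1 ⊢
      rw [hzw] at h2 ⊢
      simp only [Function.comp_apply, map_add, map_smul, inner_add_right, inner_smul_right,
        smul_eq_mul, LorentzNumber.plus_one, LorentzNumber.minus_one, LorentzNumber.plus_sigma,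
        LorentzNumber.minus_sigma] at h1 h2 ⊢
      unfold frameOrientation at h0
      obtain ⟨h1, h1'⟩ := h1
      obtain ⟨h2, h2'⟩ := h2
      generalize inner ℝ (frameVec (gp (e.symm a)) (gm (e.symm a)) unitJ)
        (fderiv ℝ f (e.symm a) u₀) = j₁ at *
      generalize inner ℝ (frameVec (gp (e.symm a)) (gm (e.symm a)) unitJ)
        (fderiv ℝ f (e.symm a) v₀) = j₂ at *
      generalize inner ℝ (frameVec (gp (e.symm a)) (gm (e.symm a)) unitK)
        (fderiv ℝ f (e.symm a) u₀) = k₁ at *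
      generalize inner ℝ (frameVec (gp (e.symm a)) (gm (e.symm a)) unitK)
        (fderiv ℝ f (e.symm a) v₀) = k₂ at *
      generalize νp (e.symm a) u₀ = n₁ at *
      generalize νp (e.symm a) v₀ = n₂ at *
      generalize νm (e.symm a) u₀ = m₁ at *
      generalize νm (e.symm a) v₀ = m₂ at *
      -- The determinant of (ds₊, ds₋) on the coordinate vectors of 1 and σ is 1·(-1) - 1·1 = -2.
      -- Its fixed sign transfers the positivity of `frameOrientation` from the basis (u₀, v₀) to
      -- (1, σ).
      have hdet : (x * w - y * z) * (n₁ * m₂ - n₂ * m₁) = -2 := by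
        calc _ = (x * n₁ + y * n₂) * (z * m₁ + w * m₂) -
            (z * n₁ + w * n₂) * (x * m₁ + y * m₂) := by ring
          _ = -2 := by rw [h1, h1', h2, h2']; norm_num
      have hD : x * w - y * z ≠ 0 := fun h => by rw [h] at hdet; norm_num at hdet
      have hpos := mul_pos h0 (pow_pos (abs_pos.2 hD) 2)
      rw [sq_abs] at hpos
      nlinarith [hpos, hdet])
  exact ⟨e, hpe, heO, hS.mono heO, hes, ψ, l, m, g, ω₂, ω₃, hd, hF'⟩

end Adapted

/-! ### Immersions of abstract surfaces in charts -/

section Charts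

variable {M : Type*} [TopologicalSpace M] [ChartedSpace R2 M] [IsManifold 𝓘(ℝ, R2) ∞ M]
  {F : M → R4}

theorem IsSurfaceImmersion.isImmersedOn_chartAt (hF : IsSurfaceImmersion F) (p : M) :
    IsImmersedOn (F ∘ (chartAt R2 p).symm) (chartAt R2 p).target := by
  have hM : IsManifold 𝓘(ℝ, R2) 1 M := IsManifold.of_le (n := ∞) (by simp)
  have hs : ContMDiffOn 𝓘(ℝ, R2) 𝓘(ℝ, R4) ∞ (F ∘ (chartAt R2 p).symm) (chartAt R2 p).target :=
    hF.1.comp_contMDiffOn contMDiffOn_chart_symm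
  refine ⟨hs.contDiffOn, fun q hq => ?_⟩
  have hc := mdifferentiable_chart (I := 𝓘(ℝ, R2)) p
  have h1 : Function.Injective (mfderiv 𝓘(ℝ, R2) 𝓘(ℝ, R2) (chartAt R2 p).symm q) :=
    hc.symm.mfderiv_injective hq
  rw [← mfderiv_eq_fderiv, mfderiv_comp q (hF.1.mdifferentiableAt (by simp))
    (hc.mdifferentiableAt_symm hq)]
  exact (hF.2 _).comp h1

/-- The representation of a flat surface with flat normal bundle and regular Gauss map. -/
theorem exists_representation_chart (hF : IsSurfaceImmersion F) (hK : SurfaceHasZeroCurvatures F)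
    (hreg : SurfaceHasRegularGaussMap F) (p : M) :
    ∃ c : OpenPartialHomeomorph M LorentzNumber, p ∈ c.source ∧
      ContMDiffOn 𝓘(ℝ, R2) 𝓘(ℝ, LorentzNumber) ∞ c c.source ∧
      ContMDiffOn 𝓘(ℝ, LorentzNumber) 𝓘(ℝ, R2) ∞ c.symm c.target ∧
      ∃ (ψ : LorentzNumber → LorentzNumber) (l m : LorentzNumber → ℝ)
        (g : LorentzNumber → LorentzQuaternion)
        (ω₂ ω₃ : LorentzNumber → (LorentzNumber →L[ℝ] ℝ)),
        IsRepresentationData c.target ψ l m g ω₂ ω₃ ∧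
        IsPrimitiveOn (F ∘ c.symm) (representationForm g ω₂ ω₃) c.target := by
  have hp := mem_chart_target R2 p
  set c₀ := chartAt R2 p with hc₀
  have hf := hF.isImmersedOn_chartAt p
  let b := (EuclideanSpace.basisFun (Fin 2) ℝ).toBasis
  have hli : LinearIndependent ℝ ![b 0, b 1] := by
    have : ![b 0, b 1] = b := by ext1 i; fin_cases i <;> rfl
    rw [this]; exact b.linearIndependent
  have hspan : ∀ w : R2, ∃ x y : ℝ, w = x • b 0 + y • b 1 := fun w =>
    ⟨b.repr w 0, b.repr w 1, by conv_lhs => rw [← b.sum_repr w, Fin.sum_univ_two]⟩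
  obtain ⟨O, gp, gm, ψp, sp, ψm, sm, νp, νm, hO, hpO, hOV, hP, hM, hFr, hor⟩ :=
    exists_polar_frame c₀.open_target hf (hK c₀ (chart_mem_atlas R2 p))
      (hreg c₀ (chart_mem_atlas R2 p)) hli hspan hp
  obtain ⟨χ, hpχ, hχO, sχ, sχ', hdata⟩ := exists_chart_of_polar_frame hO (hf.1.mono hOV) hspan hP hM
    hFr hor hpO
  have hχ : χ.source ⊆ c₀.target := hχO.trans hOV
  -- The domain of χ lies in the image of the original chart, so composing the two shrinks nothing
  -- and the data live on the full target.
  have htarget : (c₀.trans χ).target = χ.target := by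
    rw [OpenPartialHomeomorph.trans_target]
    exact Set.inter_eq_left.2 fun a ha => hχ (χ.map_target ha)
  refine ⟨c₀.trans χ, ⟨mem_chart_source R2 p, hpχ⟩, ?_, ?_, ?_⟩
  · exact sχ.contMDiffOn.comp (contMDiffOn_chart.mono fun q hq => hq.1) fun q hq => hq.2
  · rw [htarget]
    exact contMDiffOn_chart_symm.comp sχ'.contMDiffOn fun a ha => hχ (χ.map_target ha)
  · rw [htarget]
    exact hdata

end Charts

end

theorem mainTheorem3 :
    -- the direct statement
    (∀ (U : Set LorentzNumber) (ψ : LorentzNumber → LorentzNumber) (l m : LorentzNumber → ℝ)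
        (g : LorentzNumber → LorentzQuaternion)
        (ω₂ ω₃ : LorentzNumber → (LorentzNumber →L[ℝ] ℝ)),
        IsOpen U → IsRepresentationData U ψ l m g ω₂ ω₃ →
        (SimplyConnectedSpace U →
          ∃ F : LorentzNumber → R4, IsPrimitiveOn F (representationForm g ω₂ ω₃) U) ∧
        ∀ F : LorentzNumber → R4, IsPrimitiveOn F (representationForm g ω₂ ω₃) U →
          IsImmersedOn F U ∧ HasZeroCurvaturesOn F U) ∧
    -- the converse
    (∀ (M : Type*) [TopologicalSpace M] [ChartedSpace R2 M] [IsManifold 𝓘(ℝ, R2) ∞ M]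
        (F : M → R4),
        IsSurfaceImmersion F → SurfaceHasZeroCurvatures F → SurfaceHasRegularGaussMap F →
        ∀ p : M, ∃ c : OpenPartialHomeomorph M LorentzNumber,
          p ∈ c.source ∧
          ContMDiffOn 𝓘(ℝ, R2) 𝓘(ℝ, LorentzNumber) ∞ c c.source ∧
          ContMDiffOn 𝓘(ℝ, LorentzNumber) 𝓘(ℝ, R2) ∞ c.symm c.target ∧
          ∃ (ψ : LorentzNumber → LorentzNumber) (l m : LorentzNumber → ℝ)
            (g : LorentzNumber → LorentzQuaternion)
            (ω₂ ω₃ : LorentzNumber → (LorentzNumber →L[ℝ] ℝ)),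
            IsRepresentationData c.target ψ l m g ω₂ ω₃ ∧
            IsPrimitiveOn (F ∘ c.symm) (representationForm g ω₂ ω₃) c.target) := by
  refine ⟨fun U ψ l m g ω₂ ω₃ hU h => ⟨fun _ => h.exists_isPrimitiveOn hU, fun F hF =>
    h.isImmersedOn_and_hasZeroCurvaturesOn hU hF⟩, ?_⟩
  intro M _ _ _ F hF hK hreg p
  exact exists_representation_chart hF hK hreg p
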